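/- **Conventions.** A gap problem is given by a set of YES strings and a set of NO strings over a finite alphabet; it is NP-hard (to distinguish the two) if every language in NP has a polynomial-time many-one reduction to it, mapping members to YES strings and non-members to NO strings. Instances are written in binary; coordinates of points are rational. **Johnson Coverage.** For $\alpha\in\mathbb R$ and integers $z>y\ge 1$, an instance of $(\alpha,z,y)$-Johnson Coverage is a number $n$, a nonempty collection $E\subseteq\binom{[n]}{z}$ and an integer $k\ge 0$. For $S_1,\dots,S_k\in\binom{[n]}{y}$ let $\mathrm{cov}(S_1,\dots,S_k)=\{T\in E: S_i\subseteq T\text{ for some }i\}$. The instance is a YES instance if $\mathrm{cov}(S_1,\dots,S_k)=E$ for some $S_1,\dots,S_k\in\binom{[n]}{y}$, and a NO instance if $|\mathrm{cov}(S_1,\dots,S_k)|\le\alpha|E|$ for all $S_1,\dots,S_k\in\binom{[n]}{y}$. The Johnson Coverage Hypothesis (JCH) states that for every $\varepsilon>0$ there is an integer $z\ge 2$ such that $(1-\frac1e+\varepsilon,\,z,\,z-1)$-Johnson Coverage is NP-hard. **Gap numbers.** Let $p\in[1,\infty)$ and $q\ge t\ge r$. Let $J(q,t,r)$ be the bipartite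 graph with sides $\binom{[q]}{t}$ and $\binom{[q]}{r}$ in which $T\in\binom{[q]}{t}$ and $S\in\binom{[q]}{r}$ are adjacent iff $S\subseteq T$. For a bipartite graph $G$ with sides $A,B$, let $g_p(G)\in[1,\infty]$ be the supremum of all real $\lambda\ge1$ for which there are a finite $d$, a map $\tau:A\sqcup B\to\mathbb R^d$ and a $\beta>0$ such that $\|\tau(u)-\tau(v)\|_p=\beta$ for adjacent $u\in A$, $v\in B$, and $\|\tau(u)-\tau(v)\|_p\ge\lambda\beta$ for non-adjacent $u\in A$, $v\in B$. For $\Delta\ge1$ put $$\gamma_{p,\Delta}=\inf_{q\ge t\ge\Delta+1} g_p(J(q,t,t-\Delta)),\qquad \zeta_2(p,\Delta,\alpha)=1+(1-\alpha)(\gamma_{p,\Delta}^2-1),\qquad \zeta_2(p)=\zeta_2(p,1,1-\tfrac1e).$$ **Discrete $k$-means.** For $p\ge 1$, a real number $c$, and constants $\rho>0$, $K\in\mathbb R$, $s\in\mathbb N$, consider instances consisting of a set $\mathcal P\subset\mathbb Q^d$ of $n\ge2$ points, a set $\mathcal C\subset\mathbb Q^d$ of $m$ candidate centers and an integer $1\le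 k\le m$, where $d\le K\log n$ and $m\le n^s$. The instance is a YES instance if there are $c_1,\dots,c_k\in\mathcal C$ and $\sigma:\mathcal P\to\{c_1,\dots,c_k\}$ with $$\sum_{a\in\mathcal P}\|a-\sigma(a)\|_p^2\le\rho\, n(\log n)^{2/p},$$ and a NO instance if for all $c_1,\dots,c_k\in\mathcal C$ and all $\sigma:\mathcal P\to\{c_1,\dots,c_k\}$ $$\sum_{a\in\mathcal P}\|a-\sigma(a)\|_p^2\ge c\cdot\rho\, n(\log n)^{2/p}.$$ We say that discrete $k$-means in $O(\log n)$-dimensional $\ell_p$ with $\mathrm{poly}(n)$ candidate centers is NP-hard to approximate within the factor $c$ if for some constants $\rho>0$, $K$, $s$ it is NP-hard to distinguish these YES and NO instances. **Theorem.** 1. Let $p\in[1,\infty)$, $\alpha\in\mathbb R$, and let $z>y\ge1$ be integers. If $(\alpha,z,y)$-Johnson Coverage is NP-hard, then for every $\varepsilon>0$, discrete $k$-means in $O(\log n)$-dimensional $\ell_p$ with $\mathrm{poly}(n)$ candidate centers is NP-hard to approximate within the factor $\zeta_2(p,z-y,\alpha)-\varepsilon$. 2. In particular, assuming JCH, for every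 $p\in[1,\infty)$ and $\varepsilon>0$ this problem is NP-hard to approximate within the factor $\zeta_2(p)-\varepsilon$. 3. One has $\zeta_2(1)\ge 3.94$ and $\zeta_2(2)\ge 1.73$; assuming JCH, the problem is NP-hard to approximate within the factor $3.94$ in $\ell_1$ and within the factor $1.73$ in $\ell_2$. -/

import Mathlib

open Computability

/-! ### Polynomial time, NP, and NP-hardness of gap (promise) problems -/

/-- `f` is computed, under the encodings `ea` and `eb`, by a Turing machine that runs in time
polynomial in the length of the encoded input. -/
def PolyTimeComputable {A B Γ₀ Γ₁ : Type} (ea : A → List Γ₀) (eb : B → List Γ₁) (f : A → B) :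
    Prop :=
  Nonempty (Turing.TM2ComputableInPolyTime ea eb f)

/-- A pair of bit strings, written as one string with a separator (the symbol `none`). -/
def encodeBitPair (x : List Bool × List Bool) : List (Option Bool) :=
  x.1.map some ++ none :: x.2.map some

/-- The class NP: languages with a polynomial-time verifier and certificates of polynomial
length. -/
def InNP (L : Set (List Bool)) : Prop :=
  ∃ (V : List Bool × List Bool → Bool) (b : Polynomial ℕ),
    PolyTimeComputable encodeBitPair encodeBool V ∧
      ∀ x, x ∈ L ↔ ∃ w : List Bool, w.length ≤ b.eval x.length ∧ V (x, w) = true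

/-- A gap problem over the alphabet `Γ`: strings that have to be accepted (the completeness case)
and strings that have to be rejected (the soundness case). -/
structure GapProblem (Γ : Type) where
  yes : Set (List Γ)
  no : Set (List Γ)

/-- It is NP-hard to distinguish the two cases of `Q`: every language in NP has a polynomial-time
many-one reduction to `Q`. -/
def GapProblem.NPHard {Γ : Type} (Q : GapProblem Γ) : Prop :=
  ∀ L : Set (List Bool), InNP L →
    ∃ f : List Bool → List Γ, PolyTimeComputable id id f ∧
      (∀ x ∈ L, f x ∈ Q.yes) ∧ (∀ x ∉ L, f x ∈ Q.no)

/-! ### Writing instances as strings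

The alphabet `Γ'` consists of the two bits, brackets, a comma and a blank. -/

/-- A natural number in binary, closed by a comma. -/
def writeNat (n : ℕ) : List Γ' := (encodeNat n).map Γ'.bit ++ [Γ'.comma]

/-- An integer: a sign bit, then its absolute value. -/
def writeInt (a : ℤ) : List Γ' := Γ'.bit (decide (a < 0)) :: writeNat a.natAbs

/-- A rational number: numerator and denominator in lowest terms. -/
def writeRat (r : ℚ) : List Γ' := writeInt r.num ++ writeNat r.den

/-- A list, between brackets. -/
def writeList {A : Type} (f : A → List Γ') (l : List A) : List Γ' :=
  Γ'.bra :: (l.flatMap f ++ [Γ'.ket])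

/-! ### Johnson Coverage -/

/-- An instance of Johnson Coverage with `z`-sets: a universe with `n` elements, a nonempty
collection `E` of `z`-subsets of it (listed without repetition), and a parameter `k`. -/
structure JohnsonInstance (z : ℕ) where
  n : ℕ
  E : List (Finset (Fin n))
  k : ℕ
  card_eq : ∀ T ∈ E, T.card = z
  nodup : E.Nodup
  nonempty : E ≠ []

/-- `n`, the sets of `E` (each one written by its elements in increasing order), and `k`. -/
def JohnsonInstance.write {z : ℕ} (I : JohnsonInstance z) : List Γ' :=
  writeNat I.n ++
    writeList (fun T : Finset (Fin I.n) =>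
      writeList (fun u : Fin I.n => writeNat u) (T.sort (· ≤ ·))) I.E ++
    writeNat I.k

/-- The sets of `E` that contain `S`. -/
def cov {n : ℕ} (S : Finset (Fin n)) (E : Finset (Finset (Fin n))) : Finset (Finset (Fin n)) :=
  E.filter (fun T => S ⊆ T)

/-- The sets of `E` that contain at least one of `S₁, …, S_k`. -/
def covFamily {n k : ℕ} (S : Fin k → Finset (Fin n)) (E : Finset (Finset (Fin n))) :
    Finset (Finset (Fin n)) :=
  Finset.univ.biUnion fun i => cov (S i) E

/-- Completeness: some `k` sets of size `y` cover all of `E`. -/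
def JohnsonInstance.Complete {z : ℕ} (I : JohnsonInstance z) (y : ℕ) : Prop :=
  ∃ S : Fin I.k → Finset (Fin I.n), (∀ i, (S i).card = y) ∧
    covFamily S I.E.toFinset = I.E.toFinset

/-- Soundness: any `k` sets of size `y` cover at most an `α` fraction of `E`. -/
def JohnsonInstance.Sound {z : ℕ} (I : JohnsonInstance z) (α : ℝ) (y : ℕ) : Prop :=
  ∀ S : Fin I.k → Finset (Fin I.n), (∀ i, (S i).card = y) →
    ((covFamily S I.E.toFinset).card : ℝ) ≤ α * (I.E.toFinset.card : ℝ)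

/-- The `(α, z, y)`-Johnson Coverage problem. -/
def johnsonCoverage (α : ℝ) (z y : ℕ) : GapProblem Γ' where
  yes := {w | ∃ I : JohnsonInstance z, w = I.write ∧ I.Complete y}
  no := {w | ∃ I : JohnsonInstance z, w = I.write ∧ I.Sound α y}

/-- The Johnson Coverage Hypothesis. -/
def JohnsonCoverageHypothesis : Prop :=
  ∀ ε : ℝ, 0 < ε → ∃ z : ℕ, 2 ≤ z ∧ (johnsonCoverage (1 - 1 / Real.exp 1 + ε) z (z - 1)).NPHard

/-! ### Gap numbers of Johnson incidence graphs -/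

/-- The distance of the `ℓ_p`-metric on `ℝ^d`. -/
noncomputable def lpDist (p : ℝ) {d : ℕ} (a b : Fin d → ℝ) : ℝ :=
  (∑ i, |a i - b i| ^ p) ^ (1 / p)

/-- `τ` is a `lam`-gap-realization, in the `ℓ_p`-metric on `ℝ^d`, of the bipartite graph with
sides `A`, `B` and edge relation `Adj`: for some `β > 0`, edges have length exactly `β`, and
non-edges between the two sides have length at least `lam * β`. -/
def IsGapRealization (p lam : ℝ) {A B : Type} (Adj : A → B → Prop) {d : ℕ}
    (τ : A ⊕ B → Fin d → ℝ) : Prop :=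
  ∃ β : ℝ, 0 < β ∧
    (∀ u v, Adj u v → lpDist p (τ (Sum.inl u)) (τ (Sum.inr v)) = β) ∧
    (∀ u v, ¬ Adj u v → lam * β ≤ lpDist p (τ (Sum.inl u)) (τ (Sum.inr v)))

/-- The gap number `g_p`: the supremum of all `lam ≥ 1` for which the graph has a
`lam`-gap-realization in some finite dimension (it is `∞` if there are no non-edges). -/
noncomputable def gapNumber (p : ℝ) {A B : Type} (Adj : A → B → Prop) : ENNReal :=
  sSup {x | ∃ lam : ℝ, 1 ≤ lam ∧ x = ENNReal.ofReal lam ∧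
    ∃ (d : ℕ) (τ : A ⊕ B → Fin d → ℝ), IsGapRealization p lam Adj τ}

/-- The graph `J(q, t, r)`: the `t`-subsets against the `r`-subsets of a `q`-element set, with an
edge when the former contains the latter. -/
def johnsonAdj (q t r : ℕ) (T : {T : Finset (Fin q) // T.card = t})
    (S : {S : Finset (Fin q) // S.card = r}) : Prop :=
  S.1 ⊆ T.1

/-- `γ_{p,Δ}`, the infimum of `g_p(J(q, t, t - Δ))` over all `q ≥ t ≥ Δ + 1`. It is finite for
`Δ ≥ 1`, as any graph `J(q, t, t - Δ)` with `q > t` has gap number at most `3`. -/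
noncomputable def gammaGap (p : ℝ) (Δ : ℕ) : ENNReal :=
  ⨅ (q : ℕ) (t : ℕ) (_ : Δ + 1 ≤ t ∧ t ≤ q), gapNumber p (johnsonAdj q t (t - Δ))

/-- `ζ₂(p, Δ, α) = 1 + (1 - α) (γ_{p,Δ}² - 1)`. -/
noncomputable def zetaTwo (p : ℝ) (Δ : ℕ) (α : ℝ) : ℝ :=
  1 + (1 - α) * ((gammaGap p Δ).toReal ^ 2 - 1)

/-! ### Discrete k-means -/

/-- An instance of discrete `k`-means in dimension `d`: a set of points to be clustered, a set of
candidate centers (both listed without repetition, with rational coordinates), and a number `k`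
of centers to be opened. -/
structure KMeansInstance where
  d : ℕ
  points : List (Fin d → ℚ)
  centers : List (Fin d → ℚ)
  k : ℕ
  points_nodup : points.Nodup
  centers_nodup : centers.Nodup
  k_pos : 1 ≤ k
  k_le : k ≤ centers.length

/-- `d`, the coordinates of the points, those of the candidate centers, and `k`. -/
def KMeansInstance.write (I : KMeansInstance) : List Γ' :=
  writeNat I.d ++
    writeList (fun a : Fin I.d → ℚ => writeList writeRat (List.ofFn a)) I.points ++
    writeList (fun a : Fin I.d → ℚ => writeList writeRat (List.ofFn a)) I.centers ++
    writeNat I.k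

/-- The number of points. -/
def KMeansInstance.n (I : KMeansInstance) : ℕ := I.points.length

/-- `c₁, …, c_k` are candidate centers. -/
def KMeansInstance.IsChoice (I : KMeansInstance) (c : Fin I.k → Fin I.d → ℚ) : Prop :=
  ∀ i, c i ∈ I.centers

/-- The sum, over all points `a`, of the squared `ℓ_p`-distance from `a` to the center
`c (σ a)` that `σ` assigns to it. -/
noncomputable def KMeansInstance.cost (p : ℝ) (I : KMeansInstance)
    (c : Fin I.k → Fin I.d → ℚ) (σ : (Fin I.d → ℚ) → Fin I.k) : ℝ :=
  ∑ a ∈ I.points.toFinset, lpDist p (fun j => (a j : ℝ)) (fun j => (c (σ a) j : ℝ)) ^ 2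

/-- The threshold `ρ n (log n)^(2/p)`. -/
noncomputable def KMeansInstance.threshold (p ρ : ℝ) (I : KMeansInstance) : ℝ :=
  ρ * (I.n : ℝ) * Real.log (I.n : ℝ) ^ (2 / p)

/-- At least two points, dimension at most `K log n`, and at most `n ^ s` candidate centers. (For
`n ≤ 1` the threshold is zero and there is no gap.) -/
def KMeansInstance.Small (I : KMeansInstance) (K : ℝ) (s : ℕ) : Prop :=
  2 ≤ I.n ∧ (I.d : ℝ) ≤ K * Real.log (I.n : ℝ) ∧ I.centers.length ≤ I.n ^ s

/-- Gap `k`-means with factor `c` in the `ℓ_p`-metric: on instances with `n ≥ 2` points, dimension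
at most `K log n` and at most `n ^ s` candidate centers, distinguish optimal cost at most
`ρ n (log n)^(2/p)` from optimal cost at least `c` times that value. -/
def kMeansGap (p c ρ K : ℝ) (s : ℕ) : GapProblem Γ' where
  yes := {w | ∃ I : KMeansInstance, w = I.write ∧ I.Small K s ∧
    ∃ C, I.IsChoice C ∧ ∃ σ, I.cost p C σ ≤ I.threshold p ρ}
  no := {w | ∃ I : KMeansInstance, w = I.write ∧ I.Small K s ∧
    ∀ C, I.IsChoice C → ∀ σ, c * I.threshold p ρ ≤ I.cost p C σ}

/-- Discrete `k`-means in `O(log n)`-dimensional `ℓ_p`-space, with `poly(n)` candidate centers, is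
NP-hard to approximate within the factor `c`, with a gap located at `ρ n (log n)^(2/p)`. -/
def KMeansHard (p c : ℝ) : Prop :=
  ∃ ρ : ℝ, 0 < ρ ∧ ∃ (K : ℝ) (s : ℕ), (kMeansGap p c ρ K s).NPHard

/-! Let `E` be the collection of a Johnson Coverage instance and let `lam` lie below `γ_{p,z-y}` (or
`lam = 1`). Then every `J(Q, z, y)` with `Q ≥ z` has a `lam`-gap-realization. Realizing the Johnson
graph of the whole universe would give no control of the dimension, so the universe is first encoded
over an alphabet of constant size. Each element occurring in `E` receives a word of length `N`, the
binary length of `|E|` plus a constant `a`, over an alphabet of `Q` letters, such that different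
words agree in at most a fraction `1/D` of the positions.

At a fixed position a `z`-set `T` becomes a set of at most `z` letters, which is completed to
exactly `z` letters, and a `y`-set `S` is completed likewise to `y` letters. The point of `T` and
the center of `S` are the concatenations, over all positions, of the vectors that a realization of
`J(Q, z, y)` assigns to these letter sets. The `p`-th powers of distances add up over positions. If
`S ⊆ T`, then containment holds at every position (`centerVertex_subset`) and the sum is about `N`.
If `S ⊄ T`, containment fails outside a fraction `2z²/D` of the positions (`ValidSets.card_bad`),
and the sum is at least about `lam^p N`. It is never much below `N`. Hence a covered point costs
about `N^(2/p)` and an uncovered one at least about `lam² N^(2/p)`; if a fraction of at least `1 -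
α` of the sets is uncovered, the total cost grows by the factor `1 + (1 - α)(lam² - 1)`
(`exists_cost_le`, `le_cost`). Only `y`-subsets of members of `E` are needed as centers, so there
are few of them.

Real coordinates are replaced by rational approximations, and small extra coordinates keep points
and centers distinct (`exists_gadget`). Each set gives `R = 2^a` points, which makes the rounding of
`log n` to the integer `N` relatively small. All errors are controlled by one parameter `κ`, chosen
small at the end. The code is found greedily among all `Q^N` words, which are polynomially many
(`two_pow_le_length_greedyCode`).

NP-hardness asks for Turing machines. The reduction is therefore assembled from functions on binary
trees computed by stack programs; these functions, `PT`, are closed under composition, pairing,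
branching and folds with polynomial bounds. Stack programs are compiled and run after the machine
that produces the Johnson Coverage instance (`PolyTimeComputable.comp_pt`).

For the numerical bounds, indicator vectors realize `J(q, t, t - 1)` with gap `3^(1/p)`
(`le_gammaGap`), which gives `1 + 8/e` for `p = 1` and `1 + 2/e` for `p = 2`. -/

/-! ### A small language of stack programs -/

/-- The stacks of the stack programs. -/
inductive Stk
  | main | aux | copy | ctr | io
  deriving DecidableEq

instance : Fintype Stk where
  elems := {.main, .aux, .copy, .ctr, .io}
  complete k := by cases k <;> decide

/-- Stack programs over the alphabet `Γ'`. A `loop` pops symbols until the stack is empty or the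
popped symbol satisfies `halts`. -/
inductive Prog
  | skip
  | push (k : Stk) (a : Γ')
  | seq (p q : Prog)
  | case (k : Stk) (f : Option Γ' → Prog)
  | loop (k : Stk) (halts : Γ' → Bool) (body : Γ' → Prog)

abbrev Store := Stk → List Γ'

/-- `Run p s s' t`: started on `s`, the program `p` ends on `s'` and enters loops `t` times. -/
inductive Run : Prog → Store → Store → ℕ → Prop
  | skip (s) : Run .skip s s 0
  | push (k a s) : Run (.push k a) s (Function.update s k (a :: s k)) 0
  | seq {p q s₁ s₂ s₃ t₁ t₂} (h₁ : Run p s₁ s₂ t₁) (h₂ : Run q s₂ s₃ t₂) :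
      Run (.seq p q) s₁ s₃ (t₁ + t₂)
  | case {k f s s' t} (h : Run (f (s k).head?) (Function.update s k (s k).tail) s' t) :
      Run (.case k f) s s' t
  | loop_nil {k halts body s} (h : s k = []) : Run (.loop k halts body) s s 1
  | loop_halt {k halts body s a l} (h : s k = a :: l) (ha : halts a = true) :
      Run (.loop k halts body) s (Function.update s k l) 1
  | loop_step {k halts body s a l s₁ s₂ t₁ t₂} (h : s k = a :: l) (ha : halts a = false)
      (h₁ : Run (body a) (Function.update s k l) s₁ t₁)
      (h₂ : Run (.loop k halts body) s₁ s₂ t₂) : Run (.loop k halts body) s s₂ (t₁ + t₂ + 1)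

/-! ### Compiling stack programs -/

/-- The labels needed by a stack program, one for each loop. -/
def Prog.Lbl : Prog → Type
  | .skip => Empty
  | .push _ _ => Empty
  | .seq p q => p.Lbl ⊕ q.Lbl
  | .case _ f => Σ o, (f o).Lbl
  | .loop _ _ body => Option (Σ a, (body a).Lbl)

@[reducible]
noncomputable def Prog.fintypeLbl : (p : Prog) → Fintype p.Lbl
  | .skip => inferInstanceAs (Fintype Empty)
  | .push _ _ => inferInstanceAs (Fintype Empty)
  | .seq p q =>
    letI := p.fintypeLbl
    letI := q.fintypeLbl
    inferInstanceAs (Fintype (p.Lbl ⊕ q.Lbl))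
  | .case _ f =>
    letI := fun o => (f o).fintypeLbl
    inferInstanceAs (Fintype (Σ o, (f o).Lbl))
  | .loop _ _ body =>
    letI := fun a => (body a).fintypeLbl
    inferInstanceAs (Fintype (Option (Σ a, (body a).Lbl)))

section compile

open Turing Turing.TM2

variable {K₁ : Type} {Γ₁ : K₁ → Type} {σ₁ Λ : Type}

/-- The alphabets of a machine to which the stacks of stack programs have been added. -/
@[reducible]
def extAlphabet (Γ₁ : K₁ → Type) : K₁ ⊕ Stk → Type
  | .inl k => Γ₁ k
  | .inr _ => Γ'

abbrev ExtStmt (Γ₁ : K₁ → Type) (σ₁ Λ : Type) := Stmt (extAlphabet Γ₁) Λ (σ₁ × Option Γ')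

/-- Joining the stacks of a machine with those of a stack program. -/
def joinStk (S : ∀ k, List (Γ₁ k)) (s : Store) : ∀ k, List (extAlphabet Γ₁ k)
  | .inl k => S k
  | .inr k => s k

/-- Branching on the last symbol read. -/
def selectStmt (f : Option Γ' → ExtStmt Γ₁ σ₁ Λ) : List (Option Γ') → ExtStmt Γ₁ σ₁ Λ
  | [] => .halt
  | o :: l => .branch (fun v => decide (v.2 = o)) (f o) (selectStmt f l)

/-- Popping a symbol and branching on it. -/
noncomputable def popSelect (k : Stk) (f : Option Γ' → ExtStmt Γ₁ σ₁ Λ) : ExtStmt Γ₁ σ₁ Λ :=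
  .pop (.inr k) (fun v o => (v.1, o)) (selectStmt f Finset.univ.toList)

/-- The compiled program `p`, followed by `q`. -/
noncomputable def Prog.entry : (p : Prog) → (p.Lbl → Λ) → ExtStmt Γ₁ σ₁ Λ → ExtStmt Γ₁ σ₁ Λ
  | .skip, _, q => q
  | .push k a, _, q => .push (.inr k) (fun _ => a) q
  | .seq p₁ p₂, j, q => p₁.entry (fun l => j (.inl l)) (p₂.entry (fun l => j (.inr l)) q)
  | .case k f, j, q => popSelect k fun o => (f o).entry (fun l => j ⟨o, l⟩) q
  | .loop _ _ _, j, _ => .goto fun _ => j none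

/-- The statements at the labels of the compiled program `p`, followed by `q`. -/
noncomputable def Prog.code :
    (p : Prog) → (p.Lbl → Λ) → ExtStmt Γ₁ σ₁ Λ → p.Lbl → ExtStmt Γ₁ σ₁ Λ
  | .skip, _, _ => fun l => nomatch l
  | .push _ _, _, _ => fun l => nomatch l
  | .seq p₁ p₂, j, q => fun l =>
    match l with
    | .inl l => p₁.code (fun l => j (.inl l)) (p₂.entry (fun l => j (.inr l)) q) l
    | .inr l => p₂.code (fun l => j (.inr l)) q l
  | .case _ f, j, q => fun l => (f l.1).code (fun l' => j ⟨l.1, l'⟩) q l.2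
  | .loop k halts body, j, q => fun l =>
    match l with
    | none => popSelect k fun o =>
        match o with
        | none => q
        | some a => bif halts a then q
            else (body a).entry (fun l => j (some ⟨a, l⟩)) (.goto fun _ => j none)
    | some l => (body l.1).code (fun l' => j (some ⟨l.1, l'⟩)) (.goto fun _ => j none) l.2

variable [DecidableEq K₁]

theorem joinStk_update_inr (S : ∀ k, List (Γ₁ k)) (s : Store) (k : Stk) (l : List Γ') :
    Function.update (joinStk S s) (.inr k) l = joinStk S (Function.update s k l) := by
  funext k'
  rcases k' with k' | k'
  · exact Function.update_of_ne Sum.inl_ne_inr _ _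
  · by_cases h : k' = k
    · subst h
      exact (Function.update_self _ _ _).trans (Function.update_self k' l s).symm
    · have h₁ : joinStk S (Function.update s k l) (.inr k') = joinStk S s (.inr k') :=
        Function.update_of_ne (β := fun _ => List Γ') h l s
      exact (Function.update_of_ne (fun h' => h (Sum.inr_injective h')) _ _).trans h₁.symm

theorem joinStk_update_inl (S : ∀ k, List (Γ₁ k)) (s : Store) (k : K₁) (l : List (Γ₁ k)) :
    Function.update (joinStk S s) (.inl k) l = joinStk (Function.update S k l) s := by
  funext k'
  rcases k' with k' | k'
  · by_cases h : k' = k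
    · subst h
      exact (Function.update_self _ _ _).trans (Function.update_self k' l S).symm
    · have h₁ : joinStk (Function.update S k l) s (.inl k') = joinStk S s (.inl k') :=
        Function.update_of_ne (β := fun k => List (Γ₁ k)) h l S
      exact (Function.update_of_ne (fun h' => h (Sum.inl_injective h')) _ _).trans h₁.symm
  · exact Function.update_of_ne Sum.inr_ne_inl _ _

theorem stepAux_selectStmt (f : Option Γ' → ExtStmt Γ₁ σ₁ Λ) (v : σ₁) (o : Option Γ')
    (S : ∀ k, List (extAlphabet Γ₁ k)) {l : List (Option Γ')} (h : o ∈ l) :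
    stepAux (selectStmt f l) (v, o) S = stepAux (f o) (v, o) S := by
  induction l with
  | nil => simp at h
  | cons o' l ih =>
    rw [selectStmt, stepAux]
    by_cases ho : o = o'
    · subst ho; simp
    · simp only [ho, decide_false, cond_false]
      exact ih (by simpa [ho] using h)

theorem stepAux_popSelect (k : Stk) (f : Option Γ' → ExtStmt Γ₁ σ₁ Λ) (v : σ₁ × Option Γ')
    (S : ∀ k, List (Γ₁ k)) (s : Store) :
    stepAux (popSelect k f) v (joinStk S s) =
      stepAux (f (s k).head?) (v.1, (s k).head?)
        (joinStk S (Function.update s k (s k).tail)) := by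
  rw [popSelect, stepAux, ← joinStk_update_inr]
  exact stepAux_selectStmt _ _ _ _ (by simp)

/-- `n` steps of a machine. -/
def StepsTo {K : Type} [DecidableEq K] {Γ : K → Type} {Λ σ : Type} (M : Λ → Stmt Γ Λ σ) (n : ℕ)
    (c c' : Cfg Γ Λ σ) : Prop :=
  (flip bind (TM2.step M))^[n] (some c) = some c'

theorem StepsTo.trans {K : Type} [DecidableEq K] {Γ : K → Type} {Λ σ : Type}
    {M : Λ → Stmt Γ Λ σ} {m n : ℕ} {c₁ c₂ c₃ : Cfg Γ Λ σ} (h₁ : StepsTo M m c₁ c₂)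
    (h₂ : StepsTo M n c₂ c₃) : StepsTo M (m + n) c₁ c₃ := by
  unfold StepsTo at *
  rw [Nat.add_comm, Function.iterate_add_apply, h₁, h₂]

theorem StepsTo.refl {K : Type} [DecidableEq K] {Γ : K → Type} {Λ σ : Type}
    (M : Λ → Stmt Γ Λ σ) (c : Cfg Γ Λ σ) : StepsTo M 0 c c := rfl

theorem StepsTo.one {K : Type} [DecidableEq K] {Γ : K → Type} {Λ σ : Type}
    (M : Λ → Stmt Γ Λ σ) (l : Λ) (v : σ) (S : ∀ k, List (Γ k)) :
    StepsTo M 1 ⟨some l, v, S⟩ (stepAux (M l) v S) := rfl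

/-- One step of a machine executes a whole statement up to the next jump, and compiled programs jump
only to enter a loop; this is why `Run` counts nothing else. The final register content `o'` is left
open, because compiled code overwrites the register before each branch on it. -/
theorem Run.stepsTo {p : Prog} {s s' : Store} {t : ℕ} (h : Run p s s' t)
    (M : Λ → ExtStmt Γ₁ σ₁ Λ) (j : p.Lbl → Λ) (q : ExtStmt Γ₁ σ₁ Λ)
    (hM : ∀ l, M (j l) = p.code j q l) (v : σ₁) (o : Option Γ') (S : ∀ k, List (Γ₁ k)) :
    ∃ n o', n ≤ t ∧ StepsTo M n (stepAux (p.entry j q) (v, o) (joinStk S s))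
      (stepAux q (v, o') (joinStk S s')) := by
  induction h generalizing q o with
  | skip s => exact ⟨0, o, le_rfl, StepsTo.refl _ _⟩
  | push k a s =>
    refine ⟨0, o, le_rfl, ?_⟩
    rw [← joinStk_update_inr]
    exact StepsTo.refl _ _
  | seq h₁ h₂ ih₁ ih₂ =>
    obtain ⟨n₁, o₁, hn₁, hs₁⟩ := ih₁ _ _ (fun l => hM (.inl l)) o
    obtain ⟨n₂, o₂, hn₂, hs₂⟩ := ih₂ _ _ (fun l => hM (.inr l)) o₁
    exact ⟨n₁ + n₂, o₂, by omega, hs₁.trans hs₂⟩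
  | @case k f s s' t h ih =>
    obtain ⟨n, o', hn, hs⟩ := ih (fun l => j ⟨_, l⟩) q (fun l => hM ⟨_, l⟩) (s k).head?
    refine ⟨n, o', hn, ?_⟩
    rw [Prog.entry, stepAux_popSelect]
    exact hs
  | @loop_nil k halts body s h =>
    refine ⟨1, none, le_rfl, ?_⟩
    have h1 := StepsTo.one M (j none) (v, o) (joinStk S s)
    rw [hM none, Prog.code, stepAux_popSelect, h] at h1
    simp only [List.head?_nil, List.tail_nil] at h1
    -- Popping from the empty stack does not change the store.
    rw [← h, Function.update_eq_self] at h1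
    exact h1
  | @loop_halt k halts body s a l h ha =>
    refine ⟨1, some a, le_rfl, ?_⟩
    have h1 := StepsTo.one M (j none) (v, o) (joinStk S s)
    rw [hM none, Prog.code, stepAux_popSelect, h] at h1
    simp only [List.head?_cons, List.tail_cons, ha, cond_true] at h1
    exact h1
  | @loop_step k halts body s a l s₁ s₂ t₁ t₂ h ha h₁ h₂ ih₁ ih₂ =>
    have h1 := StepsTo.one M (j none) (v, o) (joinStk S s)
    rw [hM none, Prog.code, stepAux_popSelect, h] at h1
    simp only [List.head?_cons, List.tail_cons, ha, cond_false] at h1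
    obtain ⟨n₁, o₁, hn₁, hs₁⟩ := ih₁ (fun l => j (some ⟨a, l⟩)) (.goto fun _ => j none)
      (fun l => (hM (some ⟨a, l⟩)).trans (by rw [Prog.code])) (some a)
    obtain ⟨n₂, o₂, hn₂, hs₂⟩ := ih₂ j q hM o₁
    exact ⟨1 + (n₁ + n₂), o₂, by omega, h1.trans (hs₁.trans hs₂)⟩

/-- A statement of a machine, as a statement of the extended machine that jumps to `e` instead of
halting. -/
def extStmt (e : Λ) {Λ₁ : Type} (i : Λ₁ → Λ) : Stmt Γ₁ Λ₁ σ₁ → ExtStmt Γ₁ σ₁ Λ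
  | .push k f q => .push (.inl k) (fun v => f v.1) (extStmt e i q)
  | .peek k f q => .peek (.inl k) (fun v o => (f v.1 o, v.2)) (extStmt e i q)
  | .pop k f q => .pop (.inl k) (fun v o => (f v.1 o, v.2)) (extStmt e i q)
  | .load f q => .load (fun v => (f v.1, v.2)) (extStmt e i q)
  | .branch f q₁ q₂ => .branch (fun v => f v.1) (extStmt e i q₁) (extStmt e i q₂)
  | .goto f => .goto fun v => i (f v.1)
  | .halt => .goto fun _ => e

/-- The configuration of the extended machine. -/
def extCfg (e : Λ) {Λ₁ : Type} (i : Λ₁ → Λ) (o : Option Γ') (s : Store) (c : Cfg Γ₁ Λ₁ σ₁) :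
    Cfg (extAlphabet Γ₁) Λ (σ₁ × Option Γ') :=
  ⟨some (c.l.elim e i), (c.var, o), joinStk c.stk s⟩

theorem stepAux_extStmt (e : Λ) {Λ₁ : Type} (i : Λ₁ → Λ) (q : Stmt Γ₁ Λ₁ σ₁) (v : σ₁)
    (o : Option Γ') (S : ∀ k, List (Γ₁ k)) (s : Store) :
    stepAux (extStmt e i q) (v, o) (joinStk S s) = extCfg e i o s (stepAux q v S) := by
  induction q generalizing v S with
  | push k f q ih =>
    have := ih v (Function.update S k (f v :: S k))
    rw [← joinStk_update_inl] at this
    exact this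
  | peek k f q ih => rw [extStmt, stepAux]; exact ih _ _
  | pop k f q ih =>
    have := ih (f v (S k).head?) (Function.update S k (S k).tail)
    rw [← joinStk_update_inl] at this
    exact this
  | load f q ih => rw [extStmt, stepAux]; exact ih _ _
  | branch f q₁ q₂ ih₁ ih₂ =>
    rw [extStmt, stepAux, stepAux]
    cases f v
    · exact ih₂ _ _
    · exact ih₁ _ _
  | goto f => rfl
  | halt => rfl

/-- The extended machine follows the original one step by step. A halted configuration corresponds
to one at the label `e`, where the appended code takes over. -/
theorem StepsTo.ext {e : Λ} {Λ₁ : Type} {i : Λ₁ → Λ} {M₁ : Λ₁ → Stmt Γ₁ Λ₁ σ₁}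
    {M : Λ → ExtStmt Γ₁ σ₁ Λ} (hM : ∀ l, M (i l) = extStmt e i (M₁ l)) (o : Option Γ')
    (s : Store) {n : ℕ} {c c' : Cfg Γ₁ Λ₁ σ₁} (h : StepsTo M₁ n c c') :
    StepsTo M n (extCfg e i o s c) (extCfg e i o s c') := by
  induction n generalizing c with
  | zero =>
    obtain rfl : c = c' := by simpa [StepsTo] using h
    exact StepsTo.refl _ _
  | succ n ih =>
    obtain ⟨l, v, S⟩ := c
    unfold StepsTo at h
    rw [Function.iterate_succ_apply] at h
    cases l with
    | none =>
      -- A halted configuration has no successor, so it cannot reach `c'` in a positive number of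
      -- steps.
      have : flip bind (TM2.step M₁) (some ⟨none, v, S⟩) = none := rfl
      rw [this] at h
      have h2 : ∀ n, (flip bind (TM2.step M₁))^[n] none = none := by
        intro n
        induction n with
        | zero => rfl
        | succ n ih => rw [Function.iterate_succ_apply]; exact ih
      rw [h2] at h
      cases h
    | some l =>
      have h1 : StepsTo M 1 (extCfg e i o s ⟨some l, v, S⟩)
          (stepAux (M (i l)) (v, o) (joinStk S s)) := StepsTo.one M (i l) (v, o) (joinStk S s)
      rw [hM, stepAux_extStmt] at h1
      rw [Nat.add_comm]
      exact h1.trans (ih h)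

/-! ### The growth of the stacks of a machine -/

/-- The largest number of symbols that a statement pushes. -/
def stmtPushes {Λ₁ : Type} : Stmt Γ₁ Λ₁ σ₁ → ℕ
  | .push _ _ q => stmtPushes q + 1
  | .peek _ _ q => stmtPushes q
  | .pop _ _ q => stmtPushes q
  | .load _ q => stmtPushes q
  | .branch _ q₁ q₂ => max (stmtPushes q₁) (stmtPushes q₂)
  | .goto _ => 0
  | .halt => 0

theorem length_stepAux_le {Λ₁ : Type} (q : Stmt Γ₁ Λ₁ σ₁) (v : σ₁) (S : ∀ k, List (Γ₁ k)) {B : ℕ}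
    (hB : ∀ k, (S k).length ≤ B) (k : K₁) :
    ((stepAux q v S).stk k).length ≤ B + stmtPushes q := by
  induction q generalizing v S B with
  | push k' f q ih =>
    rw [stepAux, stmtPushes]
    have := ih v (Function.update S k' (f v :: S k')) (B := B + 1) (by
      intro k''
      by_cases h : k'' = k'
      · subst h; rw [Function.update_self, List.length_cons]; have := hB k''; omega
      · simp only [Function.update_of_ne h]; exact (hB _).trans (by omega))
    omega
  | peek k' f q ih => exact ih _ _ hB
  | pop k' f q ih =>
    rw [stepAux, stmtPushes]
    refine ih _ _ (fun k'' => ?_)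
    by_cases h : k'' = k'
    · subst h; simp only [Function.update_self, List.length_tail]; have := hB k''; omega
    · simp only [Function.update_of_ne h]; exact hB _
  | load f q ih => exact ih _ _ hB
  | branch f q₁ q₂ ih₁ ih₂ =>
    rw [stepAux, stmtPushes]
    cases f v
    · exact (ih₂ _ _ hB).trans (by omega)
    · exact (ih₁ _ _ hB).trans (by omega)
  | goto f => simpa [stmtPushes] using hB k
  | halt => simpa [stmtPushes] using hB k

/-- Each step pushes boundedly many symbols. Hence the output of a polynomial-time machine has
polynomial length, and a second polynomial-time computation on it stays polynomial in the original
input. -/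
theorem StepsTo.length_le {Λ₁ : Type} {M₁ : Λ₁ → Stmt Γ₁ Λ₁ σ₁} {c₀ : ℕ}
    (hc : ∀ l, stmtPushes (M₁ l) ≤ c₀) {n : ℕ} {c c' : Cfg Γ₁ Λ₁ σ₁} (h : StepsTo M₁ n c c')
    {B : ℕ} (hB : ∀ k, (c.stk k).length ≤ B) (k : K₁) : (c'.stk k).length ≤ B + c₀ * n := by
  induction n generalizing c B with
  | zero =>
    obtain rfl : c = c' := by simpa [StepsTo] using h
    simpa using hB k
  | succ n ih =>
    obtain ⟨l, v, S⟩ := c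
    unfold StepsTo at h
    rw [Function.iterate_succ_apply] at h
    cases l with
    | none =>
      have : flip bind (TM2.step M₁) (some ⟨none, v, S⟩) = none := rfl
      rw [this] at h
      have h2 : ∀ n, (flip bind (TM2.step M₁))^[n] none = none := by
        intro n
        induction n with
        | zero => rfl
        | succ n ih => rw [Function.iterate_succ_apply]; exact ih
      rw [h2] at h
      cases h
    | some l =>
      have := ih (B := B + c₀) h (fun k => (length_stepAux_le _ v S hB k).trans (by
        have := hc l; omega))
      rw [Nat.mul_succ]
      omega

end compile

/-! ### Trees as data of stack programs -/

inductive STree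
  | nil
  | cons (l r : STree)
  deriving DecidableEq

/-- The preorder code is self-delimiting, so trees can lie on top of one another on a stack without
separators. -/
def STree.bits : STree → List Γ'
  | .nil => [Γ'.bit false]
  | .cons l r => Γ'.bit true :: (l.bits ++ r.bits)

def STree.size (x : STree) : ℕ := x.bits.length

@[simp] theorem STree.size_nil : STree.nil.size = 1 := rfl

@[simp] theorem STree.size_cons (l r : STree) : (STree.cons l r).size = l.size + r.size + 1 := by
  simp [STree.size, STree.bits]

theorem STree.size_pos (x : STree) : 0 < x.size := by cases x <;> simp

theorem STree.blank_notMem_bits (x : STree) : Γ'.blank ∉ x.bits := by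
  induction x with
  | nil => simp [STree.bits]
  | cons l r ihl ihr => simp [STree.bits, ihl, ihr]

/-- A store, given by the contents of its stacks. -/
def st (m a b c o : List Γ') : Store
  | .main => m
  | .aux => a
  | .copy => b
  | .ctr => c
  | .io => o

section st

variable (m a b c o x : List Γ')

@[simp] theorem st_main : st m a b c o .main = m := rfl
@[simp] theorem st_aux : st m a b c o .aux = a := rfl
@[simp] theorem st_copy : st m a b c o .copy = b := rfl
@[simp] theorem st_ctr : st m a b c o .ctr = c := rfl
@[simp] theorem st_io : st m a b c o .io = o := rfl

@[simp] theorem update_st_main : Function.update (st m a b c o) .main x = st x a b c o := by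
  funext k; cases k <;> rfl
@[simp] theorem update_st_aux : Function.update (st m a b c o) .aux x = st m x b c o := by
  funext k; cases k <;> rfl
@[simp] theorem update_st_copy : Function.update (st m a b c o) .copy x = st m a x c o := by
  funext k; cases k <;> rfl
@[simp] theorem update_st_ctr : Function.update (st m a b c o) .ctr x = st m a b x o := by
  funext k; cases k <;> rfl
@[simp] theorem update_st_io : Function.update (st m a b c o) .io x = st m a b c x := by
  funext k; cases k <;> rfl

end st

theorem Run.push' {k : Stk} {x : Γ'} {s s' : Store}
    (h : s' = Function.update s k (x :: s k)) : Run (.push k x) s s' 0 := by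
  subst h; exact Run.push _ _ _

theorem Run.case' {k : Stk} {f : Option Γ' → Prog} {s s₁ s' : Store} {o : Option Γ'} {t : ℕ}
    (ho : (s k).head? = o) (hs : Function.update s k (s k).tail = s₁) (h : Run (f o) s₁ s' t) :
    Run (.case k f) s s' t := by
  subst ho hs; exact Run.case h

theorem Run.cast {p : Prog} {s₁ s₂ : Store} {t t' : ℕ} (h : Run p s₁ s₂ t) (ht : t = t') :
    Run p s₁ s₂ t' := ht ▸ h

theorem Run.exists_le {p : Prog} {s₁ s₂ : Store} {t T : ℕ} (h : Run p s₁ s₂ t) (ht : t ≤ T) :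
    ∃ t, t ≤ T ∧ Run p s₁ s₂ t := ⟨t, ht, h⟩

/-- The test for the marker. -/
def isBlank (x : Γ') : Bool := decide (x = Γ'.blank)

/-- Moving the tree on top of the stack `main` to the stack `aux`, in reverse and above a marker. -/
def stashLoop : Prog :=
  .loop .ctr isBlank fun _ => .case .main fun
    | some (.bit true) =>
      .seq (.push .aux (.bit true)) (.seq (.push .ctr .comma) (.push .ctr .comma))
    | some (.bit false) => .push .aux (.bit false)
    | _ => .skip

def stash : Prog :=
  .seq (.push .aux .blank) (.seq (.push .ctr .blank) (.seq (.push .ctr .comma) stashLoop))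

/-- The commas on `ctr` count the subtrees still to be read: a `true` bit replaces one comma by two,
a `false` bit removes one. Prepending a subtree to an arbitrary remaining run, rather than
describing a complete run, lets the induction treat the two children in turn. -/
theorem run_stashLoop (x : STree) {m a b c o : List Γ'} {s' : Store} {t : ℕ}
    (h : Run stashLoop (st m (x.bits.reverse ++ a) b c o) s' t) :
    Run stashLoop (st (x.bits ++ m) a b (.comma :: c) o) s' (t + x.size) := by
  induction x generalizing m a c t with
  | nil =>
    refine (Run.loop_step (s₁ := st m (.bit false :: a) b c o) rfl rfl ?_ h).cast
      (show 0 + t + 1 = _ by simp)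
    refine Run.case' (o := some (.bit false)) (s₁ := st m a b c o) (by simp [STree.bits])
      (by simp [STree.bits]) ?_
    exact Run.push' (by simp)
  | cons l r ihl ihr =>
    have h1 : Run stashLoop
        (st (l.bits ++ (r.bits ++ m)) (.bit true :: a) b (.comma :: .comma :: c) o) s'
        (t + r.size + l.size) := by
      refine ihl (ihr ?_)
      simpa [STree.bits] using h
    refine (Run.loop_step (s₁ := st (l.bits ++ (r.bits ++ m)) (.bit true :: a) b
      (.comma :: .comma :: c) o) rfl rfl ?_ h1).cast
      (show 0 + (0 + 0) + (t + r.size + l.size) + 1 = _ by simp only [STree.size_cons]; omega)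
    refine Run.case' (o := some (.bit true)) (s₁ := st (l.bits ++ (r.bits ++ m)) a b c o)
      (by simp [STree.bits]) (by simp [STree.bits]) ?_
    exact .seq (Run.push' rfl) (.seq (Run.push' rfl) (Run.push' (by simp)))

theorem run_stash (x : STree) (m a b c o : List Γ') :
    Run stash (st (x.bits ++ m) a b c o) (st m (x.bits.reverse ++ .blank :: a) b c o)
      (x.size + 1) := by
  refine (Run.seq (Run.push' rfl) (.seq (Run.push' rfl) (.seq (Run.push' rfl)
    (t₂ := 1 + x.size) ?_))).cast (show 0 + (0 + (0 + (1 + x.size))) = _ by omega)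
  simp only [update_st_ctr, update_st_aux, st_aux, st_ctr]
  refine run_stashLoop x ?_
  have : Run stashLoop (st m (x.bits.reverse ++ .blank :: a) b (.blank :: c) o) _ 1 :=
    Run.loop_halt rfl rfl
  simpa using this

/-- Emptying the stack `aux` up to the marker. -/
def pour (body : Γ' → Prog) : Prog := .loop .aux isBlank body

theorem run_pour_main (w : List Γ') (hw : .blank ∉ w) (m a b c o : List Γ') :
    Run (pour fun x => .push .main x) (st m (w ++ .blank :: a) b c o)
      (st (w.reverse ++ m) a b c o) (w.length + 1) := by
  induction w generalizing m with
  | nil =>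
    have : Run (pour fun x => .push .main x) (st m (.blank :: a) b c o) _ 1 :=
      Run.loop_halt rfl rfl
    simpa using this
  | cons x w ih =>
    simp only [List.mem_cons, not_or] at hw
    refine (Run.loop_step (a := x) (l := w ++ .blank :: a) rfl ?_ (Run.push' rfl)
      (t₂ := w.length + 1) ?_).cast (show 0 + (w.length + 1) + 1 = _ by simp)
    · simpa [isBlank] using Ne.symm hw.1
    · simpa [pour] using ih hw.2 (x :: m)

theorem run_pour_skip (w : List Γ') (hw : .blank ∉ w) (m a b c o : List Γ') :
    Run (pour fun _ => .skip) (st m (w ++ .blank :: a) b c o)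
      (st m a b c o) (w.length + 1) := by
  induction w with
  | nil =>
    have : Run (pour fun _ => .skip) (st m (.blank :: a) b c o) _ 1 :=
      Run.loop_halt rfl rfl
    simpa using this
  | cons x w ih =>
    simp only [List.mem_cons, not_or] at hw
    refine (Run.loop_step (a := x) (l := w ++ .blank :: a) rfl ?_ (Run.skip _)
      (t₂ := w.length + 1) ?_).cast (show 0 + (w.length + 1) + 1 = _ by simp)
    · simpa [isBlank] using Ne.symm hw.1
    · simpa [pour] using ih hw.2

theorem run_pour_both (w : List Γ') (hw : .blank ∉ w) (m a b c o : List Γ') :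
    Run (pour fun x => .seq (.push .main x) (.push .copy x)) (st m (w ++ .blank :: a) b c o)
      (st (w.reverse ++ m) a (w.reverse ++ b) c o) (w.length + 1) := by
  induction w generalizing m b with
  | nil =>
    have : Run (pour fun x => .seq (.push .main x) (.push .copy x)) (st m (.blank :: a) b c o) _ 1 :=
      Run.loop_halt rfl rfl
    simpa using this
  | cons x w ih =>
    simp only [List.mem_cons, not_or] at hw
    refine (Run.loop_step (a := x) (l := w ++ .blank :: a) rfl ?_
      (.seq (Run.push' rfl) (Run.push' rfl))
      (t₂ := w.length + 1) ?_).cast (show 0 + 0 + (w.length + 1) + 1 = _ by simp)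
    · simpa [isBlank] using Ne.symm hw.1
    · simpa [pour] using ih hw.2 (x :: m) (x :: b)

theorem run_copy_aux (w : List Γ') (hw : .blank ∉ w) (m a b c o : List Γ') :
    Run (.loop .copy isBlank fun x => .push .aux x) (st m a (w ++ .blank :: b) c o)
      (st m (w.reverse ++ a) b c o) (w.length + 1) := by
  induction w generalizing a with
  | nil =>
    have : Run (.loop .copy isBlank fun x => .push .aux x) (st m a (.blank :: b) c o) _ 1 :=
      Run.loop_halt rfl rfl
    simpa using this
  | cons x w ih =>
    simp only [List.mem_cons, not_or] at hw
    refine (Run.loop_step (a := x) (l := w ++ .blank :: b) rfl ?_ (Run.push' rfl)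
      (t₂ := w.length + 1) ?_).cast (show 0 + (w.length + 1) + 1 = _ by simp)
    · simpa [isBlank] using Ne.symm hw.1
    · simpa using ih hw.2 (x :: a)

def unstash : Prog := pour fun x => .push .main x

def drop : Prog := .seq stash (pour fun _ => .skip)

/-- Emptying one stack onto another reverses the word. One copy is restored to `main` directly; the
one on `copy` already stands in the right order and has to pass through `aux` to keep it. -/
def dup : Prog :=
  .seq stash (.seq (.push .copy .blank)
    (.seq (pour fun x => .seq (.push .main x) (.push .copy x))
      (.seq (.push .aux .blank) (.seq (.loop .copy isBlank fun x => .push .aux x) unstash))))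

theorem run_unstash (x : STree) (m a b c o : List Γ') :
    Run unstash (st m (x.bits.reverse ++ .blank :: a) b c o) (st (x.bits ++ m) a b c o)
      (x.size + 1) := by
  simpa [unstash, STree.size] using run_pour_main x.bits.reverse (by simpa using x.blank_notMem_bits) m a b c o

theorem run_drop (x : STree) (m a b c o : List Γ') :
    Run drop (st (x.bits ++ m) a b c o) (st m a b c o) (2 * x.size + 2) := by
  have h := run_pour_skip x.bits.reverse (by simpa using x.blank_notMem_bits) m a b c o
  refine (Run.seq (run_stash x m a b c o) h).cast ?_
  simp [STree.size]; omega

theorem run_dup (x : STree) (m a b c o : List Γ') :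
    Run dup (st (x.bits ++ m) a b c o) (st (x.bits ++ (x.bits ++ m)) a b c o)
      (4 * x.size + 4) := by
  have hx : .blank ∉ x.bits.reverse := by simpa using x.blank_notMem_bits
  have h₁ := run_pour_both x.bits.reverse hx m a (.blank :: b) c o
  have h₂ := run_copy_aux x.bits x.blank_notMem_bits (x.bits ++ m) (.blank :: a) b c o
  rw [List.reverse_reverse] at h₁
  refine (Run.seq (run_stash x m a b c o) (.seq (Run.push' (by simp)) (.seq h₁
    (.seq (Run.push' (by simp)) (.seq h₂ (run_unstash x _ a b c o)))))).cast ?_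
  simp [STree.size]; omega

def pushBits : List Γ' → Prog
  | [] => .skip
  | x :: l => .seq (pushBits l) (.push .main x)

theorem run_pushBits (w m a b c o : List Γ') :
    Run (pushBits w) (st m a b c o) (st (w ++ m) a b c o) 0 := by
  induction w with
  | nil => exact Run.skip _
  | cons x w ih => exact Run.seq ih (Run.push' (by simp))

/-! ### Functions computed by stack programs in polynomial time -/

/-- Types whose elements are represented by trees. -/
class TreeRep (A : Type) where
  trep : A → STree

open TreeRep

def sz {A : Type} [TreeRep A] (a : A) : ℕ := (trep a).size

theorem sz_pos {A : Type} [TreeRep A] (a : A) : 0 < sz a := STree.size_pos _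

instance : TreeRep STree := ⟨id⟩

instance : TreeRep Unit := ⟨fun _ => .nil⟩

instance : TreeRep Bool := ⟨fun x => bif x then .cons .nil .nil else .nil⟩

instance {A B : Type} [TreeRep A] [TreeRep B] : TreeRep (A × B) := ⟨fun x => .cons (trep x.1) (trep x.2)⟩

def repList {A : Type} [TreeRep A] : List A → STree
  | [] => .nil
  | x :: l => .cons (trep x) (repList l)

instance {A : Type} [TreeRep A] : TreeRep (List A) := ⟨repList⟩

section
variable {A B : Type} [TreeRep A] [TreeRep B]

theorem trep_pair (a : A) (b : B) : trep (a, b) = .cons (trep a) (trep b) := rfl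
theorem trep_nil : trep ([] : List A) = .nil := rfl
theorem trep_cons (a : A) (l : List A) : trep (a :: l) = .cons (trep a) (trep l) := rfl
@[simp] theorem sz_pair (a : A) (b : B) : sz (a, b) = sz a + sz b + 1 := STree.size_cons _ _
@[simp] theorem sz_nil : sz ([] : List A) = 1 := rfl
@[simp] theorem sz_cons (a : A) (l : List A) : sz (a :: l) = sz a + sz l + 1 := STree.size_cons _ _

theorem sz_bool_le (b : Bool) : sz b ≤ 3 := by cases b <;> decide

theorem sz_append (l₁ l₂ : List A) : sz (l₁ ++ l₂) + 1 = sz l₁ + sz l₂ := by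
  induction l₁ with
  | nil => simp; omega
  | cons a l ih => simp only [List.cons_append, sz_cons]; omega

theorem length_lt_sz (l : List A) : l.length < sz l := by
  induction l with
  | nil => simp
  | cons a l ih => simp only [List.length_cons, sz_cons]; omega

theorem sz_le_of_mem {a : A} {l : List A} (h : a ∈ l) : sz a < sz l := by
  induction l with
  | nil => simp at h
  | cons b l ih =>
    rcases List.mem_cons.1 h with rfl | h
    · simp only [sz_cons]; omega
    · have := ih h; simp only [sz_cons]; omega

theorem sz_le_of_forall {l : List A} {C : ℕ} (h : ∀ a ∈ l, sz a ≤ C) :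
    sz l ≤ l.length * (C + 1) + 1 := by
  induction l with
  | nil => simp
  | cons b l ih =>
    have h1 := ih fun a ha => h a (List.mem_cons_of_mem _ ha)
    have h2 := h b List.mem_cons_self
    simp only [sz_cons, List.length_cons, Nat.succ_mul]
    omega

end

theorem Polynomial.eval_mono_nat (P : Polynomial ℕ) : Monotone fun n => P.eval n := by
  intro m n h
  simp only [Polynomial.eval_eq_sum_range]
  gcongr

/-- Functions that a stack program computes in polynomial time, with the argument and the value
on top of the stack `main`. -/
def PT {A B : Type} [TreeRep A] [TreeRep B] (f : A → B) : Prop :=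
  ∃ (p : Prog) (P : Polynomial ℕ), ∀ x m a b c o, ∃ t, t + sz (f x) ≤ P.eval (sz x) ∧
    Run p (st ((trep x).bits ++ m) a b c o) (st ((trep (f x)).bits ++ m) a b c o) t

/-- Polynomially bounded functions. -/
def PolyBdd {A : Type} [TreeRep A] (n : A → ℕ) : Prop := ∃ P : Polynomial ℕ, ∀ x, n x ≤ P.eval (sz x)

namespace PolyBdd

variable {A : Type} [TreeRep A]

theorem of_le {m n : A → ℕ} (hn : PolyBdd n) (h : ∀ x, m x ≤ n x) : PolyBdd m :=
  let ⟨P, hP⟩ := hn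
  ⟨P, fun x => (h x).trans (hP x)⟩

theorem const (n : ℕ) : PolyBdd fun _ : A => n := ⟨Polynomial.C n, fun _ => by simp⟩

theorem sz : PolyBdd fun x : A => sz x := ⟨Polynomial.X, fun _ => by simp⟩

theorem add {m n : A → ℕ} (hm : PolyBdd m) (hn : PolyBdd n) : PolyBdd fun x => m x + n x :=
  let ⟨P, hP⟩ := hm
  let ⟨Q, hQ⟩ := hn
  ⟨P + Q, fun x => by simpa using Nat.add_le_add (hP x) (hQ x)⟩

theorem mul {m n : A → ℕ} (hm : PolyBdd m) (hn : PolyBdd n) : PolyBdd fun x => m x * n x :=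
  let ⟨P, hP⟩ := hm
  let ⟨Q, hQ⟩ := hn
  ⟨P * Q, fun x => by simpa using Nat.mul_le_mul (hP x) (hQ x)⟩

theorem pow {m : A → ℕ} (hm : PolyBdd m) (n : ℕ) : PolyBdd fun x => m x ^ n :=
  let ⟨P, hP⟩ := hm
  ⟨P ^ n, fun x => by simpa using Nat.pow_le_pow_left (hP x) n⟩

theorem eval {m : A → ℕ} (hm : PolyBdd m) (Q : Polynomial ℕ) : PolyBdd fun x => Q.eval (m x) :=
  let ⟨P, hP⟩ := hm
  ⟨Q.comp P, fun x => by simpa [Polynomial.eval_comp] using Q.eval_mono_nat (hP x)⟩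

end PolyBdd

theorem PT.polyBdd {A B : Type} [TreeRep A] [TreeRep B] {f : A → B} (hf : PT f) :
    PolyBdd fun x => sz (f x) :=
  let ⟨_, P, h⟩ := hf
  ⟨P, fun x => let ⟨_, ht, _⟩ := h x [] [] [] [] []; le_trans (Nat.le_add_left _ _) ht⟩

/-- To show that `f` is computed in polynomial time, it suffices to bound the running time and
the size of the values separately. -/
theorem PT.intro {A B : Type} [TreeRep A] [TreeRep B] {f : A → B} (p : Prog) (T : A → ℕ)
    (hT : PolyBdd T) (hs : PolyBdd fun x => sz (f x))
    (h : ∀ x m a b c o, ∃ t, t ≤ T x ∧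
      Run p (st ((trep x).bits ++ m) a b c o) (st ((trep (f x)).bits ++ m) a b c o) t) : PT f := by
  obtain ⟨P, hP⟩ := hT.add hs
  refine ⟨p, P, fun x m a b c o => ?_⟩
  obtain ⟨t, ht, hr⟩ := h x m a b c o
  exact ⟨t, (Nat.add_le_add_right ht _).trans (hP x), hr⟩

theorem PT.elim {A B : Type} [TreeRep A] [TreeRep B] {f : A → B} (hf : PT f) :
    ∃ (p : Prog) (T : Polynomial ℕ), ∀ x m a b c o, ∃ t, t ≤ T.eval (sz x) ∧
      Run p (st ((trep x).bits ++ m) a b c o) (st ((trep (f x)).bits ++ m) a b c o) t := by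
  obtain ⟨p, P, h⟩ := hf
  refine ⟨p, P, fun x m a b c o => ?_⟩
  obtain ⟨t, ht, hr⟩ := h x m a b c o
  exact ⟨t, (Nat.le_add_right _ _).trans ht, hr⟩

namespace PT

variable {A B C X : Type} [TreeRep A] [TreeRep B] [TreeRep C] [TreeRep X]

/-- A function that does not change the representation. -/
theorem of_rep_eq {f : A → B} (h : ∀ x, trep (f x) = trep x) : PT f := by
  refine .intro .skip (fun _ => 0) (.const 0) (PolyBdd.sz.of_le fun x => ?_)
    fun x m a b c o => ⟨0, le_rfl, ?_⟩
  · simp [sz, h]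
  · rw [h]; exact Run.skip _

protected theorem id : PT fun x : A => x := of_rep_eq fun _ => rfl

theorem comp {g : B → C} {f : A → B} (hg : PT g) (hf : PT f) : PT fun x => g (f x) := by
  have hfs := hf.polyBdd
  obtain ⟨R, hR⟩ := hg.polyBdd
  obtain ⟨p, P, hp⟩ := hf.elim
  obtain ⟨q, Q, hq⟩ := hg.elim
  refine .intro (.seq p q) (fun x => P.eval (sz x) + Q.eval (sz (f x)))
    ((PolyBdd.sz.eval P).add (hfs.eval Q)) ((hfs.eval R).of_le fun x => hR (f x))
    fun x m a b c o => ?_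
  obtain ⟨t₁, ht₁, hr₁⟩ := hp x m a b c o
  obtain ⟨t₂, ht₂, hr₂⟩ := hq (f x) m a b c o
  exact ⟨t₁ + t₂, Nat.add_le_add ht₁ ht₂, .seq hr₁ hr₂⟩

theorem const (y : B) : PT fun _ : A => y := by
  refine .intro (.seq drop (pushBits (trep y).bits)) (fun x => 2 * sz x + 2)
    (((PolyBdd.const 2).mul .sz).add (.const 2)) (.const _) fun x m a b c o => ?_
  exact (Run.seq (run_drop _ _ _ _ _ _) (run_pushBits _ _ _ _ _ _)).exists_le le_rfl

/-- The value of `f` waits on `aux` while `g` is computed. This is possible because `PT` requires a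
program to work above arbitrary contents of all stacks and to leave them intact. -/
theorem pair {f : X → A} {g : X → B} (hf : PT f) (hg : PT g) : PT fun x => (f x, g x) := by
  have hfs := hf.polyBdd
  have hgs := hg.polyBdd
  obtain ⟨p, P, hp⟩ := hf.elim
  obtain ⟨q, Q, hq⟩ := hg.elim
  refine .intro (.seq dup (.seq p (.seq stash (.seq q (.seq unstash (.push .main (.bit true)))))))
    (fun x => (4 * sz x + 4) + P.eval (sz x) + (sz (f x) + 1) + Q.eval (sz x) + (sz (f x) + 1))
    ((((((PolyBdd.const 4).mul .sz).add (.const 4)).add (PolyBdd.sz.eval P)).add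
      (hfs.add (.const 1))).add (PolyBdd.sz.eval Q) |>.add (hfs.add (.const 1)))
    (((hfs.add hgs).add (.const 1)).of_le fun x => le_of_eq (sz_pair _ _))
    fun x m a b c o => ?_
  obtain ⟨t₁, ht₁, hr₁⟩ := hp x ((trep x).bits ++ m) a b c o
  obtain ⟨t₂, ht₂, hr₂⟩ := hq x m ((trep (f x)).bits.reverse ++ .blank :: a) b c o
  refine ⟨_, ?_, .seq (run_dup _ _ _ _ _ _) (.seq hr₁ (.seq (run_stash _ _ _ _ _ _)
    (.seq hr₂ (.seq (run_unstash _ _ _ _ _ _) (Run.push' ?_)))))⟩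
  · simp only [sz] at *; omega
  · simp [trep_pair, STree.bits]

theorem fst : PT fun x : A × B => x.1 := by
  refine .intro (.case .main fun _ => .seq stash (.seq drop unstash)) (fun x => 3 * sz x + 4)
    (((PolyBdd.const 3).mul .sz).add (.const 4)) (PolyBdd.sz.of_le fun x => ?_)
    fun ⟨x, y⟩ m a b c o => ?_
  · rw [← x.eta, sz_pair]; dsimp only; omega
  refine (Run.case' (o := some (.bit true)) rfl
    (s₁ := st ((trep x).bits ++ ((trep y).bits ++ m)) a b c o)
    (by simp [trep_pair, STree.bits]) (.seq (run_stash _ _ _ _ _ _)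
    (.seq (run_drop _ _ _ _ _ _) (run_unstash _ _ _ _ _ _)))).exists_le ?_
  rw [sz_pair]; simp only [sz]; omega

theorem snd : PT fun x : A × B => x.2 := by
  refine .intro (.case .main fun _ => drop) (fun x => 2 * sz x + 2)
    (((PolyBdd.const 2).mul .sz).add (.const 2)) (PolyBdd.sz.of_le fun x => ?_)
    fun ⟨x, y⟩ m a b c o => ?_
  · rw [← x.eta, sz_pair]; dsimp only; omega
  refine (Run.case' (o := some (.bit true)) rfl
    (s₁ := st ((trep x).bits ++ ((trep y).bits ++ m)) a b c o)
    (by simp [trep_pair, STree.bits]) (run_drop _ _ _ _ _ _)).exists_le ?_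
  rw [sz_pair]; simp only [sz]; omega

theorem cond {c : X → Bool} {f g : X → A} (hc : PT c) (hf : PT f) (hg : PT g) :
    PT fun x => bif c x then f x else g x := by
  have hfs := hf.polyBdd
  have hgs := hg.polyBdd
  obtain ⟨q, Q, hq⟩ := hc.elim
  obtain ⟨p₁, P₁, hp₁⟩ := hf.elim
  obtain ⟨p₂, P₂, hp₂⟩ := hg.elim
  refine .intro (.seq dup (.seq q (.case .main fun
      | some (.bit true) => .seq drop (.seq drop p₁)
      | _ => p₂)))
    (fun x => (4 * sz x + 4) + Q.eval (sz x) + (8 + P₁.eval (sz x) + P₂.eval (sz x)))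
    (((((PolyBdd.const 4).mul .sz).add (.const 4)).add (PolyBdd.sz.eval Q)).add
      (((PolyBdd.const 8).add (PolyBdd.sz.eval P₁)).add (PolyBdd.sz.eval P₂)))
    ((hfs.add hgs).of_le fun x => by cases c x <;> simp) fun x m a b c' o => ?_
  obtain ⟨t, ht, hr⟩ := hq x ((trep x).bits ++ m) a b c' o
  obtain ⟨t₁, ht₁, hr₁⟩ := hp₁ x m a b c' o
  obtain ⟨t₂, ht₂, hr₂⟩ := hp₂ x m a b c' o
  cases hcx : c x with
  | false =>
    rw [hcx] at hr
    refine (Run.seq (run_dup _ _ _ _ _ _) (.seq hr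
      (Run.case' (o := some (.bit false)) rfl (s₁ := st ((trep x).bits ++ m) a b c' o)
        (by simp [trep, STree.bits]) hr₂))).exists_le ?_
    simp only [sz] at *; omega
  | true =>
    rw [hcx] at hr
    refine (Run.seq (run_dup _ _ _ _ _ _) (.seq hr
      (Run.case' (o := some (.bit true)) rfl
        (s₁ := st (STree.nil.bits ++ (STree.nil.bits ++ ((trep x).bits ++ m))) a b c' o)
        (by simp [trep, STree.bits]) (.seq (run_drop .nil _ _ _ _ _)
        (.seq (run_drop .nil _ _ _ _ _) hr₁))))).exists_le ?_
    simp only [sz, STree.size_nil] at *; omega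

/-! #### Lists -/

theorem cons {f : X → A} {g : X → List A} (hf : PT f) (hg : PT g) : PT fun x => f x :: g x :=
  (of_rep_eq (f := fun x : A × List A => x.1 :: x.2) fun _ => rfl).comp (hf.pair hg)

theorem isEmpty : PT fun l : List A => l.isEmpty := by
  refine .intro (.case .main fun
      | some (.bit true) => .seq drop (.seq drop (pushBits (trep false).bits))
      | _ => pushBits (trep true).bits) (fun x => 2 * sz x + 4)
    (((PolyBdd.const 2).mul .sz).add (.const 4)) ((PolyBdd.const 3).of_le fun x => sz_bool_le _)
    fun x m a b c o => ?_
  cases x with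
  | nil =>
    exact (Run.case' (o := some (.bit false)) rfl (s₁ := st m a b c o)
      (by simp [trep_nil, STree.bits]) (run_pushBits _ _ _ _ _ _)).exists_le (by omega)
  | cons x l =>
    refine (Run.case' (o := some (.bit true)) rfl
      (s₁ := st ((trep x).bits ++ ((trep l).bits ++ m)) a b c o)
      (by simp [trep_cons, STree.bits]) (.seq (run_drop _ _ _ _ _ _)
      (.seq (run_drop _ _ _ _ _ _) (run_pushBits _ _ _ _ _ _)))).exists_le ?_
    rw [sz_cons]; simp only [sz]; omega

theorem tail : PT fun l : List A => l.tail := by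
  refine .intro (.case .main fun
      | some (.bit true) => drop
      | _ => pushBits (trep ([] : List A)).bits) (fun x => 2 * sz x + 4)
    (((PolyBdd.const 2).mul .sz).add (.const 4))
    (PolyBdd.sz.of_le fun x => by cases x <;> simp; omega)
    fun x m a b c o => ?_
  cases x with
  | nil =>
    exact (Run.case' (o := some (.bit false)) rfl (s₁ := st m a b c o)
      (by simp [trep_nil, STree.bits]) (run_pushBits _ _ _ _ _ _)).exists_le (by omega)
  | cons x l =>
    refine (Run.case' (o := some (.bit true)) rfl
      (s₁ := st ((trep x).bits ++ ((trep l).bits ++ m)) a b c o)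
      (by simp [trep_cons, STree.bits]) (run_drop _ _ _ _ _ _)).exists_le ?_
    rw [sz_cons]; simp only [sz]; omega

theorem headD (d : A) : PT fun l : List A => l.headD d := by
  refine .intro (.case .main fun
      | some (.bit true) => .seq stash (.seq drop unstash)
      | _ => pushBits (trep d).bits) (fun x => 3 * sz x + 4)
    (((PolyBdd.const 3).mul .sz).add (.const 4))
    ((PolyBdd.sz.add (.const (sz d))).of_le fun x => by cases x <;> simp; omega)
    fun x m a b c o => ?_
  cases x with
  | nil =>
    exact (Run.case' (o := some (.bit false)) rfl (s₁ := st m a b c o)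
      (by simp [trep_nil, STree.bits]) (run_pushBits _ _ _ _ _ _)).exists_le (by omega)
  | cons x l =>
    refine (Run.case' (o := some (.bit true)) rfl
      (s₁ := st ((trep x).bits ++ ((trep l).bits ++ m)) a b c o)
      (by simp [trep_cons, STree.bits]) (.seq (run_stash _ _ _ _ _ _)
      (.seq (run_drop _ _ _ _ _ _) (run_unstash _ _ _ _ _ _)))).exists_le ?_
    rw [sz_cons]; simp only [sz]; omega

theorem run_iterate {p : Prog} {f : A → A} {T : ℕ} (w : List Γ') (hw : .blank ∉ w) (y : A)
    (hp : ∀ i < w.length, ∀ m a b c o, ∃ t, t ≤ T ∧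
      Run p (st ((trep (f^[i] y)).bits ++ m) a b c o)
        (st ((trep (f (f^[i] y))).bits ++ m) a b c o) t) (m a b c o : List Γ') :
    ∃ t, t ≤ w.length * (T + 1) + 1 ∧ Run (pour fun _ => p)
      (st ((trep y).bits ++ m) (w ++ .blank :: a) b c o)
      (st ((trep (f^[w.length] y)).bits ++ m) a b c o) t := by
  induction w generalizing y with
  | nil =>
    have : Run (pour fun _ => p) (st ((trep y).bits ++ m) (.blank :: a) b c o) _ 1 :=
      Run.loop_halt rfl rfl
    exact ⟨1, by simp, by simpa using this⟩
  | cons x w ih =>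
    simp only [List.mem_cons, not_or] at hw
    obtain ⟨t₁, ht₁, hr₁⟩ := hp 0 (by simp) m (w ++ .blank :: a) b c o
    obtain ⟨t₂, ht₂, hr₂⟩ := ih hw.2 (f y) fun i hi =>
      by simpa only [Function.iterate_succ_apply] using hp (i + 1) (by simpa using hi)
    refine ⟨t₁ + t₂ + 1, ?_, Run.loop_step (a := x) (l := w ++ .blank :: a) rfl ?_
      (s₁ := st ((trep (f y)).bits ++ m) (w ++ .blank :: a) b c o) ?_ hr₂⟩
    · simp only [List.length_cons, Nat.succ_mul]; omega
    · simpa [isBlank] using Ne.symm hw.1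
    · simpa using hr₁

/-- The code of `g x`, stashed on `aux`, serves as a clock: one symbol is consumed per round, hence
exactly `sz (g x)` rounds. Polynomial time for a single round does not suffice, as sizes may grow
exponentially; therefore all intermediate values have to be bounded. -/
theorem iterate {f : A → A} {g : X → B} {h : X → A} (hf : PT f) (hg : PT g) (hh : PT h)
    (hb : ∃ n : X → ℕ, PolyBdd n ∧ ∀ x, ∀ i ≤ sz (g x), sz (f^[i] (h x)) ≤ n x) :
    PT fun x => f^[sz (g x)] (h x) := by
  obtain ⟨n, hn, hb⟩ := hb
  have hgs := hg.polyBdd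
  have hps := (hg.pair hh).polyBdd
  obtain ⟨p, P, hp⟩ := hf.elim
  obtain ⟨q, Q, hq⟩ := (hg.pair hh).elim
  refine .intro (.seq q (.case .main fun _ => .seq stash (pour fun _ => p)))
    (fun x => Q.eval (sz x) + (sz (g x) + 1) + (sz (g x) * (P.eval (n x) + 1) + 1))
    (((PolyBdd.sz.eval Q).add (hgs.add (.const 1))).add
      ((hgs.mul ((hn.eval P).add (.const 1))).add (.const 1)))
    (hn.of_le fun x => hb x _ le_rfl) fun x m a b c o => ?_
  obtain ⟨t₁, ht₁, hr₁⟩ := hq x m a b c o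
  have hl : (trep (g x)).bits.reverse.length = sz (g x) := by simp [sz, STree.size]
  obtain ⟨t₂, ht₂, hr₂⟩ := run_iterate (p := p) (f := f) (T := P.eval (n x))
    (trep (g x)).bits.reverse (by simpa using STree.blank_notMem_bits _) (h x)
    (fun i hi m a b c o => by
      obtain ⟨t, ht, hr⟩ := hp (f^[i] (h x)) m a b c o
      exact ⟨t, ht.trans (P.eval_mono_nat (hb x i (by omega))), hr⟩) m a b c o
  rw [hl] at ht₂ hr₂
  refine ⟨t₁ + (sz (g x) + 1 + t₂), by omega, .seq hr₁ (Run.case' rfl rfl ?_)⟩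
  simp only [trep_pair, STree.bits, List.cons_append, List.append_assoc, st_main, List.tail_cons,
    update_st_main]
  exact .seq (run_stash _ _ _ _ _ _) hr₂

end PT

namespace PT

variable {A B S X : Type} [TreeRep A] [TreeRep B] [TreeRep S] [TreeRep X]

/-! #### Functions with finitely many relevant arguments -/

theorem isNilTree : PT fun t : STree => decide (t = .nil) := by
  refine .intro (.case .main fun
      | some (.bit true) => .seq drop (.seq drop (pushBits (trep false).bits))
      | _ => pushBits (trep true).bits) (fun x => 2 * sz x + 4)
    (((PolyBdd.const 2).mul .sz).add (.const 4)) ((PolyBdd.const 3).of_le fun x => sz_bool_le _)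
    fun x m a b c o => ?_
  cases x with
  | nil =>
    exact (Run.case' (o := some (.bit false)) rfl (s₁ := st m a b c o)
      (by simp [trep, STree.bits]) (run_pushBits _ _ _ _ _ _)).exists_le (by omega)
  | cons x l =>
    refine (Run.case' (o := some (.bit true)) rfl
      (s₁ := st (x.bits ++ (l.bits ++ m)) a b c o)
      (by simp [trep, STree.bits]) (.seq (run_drop _ _ _ _ _ _)
      (.seq (run_drop _ _ _ _ _ _) (run_pushBits _ _ _ _ _ _)))).exists_le ?_
    simp only [sz, trep, id, STree.size_cons]; omega

def treeLeft : STree → STree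
  | .nil => .nil
  | .cons l _ => l

def treeRight : STree → STree
  | .nil => .nil
  | .cons _ r => r

theorem leftTree : PT treeLeft := by
  refine .intro (.case .main fun
      | some (.bit true) => .seq stash (.seq drop unstash)
      | _ => pushBits STree.nil.bits) (fun x => 3 * sz x + 4)
    (((PolyBdd.const 3).mul .sz).add (.const 4))
    (PolyBdd.sz.of_le fun x => by cases x <;> simp [treeLeft, sz, trep]; omega)
    fun x m a b c o => ?_
  cases x with
  | nil =>
    exact (Run.case' (o := some (.bit false)) rfl (s₁ := st m a b c o)
      (by simp [trep, STree.bits]) (run_pushBits _ _ _ _ _ _)).exists_le (by omega)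
  | cons x l =>
    refine (Run.case' (o := some (.bit true)) rfl
      (s₁ := st (x.bits ++ (l.bits ++ m)) a b c o)
      (by simp [trep, STree.bits]) (.seq (run_stash _ _ _ _ _ _)
      (.seq (run_drop _ _ _ _ _ _) (run_unstash _ _ _ _ _ _)))).exists_le ?_
    simp only [sz, trep, id, STree.size_cons]; omega

theorem rightTree : PT treeRight := by
  refine .intro (.case .main fun
      | some (.bit true) => drop
      | _ => pushBits STree.nil.bits) (fun x => 3 * sz x + 4)
    (((PolyBdd.const 3).mul .sz).add (.const 4))
    (PolyBdd.sz.of_le fun x => by cases x <;> simp [treeRight, sz, trep]; omega)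
    fun x m a b c o => ?_
  cases x with
  | nil =>
    exact (Run.case' (o := some (.bit false)) rfl (s₁ := st m a b c o)
      (by simp [trep, STree.bits]) (run_pushBits _ _ _ _ _ _)).exists_le (by omega)
  | cons x l =>
    refine (Run.case' (o := some (.bit true)) rfl
      (s₁ := st (x.bits ++ (l.bits ++ m)) a b c o)
      (by simp [trep, STree.bits]) (run_drop _ _ _ _ _ _)).exists_le ?_
    simp only [sz, trep, id, STree.size_cons]; omega

theorem congr {f g : A → B} (hf : PT f) (h : ∀ x, f x = g x) : PT g := by
  rwa [← funext h]

theorem eqTree (d : STree) : PT fun t : STree => decide (t = d) := by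
  induction d with
  | nil => exact isNilTree
  | cons l r ihl ihr =>
    refine (isNilTree.cond (const false) ((ihl.comp leftTree).cond (ihr.comp rightTree)
      (const false))).congr fun t => ?_
    cases t with
    | nil => simp
    | cons l' r' =>
      by_cases h : l' = l <;> by_cases h' : r' = r <;> simp [treeLeft, treeRight, h, h']

/-- A table of finitely many values is searched by comparison with fixed trees. Nothing is assumed
about how `F` is obtained, so the non-constructive coordinates of the gadget can be built into the
program. -/
theorem finite [Inhabited B] (hA : Function.Injective (trep : A → STree)) (F : A → B)
    (T : List A) : ∃ G : A → B, PT G ∧ ∀ x ∈ T, G x = F x := by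
  classical
  induction T with
  | nil => exact ⟨fun _ => default, const _, by simp⟩
  | cons y T ih =>
    obtain ⟨G, hG, h⟩ := ih
    refine ⟨fun x => bif decide (trep x = trep y) then F y else G x,
      ((eqTree (trep y)).comp (of_rep_eq (f := fun x : A => trep x) fun _ => rfl)).cond
        (const _) hG, fun x hx => ?_⟩
    by_cases hxy : x = y
    · simp [hxy]
    · have : trep x ≠ trep y := fun h => hxy (hA h)
      simp only [this, decide_false, cond_false]
      exact h x (by simpa [hxy] using hx)

theorem of_fintype [Fintype A] [Inhabited B] (hA : Function.Injective (trep : A → STree))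
    (F : A → B) : PT F := by
  obtain ⟨G, hG, h⟩ := finite hA F Finset.univ.toList
  exact hG.congr fun x => h x (by simp)

/-! #### Recursion on lists -/

theorem sz_drop_le (l : List A) (n : ℕ) : sz (l.drop n) ≤ sz l := by
  have h := sz_append (l.take n) (l.drop n)
  have := sz_pos (l.take n)
  rw [List.take_append_drop] at h
  omega

/-- The fold is an iteration of the step that consumes the head of the list and does nothing on the
empty list. The size of a list exceeds its length, so `sz (l x)` rounds are enough. -/
theorem foldl [Inhabited B] {l : X → List B} {i : X → S} {h : X × S × B → S} (hl : PT l)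
    (hi : PT i) (hh : PT h) (hb : ∃ n : X → ℕ, PolyBdd n ∧ ∀ x k,
      sz (((l x).take k).foldl (fun s b => h (x, s, b)) (i x)) ≤ n x) :
    PT fun x => (l x).foldl (fun s b => h (x, s, b)) (i x) := by
  obtain ⟨n, hn, hb⟩ := hb
  let f : List B × X × S → List B × X × S := fun y =>
    bif y.1.isEmpty then y else (y.1.tail, y.2.1, h (y.2.1, y.2.2, y.1.headD default))
  have hf : PT f := (isEmpty.comp fst).cond .id ((tail.comp fst).pair
    ((fst.comp snd).pair (hh.comp ((fst.comp snd).pair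
      ((snd.comp snd).pair ((headD default).comp fst))))))
  have key : ∀ k l x s, f^[k] (l, x, s) =
      (l.drop k, x, (l.take k).foldl (fun s b => h (x, s, b)) s) := by
    intro k
    induction k with
    | zero => intro l x s; simp
    | succ k ih =>
      intro l x s
      rw [Function.iterate_succ_apply]
      cases l with
      | nil =>
        have := ih [] x s
        simpa [f] using this
      | cons b l =>
        have : f (b :: l, x, s) = (l, x, h (x, s, b)) := by simp [f]
        rw [this, ih]
        simp
  have := (snd.comp snd).comp (iterate hf hl (hl.pair (PT.id.pair hi))
    ⟨fun x => sz (l x) + (sz x + n x + 1) + 1,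
      (hl.polyBdd.add ((PolyBdd.sz.add hn).add (.const 1))).add (.const 1), fun x k _ => by
      rw [key]
      have h₁ := sz_drop_le (l x) k
      have h₂ := hb x k
      simp only [sz_pair]
      omega⟩)
  refine this.congr fun x => ?_
  rw [key, List.take_of_length_le (length_lt_sz (l x)).le]

/-- If one step adds to the state an amount depending on the argument and the list element but not
on the state, all intermediate states have polynomial size. -/
theorem foldl_of_add [Inhabited B] {l : X → List B} {i : X → S} {h : X × S × B → S} (hl : PT l)
    (hi : PT i) (hh : PT h) {n : X × B → ℕ} (hn : PolyBdd n)
    (hb : ∀ x s b, sz (h (x, s, b)) ≤ sz s + n (x, b)) :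
    PT fun x => (l x).foldl (fun s b => h (x, s, b)) (i x) := by
  obtain ⟨P, hP⟩ := hn
  refine foldl hl hi hh ⟨fun x => sz (i x) + sz (l x) * P.eval (sz x + sz (l x) + 1),
    hi.polyBdd.add (hl.polyBdd.mul (((PolyBdd.sz.add hl.polyBdd).add (.const 1)).eval P)),
    fun x k => ?_⟩
  have key : ∀ (l' : List B) s, (∀ b ∈ l', b ∈ l x) →
      sz (l'.foldl (fun s b => h (x, s, b)) s) ≤
        sz s + l'.length * P.eval (sz x + sz (l x) + 1) := by
    intro l'
    induction l' with
    | nil => intro s _; simp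
    | cons b l' ih =>
      intro s hs
      have h₁ := ih (h (x, s, b)) fun b hb => hs b (List.mem_cons_of_mem _ hb)
      have h₂ := hb x s b
      have h₃ := (hP (x, b)).trans (P.eval_mono_nat (show sz (x, b) ≤ sz x + sz (l x) + 1 by
        have := sz_le_of_mem (hs b List.mem_cons_self)
        rw [sz_pair]; omega))
      simp only [List.foldl_cons, List.length_cons, Nat.succ_mul] at *
      omega
  refine (key _ _ fun b hb => List.mem_of_mem_take hb).trans ?_
  have := (List.length_take_le' k (l x)).trans (length_lt_sz (l x)).le
  exact Nat.add_le_add_left (Nat.mul_le_mul_right _ this) _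

theorem reverse : PT fun l : List A => l.reverse := by
  -- Folds read the head with a default value; over an empty type there is only the empty list.
  by_cases hA : Nonempty A
  · have : Inhabited A := Classical.inhabited_of_nonempty hA
    refine (foldl_of_add (X := List A) (l := fun l => l) (i := fun _ => ([] : List A))
      (h := fun y => y.2.2 :: y.2.1) .id (const _)
      ((snd.comp snd).cons (fst.comp snd)) (n := fun y => sz y.2 + 1)
      (snd.polyBdd.add (.const 1)) fun x s b => ?_).congr fun l => ?_
    · rw [sz_cons]; dsimp only; omega
    · simp
  · refine PT.id.congr fun l => ?_
    cases l with
    | nil => rfl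
    | cons a => exact absurd ⟨a⟩ hA

theorem append {f g : X → List A} (hf : PT f) (hg : PT g) : PT fun x => f x ++ g x := by
  by_cases hA : Nonempty A
  · have : Inhabited A := Classical.inhabited_of_nonempty hA
    refine (foldl_of_add (l := fun x => (f x).reverse) (i := g)
      (h := fun y => y.2.2 :: y.2.1) (reverse.comp hf) hg
      ((snd.comp snd).cons (fst.comp snd)) (n := fun y => sz y.2 + 1)
      (snd.polyBdd.add (.const 1)) fun x s b => ?_).congr fun x => ?_
    · rw [sz_cons]; dsimp only; omega
    · simp
  · refine hg.congr fun x => ?_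
    cases h : f x with
    | nil => rfl
    | cons a => exact absurd ⟨a⟩ hA

theorem flatMap [Inhabited B] {l : X → List B} {f : X × B → List A} (hl : PT l) (hf : PT f) :
    PT fun x => (l x).flatMap fun b => f (x, b) := by
  refine (foldl_of_add (i := fun _ => []) (h := fun y => y.2.1 ++ f (y.1, y.2.2)) hl (const _)
    ((fst.comp snd).append (hf.comp (fst.pair (snd.comp snd)))) (n := fun y => sz (f y))
    hf.polyBdd fun x s b => ?_).congr fun x => ?_
  · have := sz_append s (f (x, b)); dsimp only; omega
  · have : ∀ (l' : List B) s, l'.foldl (fun s b => s ++ f (x, b)) s =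
        s ++ l'.flatMap fun b => f (x, b) := by
      intro l'
      induction l' with
      | nil => simp
      | cons b l' ih => intro s; simp [ih]
    simpa using this (l x) []

theorem map [Inhabited B] {l : X → List B} {f : X × B → A} (hl : PT l) (hf : PT f) :
    PT fun x => (l x).map fun b => f (x, b) :=
  (flatMap hl (hf.cons (const []))).congr fun x => by
    induction l x with
    | nil => rfl
    | cons b l ih => simp [ih]

theorem and {f g : X → Bool} (hf : PT f) (hg : PT g) : PT fun x => f x && g x :=
  (hf.cond hg (const false)).congr fun x => by cases f x <;> simp

theorem not {f : X → Bool} (hf : PT f) : PT fun x => !f x :=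
  (hf.cond (const false) (const true)).congr fun x => by cases f x <;> simp

theorem all [Inhabited B] {l : X → List B} {f : X × B → Bool} (hl : PT l) (hf : PT f) :
    PT fun x => (l x).all fun b => f (x, b) := by
  refine (foldl_of_add (i := fun _ => true) (h := fun y => y.2.1 && f (y.1, y.2.2)) hl (const _)
    ((fst.comp snd).and (hf.comp (fst.pair (snd.comp snd)))) (n := fun y => 3)
    (.const 3) fun x s b => ?_).congr fun x => ?_
  · exact (sz_bool_le _).trans (Nat.le_add_left _ _)
  · have : ∀ (l' : List B) s, l'.foldl (fun s b => s && f (x, b)) s =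
        (s && l'.all fun b => f (x, b)) := by
      intro l'
      induction l' with
      | nil => simp
      | cons b l' ih => intro s; simp [ih, Bool.and_assoc]
    simpa using this (l x) true

/-- Comparing the lengths of lists. -/
def _root_.lengthLE {A B : Type} (l : List A) (l' : List B) : Bool := (l'.foldl (fun s _ => s.tail) l).isEmpty

theorem _root_.lengthLE_iff {A B : Type} (l : List A) (l' : List B) : lengthLE l l' = true ↔ l.length ≤ l'.length := by
  unfold lengthLE
  induction l' generalizing l with
  | nil => cases l <;> simp
  | cons b l' ih =>
    rw [List.foldl_cons, ih]
    simp

theorem lengthLE_pt [Inhabited B] {l : X → List A} {l' : X → List B} (hl : PT l) (hl' : PT l') :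
    PT fun x => lengthLE (l x) (l' x) :=
  isEmpty.comp (foldl_of_add (h := fun y => y.2.1.tail) hl' hl (tail.comp (fst.comp snd))
    (n := fun _ => 0) (.const 0) fun x s b => by cases s <;> simp; try omega)

theorem zip [Inhabited A] [Inhabited B] {l : X → List A} {l' : X → List B} (hl : PT l)
    (hl' : PT l') : PT fun x => (l x).zip (l' x) := by
  have h : PT fun x => (l x).foldl (fun (s : List B × List (A × B)) b =>
      bif s.1.isEmpty then s else (s.1.tail, (b, s.1.headD default) :: s.2)) (l' x, []) := by
    refine foldl_of_add (h := fun y : X × (List B × List (A × B)) × A =>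
      bif y.2.1.1.isEmpty then y.2.1
        else (y.2.1.1.tail, (y.2.2, y.2.1.1.headD default) :: y.2.1.2)) hl (hl'.pair (const []))
      ?_ (n := fun y => sz y.2 + 2) (snd.polyBdd.add (.const 2)) fun x s b => ?_
    · have h₁ : PT fun y : X × (List B × List (A × B)) × A => y.2.1.1 := fst.comp (fst.comp snd)
      exact (isEmpty.comp h₁).cond (fst.comp snd) ((tail.comp h₁).pair
        (((snd.comp snd).pair ((headD default).comp h₁)).cons (snd.comp (fst.comp snd))))
    · obtain ⟨r, s⟩ := s
      cases r with
      | nil => simp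
      | cons c r => simp; omega
  refine (reverse.comp (snd.comp h)).congr fun x => ?_
  have : ∀ (l : List A) (l' : List B) s, (l.foldl (fun (s : List B × List (A × B)) b =>
      bif s.1.isEmpty then s else (s.1.tail, (b, s.1.headD default) :: s.2)) (l', s)).2 =
      (l.zip l').reverse ++ s := by
    intro l
    induction l with
    | nil => simp
    | cons a l ih =>
      intro l' s
      cases l' with
      | nil => simpa using ih [] s
      | cons b l' => simp [ih, -List.headD_eq_head?_getD]
  simp [this, -List.headD_eq_head?_getD]

theorem listBeq [Inhabited A] [BEq A] [LawfulBEq A] (hA : PT fun x : A × A => x.1 == x.2)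
    {l l' : X → List A} (hl : PT l) (hl' : PT l') : PT fun x => l x == l' x := by
  refine (((lengthLE_pt hl hl').and (lengthLE_pt hl' hl)).and
    (all (hl.zip hl') (hA.comp snd))).congr fun x => ?_
  rw [Bool.eq_iff_iff]
  simp only [Bool.and_eq_true, lengthLE_iff, beq_iff_eq, List.all_eq_true]
  constructor
  · rintro ⟨⟨h₁, h₂⟩, h₃⟩
    refine List.ext_getElem (le_antisymm h₁ h₂) fun i hi hi' => ?_
    exact h₃ ((l x)[i], (l' x)[i]) (List.mem_iff_getElem.2 ⟨i, by simp [hi, hi'], by simp⟩)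
  · intro h
    rw [h]
    refine ⟨⟨le_rfl, le_rfl⟩, fun y hy => ?_⟩
    obtain ⟨i, hi, rfl⟩ := List.mem_iff_getElem.1 hy
    simp

end PT

/-! ### Composition with a polynomial-time reduction -/

def unaryTree : ℕ → STree
  | 0 => .nil
  | n + 1 => .cons .nil (unaryTree n)

theorem size_unaryTree (n : ℕ) : (unaryTree n).size = 2 * n + 1 := by
  induction n with
  | zero => rfl
  | succ n ih => simp [unaryTree, ih]; omega

theorem unaryTree_injective : Function.Injective unaryTree := by
  intro m n h
  have := congrArg STree.size h
  simp only [size_unaryTree] at this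
  omega

instance {n : ℕ} : TreeRep (Fin n) := ⟨fun i => unaryTree i⟩

theorem trep_fin_injective {n : ℕ} : Function.Injective (trep : Fin n → STree) :=
  fun _ _ h => Fin.ext (unaryTree_injective h)

def symbols : List Γ' := [.bit false, .bit true, .bra, .ket, .comma, .blank]

theorem mem_symbols (x : Γ') : x ∈ symbols := by
  rcases x with _ | b | _ | _ | _ <;> (try cases b) <;> decide

instance : TreeRep Γ' := ⟨fun x => unaryTree (symbols.idxOf x)⟩

theorem trep_symbol_injective : Function.Injective (trep : Γ' → STree) :=
  fun x _ h => (List.idxOf_inj (mem_symbols x)).1 (unaryTree_injective h)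

theorem sz_symbol_le (x : Γ') : sz x ≤ 13 := by
  have : symbols.idxOf x < symbols.length := List.idxOf_lt_length_iff.2 (mem_symbols x)
  have h : sz x = 2 * symbols.idxOf x + 1 := size_unaryTree _
  have : symbols.length = 6 := rfl
  omega

/-- Reading a symbol from `main` and writing it to `io`. -/
def readSymbol : List Γ' → Prog
  | [] => .skip
  | x :: l => .case .main fun
      | some (.bit true) => .case .main fun _ => readSymbol l
      | _ => .push .io x

theorem run_readSymbol {l : List Γ'} {x : Γ'} (h : x ∈ l) (m a b c o : List Γ') :
    Run (readSymbol l) (st ((unaryTree (l.idxOf x)).bits ++ m) a b c o)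
      (st m a b c (x :: o)) 0 := by
  induction l with
  | nil => simp at h
  | cons y l ih =>
    by_cases hxy : y = x
    · subst hxy
      rw [List.idxOf_cons_self]
      exact Run.case' (o := some (.bit false)) rfl (s₁ := st m a b c o)
        (by simp [unaryTree, STree.bits]) (Run.push' (by simp))
    · rw [List.idxOf_cons_ne _ hxy]
      refine Run.case' (o := some (.bit true)) rfl
        (s₁ := st (.bit false :: ((unaryTree (l.idxOf x)).bits ++ m)) a b c o)
        (by simp [unaryTree, STree.bits]) ?_
      exact Run.case' (o := some (.bit false)) rfl
        (s₁ := st ((unaryTree (l.idxOf x)).bits ++ m) a b c o)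
        (by simp) (ih (by simpa [Ne.symm hxy] using h))

/-- Reading the input from `io`, where it stands in reverse. -/
def readInput : Prog :=
  .seq (.push .main (.bit false)) (.loop .io (fun _ => false) fun x =>
    .seq (pushBits (trep x).bits) (.push .main (.bit true)))

theorem run_readInput (w a b c : List Γ') :
    Run readInput (st [] a b c w.reverse) (st (trep w).bits a b c []) (w.length + 1) := by
  have h : ∀ v l : List Γ', Run (.loop .io (fun _ => false) fun x =>
      .seq (pushBits (trep x).bits) (.push .main (.bit true))) (st (trep l).bits a b c v)
      (st (trep (v.reverse ++ l)).bits a b c []) (v.length + 1) := by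
    intro v
    induction v with
    | nil => intro l; exact Run.loop_nil rfl
    | cons x v ih =>
      intro l
      refine (Run.loop_step (a := x) (l := v) rfl rfl
        (s₁ := st (trep (x :: l)).bits a b c v) ?_ (t₁ := 0) (t₂ := v.length + 1) ?_).cast
        (show 0 + (v.length + 1) + 1 = _ by simp)
      · rw [update_st_io]
        exact Run.seq (run_pushBits _ _ _ _ _ _) (Run.push' (by simp [trep_cons, STree.bits]))
      · simpa using ih (x :: l)
  refine (Run.seq (Run.push' rfl) (t₂ := w.length + 1) ?_).cast (Nat.zero_add _)
  simpa [trep_nil, STree.bits] using h w.reverse []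

/-- Writing the output to `io`, in reverse. -/
def writeOutput : Prog := .loop .main (fun x => decide (x ≠ .bit true)) fun _ => readSymbol symbols

theorem run_writeOutput (w a b c o : List Γ') :
    Run writeOutput (st (trep w).bits a b c o) (st [] a b c (w.reverse ++ o)) (w.length + 1) := by
  induction w generalizing o with
  | nil =>
    have : Run writeOutput (st [.bit false] a b c o) _ 1 := Run.loop_halt rfl rfl
    simpa [trep_nil, STree.bits] using this
  | cons x w ih =>
    refine (Run.loop_step (a := .bit true) (l := (trep x).bits ++ (trep w).bits)
      rfl rfl (t₁ := 0) (s₁ := st (trep w).bits a b c (x :: o)) ?_ (t₂ := w.length + 1) ?_).cast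
        (show 0 + (w.length + 1) + 1 = _ by simp)
    · rw [update_st_main]
      exact run_readSymbol (mem_symbols x) (trep w).bits a b c o
    · rw [List.reverse_cons, List.append_assoc]
      exact ih (x :: o)

section machine

open Turing Turing.TM2

theorem initList_stk (tm : FinTM2) (s : List (tm.Γ tm.k₀)) :
    (initList tm s).stk = Function.update (fun _ => []) tm.k₀ s := by
  funext k
  by_cases h : k = tm.k₀
  · subst h; simp [initList]
  · simp [initList, h]

theorem haltList_stk (tm : FinTM2) (s : List (tm.Γ tm.k₁)) :
    (haltList tm s).stk = Function.update (fun _ => []) tm.k₁ s := by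
  funext k
  by_cases h : k = tm.k₁
  · subst h; simp [haltList]
  · simp [haltList, h]

/-- The last statement of a composed machine. -/
def finish (tm : FinTM2) (Λ : Type) : ExtStmt tm.Γ tm.σ Λ := .load (fun v => (v.1, none)) .halt

/-- The statement that moves the output of a machine to the stack `io` and starts a stack
program. -/
noncomputable def transfer (tm : FinTM2) (e : tm.Γ tm.k₁ ≃ Γ') (p : Prog) :
    ExtStmt tm.Γ tm.σ (tm.Λ ⊕ Option p.Lbl) :=
  .pop (.inl tm.k₁) (fun v o => (v.1, Option.map e o))
    (.branch (fun v => v.2.isSome)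
      (.push (.inr .io) (fun v => v.2.getD .blank) (.goto fun _ => .inr none))
      (p.entry (fun l => .inr (some l)) (finish tm _)))

/-- The code of the machine `tm`, followed by the stack program `p`. -/
noncomputable def composedCode (tm : FinTM2) (e : tm.Γ tm.k₁ ≃ Γ') (p : Prog) :
    tm.Λ ⊕ Option p.Lbl → ExtStmt tm.Γ tm.σ (tm.Λ ⊕ Option p.Lbl)
  | .inl l => extStmt (.inr none) .inl (tm.m l)
  | .inr none => transfer tm e p
  | .inr (some l) => p.code (fun l => .inr (some l)) (finish tm _) l

/-- The machine `tm`, followed by the stack program `p`. -/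
noncomputable def composedMachine (tm : FinTM2) (e : tm.Γ tm.k₁ ≃ Γ') (p : Prog) : FinTM2 :=
  letI := tm.kFin
  letI := tm.ΛFin
  letI := tm.σFin
  letI := p.fintypeLbl
  letI : Fintype (extAlphabet tm.Γ (.inl tm.k₀)) := tm.Γk₀Fin
  { K := tm.K ⊕ Stk
    k₀ := .inl tm.k₀
    k₁ := .inr .io
    Γ := extAlphabet tm.Γ
    Λ := tm.Λ ⊕ Option p.Lbl
    main := .inl tm.main
    σ := tm.σ × Option Γ'
    initialState := (tm.initialState, none)
    m := composedCode tm e p }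

theorem stepAux_transfer_cons (tm : FinTM2) (e : tm.Γ tm.k₁ ≃ Γ') (p : Prog) (v : tm.σ)
    (o : Option Γ') (S : ∀ k, List (extAlphabet tm.Γ k)) {x : tm.Γ tm.k₁} {l : List (tm.Γ tm.k₁)}
    (hS : S (.inl tm.k₁) = x :: l) :
    stepAux (transfer tm e p) (v, o) S = ⟨some (.inr none), (v, some (e x)),
      Function.update (Function.update S (.inl tm.k₁) l) (.inr .io) (e x :: S (.inr .io))⟩ := by
  unfold transfer
  simp only [stepAux, hS, List.head?_cons, Option.map_some, Option.isSome_some, cond_true,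
    List.tail_cons, Option.getD_some]
  rw [Function.update_of_ne (by simp : (Sum.inr Stk.io : tm.K ⊕ Stk) ≠ Sum.inl tm.k₁)]

/-- Moving symbols one at a time reverses the word, which is the order in which `readInput` expects
it on `io`. -/
theorem steps_transfer (tm : FinTM2) (e : tm.Γ tm.k₁ ≃ Γ') (p : Prog)
    (l : List (tm.Γ tm.k₁)) (v : tm.σ) (o : Option Γ') (v' : List Γ') :
    StepsTo (composedCode tm e p) (l.length + 1)
      ⟨some (.inr none), (v, o), joinStk (Function.update (fun _ => []) tm.k₁ l)
        (st [] [] [] [] v')⟩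
      (stepAux (p.entry (fun l => .inr (some l)) (finish tm _)) (v, none)
        (joinStk (fun _ => []) (st [] [] [] [] ((l.map e).reverse ++ v')))) := by
  induction l generalizing o v' with
  | nil =>
    have h := StepsTo.one (composedCode tm e p) (.inr none) (v, o)
      (joinStk (Function.update (fun _ => []) tm.k₁ []) (st [] [] [] [] v'))
    have h₁ : Function.update (fun _ => [] : ∀ k, List (tm.Γ k)) tm.k₁ [] = fun _ => [] :=
      Function.update_eq_self _ _
    rw [h₁] at h ⊢
    have h₂ : stepAux ((composedCode tm e p) (.inr none)) (v, o)
        (joinStk (fun _ => []) (st [] [] [] [] v')) =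
        stepAux (p.entry (fun l => .inr (some l)) (finish tm _)) (v, none)
          (Function.update (joinStk (fun _ => []) (st [] [] [] [] v')) (.inl tm.k₁) []) := rfl
    rw [h₂, joinStk_update_inl, h₁] at h
    exact h
  | cons x l ih =>
    have h := StepsTo.one (composedCode tm e p) (.inr none) (v, o)
      (joinStk (Function.update (fun _ => []) tm.k₁ (x :: l)) (st [] [] [] [] v'))
    have h₁ : joinStk (Function.update (fun _ => []) tm.k₁ (x :: l)) (st [] [] [] [] v')
        (.inl tm.k₁) = x :: l :=
      Function.update_self (β := fun k => List (tm.Γ k)) tm.k₁ (x :: l) (fun _ => [])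
    have h₂ := stepAux_transfer_cons tm e p v o _ h₁
    rw [joinStk_update_inl, joinStk_update_inr, Function.update_idem, update_st_io] at h₂
    change StepsTo _ 1 _ (stepAux (transfer tm e p) _ _) at h
    rw [h₂] at h
    have := h.trans (ih (some (e x)) (e x :: v'))
    rw [Nat.add_comm 1] at this
    simpa using this

end machine

/-- The composition of a function computed by a Turing machine in polynomial time with a function
computed by a stack program in polynomial time. -/
theorem PolyTimeComputable.comp_pt {Γ₀ : Type} {f : List Γ₀ → List Γ'}
    (hf : PolyTimeComputable id id f) {g : List Γ' → List Γ'} (hg : PT g) :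
    PolyTimeComputable id id fun x => g (f x) := by
  obtain ⟨⟨⟨tm, e₀, e₁⟩, P, hP⟩⟩ := hf
  -- `writeOutput` reverses the word it writes, so the program computes the reverse of the value of
  -- `g`.
  obtain ⟨q, Q, hq⟩ := PT.reverse.comp hg
  let p : Prog := .seq readInput (.seq q writeOutput)
  obtain ⟨c₀, hc₀⟩ : ∃ c₀, ∀ l, stmtPushes (tm.m l) ≤ c₀ := by
    let _ := tm.ΛFin
    exact ⟨Finset.univ.sup fun l => stmtPushes (tm.m l),
      fun l => Finset.le_sup (f := fun l => stmtPushes (tm.m l)) (Finset.mem_univ l)⟩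
  -- A bound for the length of `f x`: the length of the input plus at most `c₀` symbols pushed in
  -- each step.
  let N : Polynomial ℕ := Polynomial.X + Polynomial.C c₀ * P
  -- The summands pay for the machine, for the transfer, for reading, and for `q` together with
  -- writing; the last is one summand because `PT` bounds the time plus the size of the value. A
  -- symbol has size at most 13 and a list cell adds 1, whence `14 * N + 1`.
  let T : Polynomial ℕ := P + (N + 1) + (N + 1) + Q.comp (Polynomial.C 14 * N + 1)
  suffices h : ∀ x, ∃ n, n ≤ T.eval x.length ∧ StepsTo (composedCode tm e₁ p) n
      (extCfg (.inr none) .inl none (st [] [] [] [] []) (Turing.initList tm (x.map e₀.symm)))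
      ⟨none, (tm.initialState, none), joinStk (fun _ => []) (st [] [] [] [] (g (f x)))⟩ by
    have hinit : ∀ x, Turing.initList (composedMachine tm e₁ p) (List.map e₀.invFun x) =
        extCfg (.inr none) .inl none (st [] [] [] [] [])
          (Turing.initList tm (x.map e₀.symm)) := by
      intro x
      refine congrArg (Turing.TM2.Cfg.mk _ _) ?_
      refine (initList_stk _ _).trans ?_
      rw [initList_stk, ← joinStk_update_inl]
      refine congrArg (fun S => Function.update S _ _) (funext fun k => ?_)
      rcases k with k | k
      · rfl
      · cases k <;> rfl
    have hhalt : ∀ y : List Γ', Turing.haltList (composedMachine tm e₁ p) y =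
        ⟨none, (tm.initialState, none), joinStk (fun _ => []) (st [] [] [] [] y)⟩ := by
      intro y
      refine congrArg (Turing.TM2.Cfg.mk _ _) ?_
      refine (haltList_stk _ _).trans ?_
      rw [← update_st_io [] [] [] [] [] y, ← joinStk_update_inr]
      refine congrArg (fun S => Function.update S _ _) (funext fun k => ?_)
      rcases k with k | k
      · rfl
      · cases k <;> rfl
    refine ⟨⟨⟨composedMachine tm e₁ p, e₀, Equiv.refl Γ'⟩, T,
      fun x => ⟨⟨(h x).choose, ?_⟩, (h x).choose_spec.1⟩⟩⟩
    refine (congrArg (fun c => (flip bind (composedMachine tm e₁ p).step)^[(h x).choose] (some c))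
      (hinit x)).trans (Eq.trans (h x).choose_spec.2 (congrArg some ?_))
    refine (hhalt _).symm.trans (congrArg (Turing.haltList (composedMachine tm e₁ p)) ?_)
    exact (List.map_id' (g (f x))).symm
  intro x
  obtain ⟨n₁, h₁, hn₁⟩ : ∃ n₁, StepsTo tm.m n₁ (Turing.initList tm (x.map e₀.symm))
      (Turing.haltList tm ((f x).map e₁.symm)) ∧ n₁ ≤ P.eval x.length :=
    ⟨(hP x).steps, (hP x).evals_in_steps, (hP x).steps_le_m⟩
  have hlen : (f x).length ≤ N.eval x.length := by
    have := StepsTo.length_le hc₀ h₁ (B := x.length) (fun k => by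
      rw [initList_stk]
      by_cases hk : k = tm.k₀
      · subst hk; simp
      · simp [hk]) tm.k₁
    rw [haltList_stk, Function.update_self, List.length_map] at this
    simp only [N, Polynomial.eval_add, Polynomial.eval_X, Polynomial.eval_mul, Polynomial.eval_C]
    exact this.trans (Nat.add_le_add_left (Nat.mul_le_mul_left _ hn₁) _)
  have hs₁ := StepsTo.ext (M := composedCode tm e₁ p) (i := Sum.inl) (e := Sum.inr none)
    (fun _ => rfl) none (st [] [] [] [] []) h₁
  have hs₂ := steps_transfer tm e₁ p ((f x).map e₁.symm) tm.initialState none []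
  have hx : extCfg (Sum.inr none : tm.Λ ⊕ Option p.Lbl) Sum.inl none (st [] [] [] [] [])
      (Turing.haltList tm ((f x).map e₁.symm)) = ⟨some (.inr none), (tm.initialState, none),
        joinStk (Function.update (fun _ => []) tm.k₁ ((f x).map e₁.symm)) (st [] [] [] [] [])⟩ := by
    rw [← haltList_stk]; rfl
  rw [hx] at hs₁
  obtain ⟨t, ht, hr⟩ := hq (f x) [] [] [] [] []
  simp only [List.append_nil] at hr
  have hrun := Run.seq (run_readInput (f x) [] [] []) (.seq hr (run_writeOutput _ [] [] [] []))
  obtain ⟨n₃, o', hn₃, hs₃⟩ := hrun.stepsTo (composedCode tm e₁ p)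
    (fun l => .inr (some l)) (finish tm _) (fun _ => rfl) tm.initialState none (fun _ => [])
  simp only [List.map_map, List.append_nil, List.reverse_reverse] at hs₂ hs₃
  rw [show (e₁ : tm.Γ tm.k₁ → Γ') ∘ e₁.symm = id from funext fun y => e₁.apply_symm_apply y,
    List.map_id] at hs₂
  refine ⟨_, ?_, hs₁.trans (hs₂.trans hs₃)⟩
  have hsz : sz (f x) ≤ 14 * N.eval x.length + 1 := by
    refine (sz_le_of_forall (C := 13) fun y _ => sz_symbol_le y).trans ?_
    omega
  have h₁ := length_lt_sz (g (f x)).reverse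
  have h₂ := ht.trans (Q.eval_mono_nat hsz)
  simp only [T, Polynomial.eval_add, Polynomial.eval_comp, Polynomial.eval_mul, Polynomial.eval_C,
    Polynomial.eval_one, List.length_map] at *
  omega

set_option linter.unusedSectionVars false

/-! ### The reduction on strings -/

/-- One step of reading an instance: the state holds the number that is being read (its bits in
reverse), the numbers read since the last bracket, and the lists that have been closed. -/
def parseStep (s : (List Bool × List (List Bool)) × List (List (List Bool))) (c : Γ') :
    (List Bool × List (List Bool)) × List (List (List Bool)) :=
  bif decide (c = .comma) then (([], s.1.1 :: s.1.2), s.2)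
  else bif decide (c = .bra) then (([], []), s.2)
  else bif decide (c = .ket) then (([], []), s.1.2 :: s.2)
  else (((sectionΓ'Bool c) :: s.1.1, s.1.2), s.2)

def parse (w : List Γ') : (List Bool × List (List Bool)) × List (List (List Bool)) :=
  w.foldl parseStep (([], []), [])

/-- The collection of sets of an instance. -/
def parseSets (w : List Γ') : List (List (List Bool)) := (parse w).2.tail

/-- The bits of the parameter of an instance, the most significant bit first. -/
def parseParam (w : List Γ') : List Bool := (parse w).1.2.headD []

/-- Adding one to a binary number. -/
def binSucc (l : List Bool) : List Bool :=
  let s := l.foldl (fun (s : Bool × List Bool) b => (s.1 && b, (s.1 ^^ b) :: s.2)) (true, [])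
  (bif s.1 then true :: s.2 else s.2).reverse

/-- The length of a list, in binary. -/
def binLength {A : Type} (l : List A) : List Bool := l.foldl (fun s _ => binSucc s) []

/-- The binary length of a list plus a constant, in unary. -/
def logLength {A : Type} (a : ℕ) (l : List A) : List Unit :=
  (binLength l).map (fun _ => ()) ++ List.replicate a ()

section code

variable {Q : ℕ} [NeZero Q]

/-- All words of a given length. -/
def allWords (Q : ℕ) (l : List Unit) : List (List (Fin Q)) :=
  l.foldl (fun W _ => W.flatMap fun w => (List.finRange Q).map fun d => d :: w) [[]]

/-- Two words agree in at most a fraction `1 / D` of their positions. -/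
def farApart (D : ℕ) (w w' : List (Fin Q)) : Bool :=
  lengthLE ((w.zip w').flatMap fun p => bif p.1 == p.2 then List.replicate D () else []) w'

/-- A greedily chosen code. -/
def greedyCode (D : ℕ) (W : List (List (Fin Q))) : List (List (Fin Q)) :=
  W.foldl (fun C w => bif C.all fun w' => farApart D w w' then w :: C else C) []

/-- The last word assigned to a key. -/
def lookupWord (l : List (List Bool × List (Fin Q))) (u : List Bool) : List (Fin Q) :=
  l.foldl (fun w p => bif p.1 == u then p.2 else w) []

/-- The words assigned to the elements of the sets in `E`. -/
def codeTable (Q : ℕ) (D a : ℕ) (E : List (List (List Bool))) : List (List Bool × List (Fin Q)) :=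
  (E.flatMap fun T => T).zip (greedyCode D (allWords Q (logLength a E)))

/-- The rows of a list of words of the same length, the last one first. -/
def wordRows (l : List Unit) (T : List (List (Fin Q))) : List (List (Fin Q)) :=
  (l.foldl (fun (s : List (List (Fin Q)) × List (List (Fin Q))) _ =>
    (s.1.map fun w => w.tail, (s.1.map fun w => w.headD 0) :: s.2)) (T, [])).2

/-- The rows of the words assigned to a set. -/
def codedRows (Q : ℕ) [NeZero Q] (D a : ℕ) (E : List (List (List Bool))) (T : List (List Bool)) :
    List (List (Fin Q)) :=
  wordRows (logLength a E) (T.map fun u => lookupWord (codeTable Q D a E) u)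

end code

/-- A binary number (the most significant bit first) in unary, capped by the length of a list. -/
def cappedUnary {A : Type} (E : List A) (k : List Bool) : List Unit :=
  k.foldl (fun s b => ((s ++ (s ++ bif b then [()] else [])).zip E).map fun p => p.1) []

/-- The string of a binary number. -/
def bitString (l : List Bool) : List Γ' := (l.map fun b => Γ'.bit b) ++ [Γ'.comma]

/-- The strings from which the coordinates of points and centers are composed. -/
structure CoordStrings (Q R J : ℕ) where
  point : List (Fin Q) → List Γ'
  center : Fin J × List (Fin Q) → List Γ'
  pointLast : Fin R → List Γ'
  centerLast : Fin J → List Γ'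

/-- The string of the `k`-means instance made from the collection `E` and the parameter `k`. -/
def reductionString {Q R J : ℕ} [NeZero Q] (c : CoordStrings Q R J) (D a D₀ : ℕ)
    (E : List (List (List Bool))) (k : List Bool) : List Γ' :=
  bitString (binLength (() :: (logLength a E).flatMap fun _ => List.replicate D₀ ())) ++
    ((Γ'.bra :: ((E.flatMap fun T => (List.finRange R).flatMap fun r =>
      Γ'.bra :: (((codedRows Q D a E T).flatMap fun ρ => c.point ρ) ++
        (c.pointLast r ++ [Γ'.ket]))) ++ [Γ'.ket])) ++
    ((Γ'.bra :: ((E.flatMap fun T => (List.finRange J).flatMap fun j =>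
      Γ'.bra :: (((codedRows Q D a E T).flatMap fun ρ => c.center (j, ρ)) ++
        (c.centerLast j ++ [Γ'.ket]))) ++ [Γ'.ket])) ++
    bitString (binLength (cappedUnary E k))))

/-- The reduction; instances with `k = 0` are mapped to a fixed string. -/
def reduction {Q R J : ℕ} [NeZero Q] (c : CoordStrings Q R J) (D a D₀ : ℕ) (bad : List Γ')
    (w : List Γ') : List Γ' :=
  bif (parseParam w).isEmpty then bad else reductionString c D a D₀ (parseSets w) (parseParam w)

/-! ### Binary numerals and their lengths -/

theorem foldl_binSucc_step (l : List Bool) : ∀ s : Bool × List Bool,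
    (l.foldl (fun (s : Bool × List Bool) b => (s.1 && b, (s.1 ^^ b) :: s.2)) s).2.length =
      l.length + s.2.length := by
  induction l with
  | nil => intro s; simp
  | cons b l ih => intro s; rw [List.foldl_cons, ih]; simp; omega

theorem length_binSucc_le (l : List Bool) : (binSucc l).length ≤ l.length + 1 := by
  have := foldl_binSucc_step l (true, [])
  unfold binSucc
  simp only [List.length_reverse] at *
  cases (l.foldl (fun (s : Bool × List Bool) b => (s.1 && b, (s.1 ^^ b) :: s.2)) (true, [])).1 <;>
    simp_all

/-- Adding one to a binary number, the least significant bit first. -/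
def binSuccRec : List Bool → List Bool
  | [] => [true]
  | false :: l => true :: l
  | true :: l => false :: binSuccRec l

theorem binSucc_eq (l : List Bool) : binSucc l = binSuccRec l := by
  have h : ∀ (l : List Bool) (c : Bool) (t : List Bool),
      (bif (l.foldl (fun (s : Bool × List Bool) b => (s.1 && b, (s.1 ^^ b) :: s.2)) (c, t)).1
        then true :: (l.foldl (fun (s : Bool × List Bool) b =>
          (s.1 && b, (s.1 ^^ b) :: s.2)) (c, t)).2
        else (l.foldl (fun (s : Bool × List Bool) b =>
          (s.1 && b, (s.1 ^^ b) :: s.2)) (c, t)).2).reverse =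
        t.reverse ++ bif c then binSuccRec l else l := by
    intro l
    induction l with
    | nil => intro c t; cases c <;> simp [binSuccRec]
    | cons b l ih =>
      intro c t
      rw [List.foldl_cons, ih]
      cases c <;> cases b <;> simp [binSuccRec]
  simpa [binSucc] using h l true []

theorem encodePosNum_succ (n : PosNum) : encodePosNum n.succ = binSuccRec (encodePosNum n) := by
  induction n with
  | one => rfl
  | bit0 n ih => rfl
  | bit1 n ih => rw [PosNum.succ, encodePosNum, ih]; rfl

theorem encodeNat_succ (n : ℕ) : encodeNat (n + 1) = binSucc (encodeNat n) := by
  rw [binSucc_eq]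
  unfold encodeNat
  rw [Nat.cast_succ, Num.add_one]
  cases (n : Num) with
  | zero => rfl
  | pos m => exact encodePosNum_succ m

theorem binLength_eq {A : Type} (l : List A) : binLength l = encodeNat l.length := by
  have h : ∀ n, l.foldl (fun s _ => binSucc s) (encodeNat n) = encodeNat (n + l.length) := by
    induction l with
    | nil => intro n; rfl
    | cons a l ih =>
      intro n
      rw [List.foldl_cons, ← encodeNat_succ, ih, List.length_cons, Nat.add_right_comm, Nat.add_assoc]
  have := h 0
  rwa [Nat.zero_add] at this

theorem length_encodePosNum (n : PosNum) :
    (n : ℕ) < 2 ^ (encodePosNum n).length ∧ 2 ^ (encodePosNum n).length ≤ 2 * (n : ℕ) := by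
  induction n with
  | one => simp [encodePosNum]
  | bit0 n ih =>
    simp only [encodePosNum, List.length_cons, pow_succ, PosNum.cast_bit0]
    omega
  | bit1 n ih =>
    simp only [encodePosNum, List.length_cons, pow_succ, PosNum.cast_bit1]
    omega

theorem lt_two_pow_length_encodeNat (n : ℕ) : n < 2 ^ (encodeNat n).length := by
  unfold encodeNat
  have h : ((n : Num) : ℕ) = n := Num.to_of_nat n
  cases hn : (n : Num) with
  | zero => rw [hn] at h; simp at h; subst h; simp [encodeNum]
  | pos m =>
    rw [hn] at h
    have := (length_encodePosNum m).1
    simp only [encodeNum]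
    have h' : (m : ℕ) = n := h
    omega

theorem two_pow_length_encodeNat_le {n : ℕ} (h0 : n ≠ 0) :
    2 ^ (encodeNat n).length ≤ 2 * n := by
  unfold encodeNat
  have h : ((n : Num) : ℕ) = n := Num.to_of_nat n
  cases hn : (n : Num) with
  | zero => rw [hn] at h; simp at h; omega
  | pos m =>
    rw [hn] at h
    have := (length_encodePosNum m).2
    simp only [encodeNum]
    have h' : (m : ℕ) = n := h
    omega

theorem two_pow_length_binLength_le {A : Type} (l : List A) :
    2 ^ (binLength l).length ≤ 2 * l.length + 1 := by
  rw [binLength_eq]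
  by_cases h : l.length = 0
  · rw [h]; decide
  · exact (two_pow_length_encodeNat_le h).trans (Nat.le_succ _)

/-! ### Polynomial-time computability of the reduction -/

namespace PT

variable {A B X : Type} [TreeRep A] [TreeRep B] [TreeRep X]

theorem xor {f g : X → Bool} (hf : PT f) (hg : PT g) : PT fun x => (f x ^^ g x) :=
  (hf.cond hg.not hg).congr fun x => by cases f x <;> simp

theorem trep_bool_injective : Function.Injective (trep : Bool → STree) := by
  intro x y h
  cases x <;> cases y <;> first | rfl | cases h

theorem parseStep_pt : PT fun y : ((List Bool × List (List Bool)) × List (List (List Bool))) × Γ' =>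
    parseStep y.1 y.2 := by
  have h (c : Γ') : PT fun y : ((List Bool × List (List Bool)) × List (List (List Bool))) × Γ' =>
      decide (y.2 = c) := (of_fintype trep_symbol_injective fun x => decide (x = c)).comp snd
  have h₁ : PT fun y : ((List Bool × List (List Bool)) × List (List (List Bool))) × Γ' => y.1.1.1 :=
    fst.comp (fst.comp fst)
  have h₂ : PT fun y : ((List Bool × List (List Bool)) × List (List (List Bool))) × Γ' => y.1.1.2 :=
    snd.comp (fst.comp fst)
  have h₃ : PT fun y : ((List Bool × List (List Bool)) × List (List (List Bool))) × Γ' => y.1.2 :=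
    snd.comp fst
  exact (h .comma).cond (((const []).pair (h₁.cons h₂)).pair h₃)
    ((h .bra).cond (((const []).pair (const [])).pair h₃)
    ((h .ket).cond (((const []).pair (const [])).pair (h₂.cons h₃))
      (((((of_fintype trep_symbol_injective sectionΓ'Bool).comp snd).cons h₁).pair h₂).pair h₃)))

theorem parse_pt : PT parse := by
  refine foldl_of_add (X := List Γ') (l := fun w => w) (i := fun _ => (([], []), []))
    (h := fun y => parseStep y.2.1 y.2.2) .id (const _) (parseStep_pt.comp snd)
    (n := fun _ => 4) (.const 4) fun x s b => ?_
  obtain ⟨⟨s₁, s₂⟩, s₃⟩ := s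
  have := sz_bool_le (sectionΓ'Bool b)
  have := sz_pos s₁
  have := sz_pos s₂
  unfold parseStep
  cases decide (b = .comma) <;> cases decide (b = .bra) <;> cases decide (b = .ket) <;>
    simp <;> omega

theorem parseSets_pt : PT parseSets := tail.comp (snd.comp parse_pt)

theorem parseParam_pt : PT parseParam := (headD []).comp (snd.comp (fst.comp parse_pt))

theorem binSucc_pt : PT binSucc := by
  have h : PT fun l : List Bool =>
      l.foldl (fun (s : Bool × List Bool) b => (s.1 && b, (s.1 ^^ b) :: s.2)) (true, []) := by
    refine foldl_of_add (X := List Bool) (l := fun w => w) (i := fun _ => (true, []))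
      (h := fun y => (y.2.1.1 && y.2.2, (y.2.1.1 ^^ y.2.2) :: y.2.1.2)) .id (const _) ?_
      (n := fun _ => 7) (.const 7) fun x s b => ?_
    · have h₁ : PT fun y : List Bool × (Bool × List Bool) × Bool => y.2.1.1 :=
        fst.comp (fst.comp snd)
      have h₂ : PT fun y : List Bool × (Bool × List Bool) × Bool => y.2.2 := snd.comp snd
      exact (h₁.and h₂).pair ((h₁.xor h₂).cons (snd.comp (fst.comp snd)))
    · obtain ⟨s₁, s₂⟩ := s
      have h₁ := sz_bool_le (s₁ && b)
      have h₂ := sz_bool_le (s₁ ^^ b)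
      simp only [sz_pair, sz_cons]
      omega
  exact reverse.comp ((fst.comp h).cond ((const true).cons (snd.comp h)) (snd.comp h))

theorem sz_boolList_le (l : List Bool) : sz l ≤ l.length * 4 + 1 :=
  sz_le_of_forall fun b _ => sz_bool_le b

theorem length_binLength_le (l : List A) : (binLength l).length ≤ l.length := by
  unfold binLength
  have : ∀ s : List Bool, (l.foldl (fun s _ => binSucc s) s).length ≤ l.length + s.length := by
    induction l with
    | nil => simp
    | cons a l ih =>
      intro s
      have := length_binSucc_le s
      have := ih (binSucc s)
      simp only [List.foldl_cons, List.length_cons]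
      omega
  simpa using this []

theorem binLength_pt [Inhabited A] : PT fun l : List A => binLength l := by
  refine foldl (X := List A) (l := fun l => l) (i := fun _ => ([] : List Bool))
    (h := fun y => binSucc y.2.1) .id (const _) (binSucc_pt.comp (fst.comp snd))
    ⟨fun x => sz x * 4 + 1, (PolyBdd.sz.mul (.const 4)).add (.const 1), fun x k => ?_⟩
  change sz (binLength (x.take k)) ≤ sz x * 4 + 1
  have h₁ := sz_boolList_le (binLength (x.take k))
  have h₂ := length_binLength_le (x.take k)
  have h₃ := List.length_take_le' k x
  have h₄ := length_lt_sz x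
  omega

theorem logLength_pt [Inhabited A] (a : ℕ) : PT fun l : List A => logLength a l :=
  (map (f := fun _ => ()) binLength_pt (const _)).append (const _)

theorem sz_fin_le {Q : ℕ} (i : Fin Q) : sz i ≤ 2 * Q := by
  have : sz i = 2 * (i : ℕ) + 1 := size_unaryTree _
  omega

variable {Q : ℕ} [NeZero Q]

theorem allWords_spec (Q : ℕ) (l : List Unit) :
    (allWords Q l).length = Q ^ l.length ∧ ∀ w ∈ allWords Q l, w.length = l.length := by
  unfold allWords
  have key : ∀ (l : List Unit) (W : List (List (Fin Q))) (m n : ℕ), W.length = m →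
      (∀ w ∈ W, w.length = n) →
      (l.foldl (fun W _ => W.flatMap fun w => (List.finRange Q).map fun d => d :: w) W).length =
        m * Q ^ l.length ∧
      ∀ w ∈ l.foldl (fun W _ => W.flatMap fun w => (List.finRange Q).map fun d => d :: w) W,
        w.length = n + l.length := by
    intro l
    induction l with
    | nil => intro W m n h₁ h₂; exact ⟨by simpa using h₁, by simpa using h₂⟩
    | cons b l ih =>
      intro W m n h₁ h₂
      have := ih (W.flatMap fun w => (List.finRange Q).map fun d => d :: w) (m * Q) (n + 1)
        (by simp [List.length_flatMap, h₁]) (by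
          intro w hw
          simp only [List.mem_flatMap, List.mem_map] at hw
          obtain ⟨w', hw', d, -, rfl⟩ := hw
          simp [h₂ w' hw'])
      simp only [List.foldl_cons, List.length_cons]
      exact ⟨by rw [this.1, pow_succ]; ring, fun w hw => by rw [this.2 w hw]; omega⟩
  simpa using key l [[]] 1 0 rfl (by simp)

/-- With `Q = 2^m` and word length `n`, the number of words is `(2^n)^m`, and `2^n` is linear in the
length of `E` because `n` is its binary length plus a constant. So exhaustive enumeration of words
is polynomial. -/
theorem allWords_pt [Inhabited A] {m : ℕ} (hQ : Q = 2 ^ m) (a : ℕ) :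
    PT fun E : List A => allWords Q (logLength a E) := by
  refine foldl (l := fun E : List A => logLength a E) (i := fun _ => [[]])
    (h := fun y : List A × List (List (Fin Q)) × Unit =>
      y.2.1.flatMap fun w => (List.finRange Q).map fun d => d :: w)
    (logLength_pt a) (const _) (flatMap (fst.comp snd)
      (f := fun y : (List A × List (List (Fin Q)) × Unit) × List (Fin Q) =>
        (List.finRange Q).map fun d => d :: y.2)
      (map (f := fun y : ((List A × List (List (Fin Q)) × Unit) × List (Fin Q)) × Fin Q =>
        y.2 :: y.1.2)
        (const _) (snd.cons (snd.comp fst))))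
    ⟨fun E => ((2 * sz E + 1) * 2 ^ a) ^ m *
      (sz (logLength a E) * (2 * Q + 1) + 1 + 1) + 1, ?_, fun E k => ?_⟩
  · exact ((((((PolyBdd.const 2).mul .sz).add (.const 1)).mul (.const _)).pow m).mul
      ((((logLength_pt a).polyBdd.mul (.const _)).add (.const 1)).add (.const 1))).add (.const 1)
  · change sz (allWords Q ((logLength a E).take k)) ≤ _
    obtain ⟨h₁, h₂⟩ := allWords_spec Q ((logLength a E).take k)
    refine (sz_le_of_forall (C := sz (logLength a E) * (2 * Q + 1) + 1) fun w hw => ?_).trans ?_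
    · refine (sz_le_of_forall fun d _ => sz_fin_le d).trans ?_
      rw [h₂ w hw]
      have := (List.length_take_le' k (logLength a E)).trans (length_lt_sz _).le
      exact Nat.add_le_add_right (Nat.mul_le_mul_right _ this) _
    · rw [h₁]
      refine Nat.add_le_add_right (Nat.mul_le_mul_right _ ?_) _
      have h₃ : (2 : ℕ) ^ (logLength a E).length ≤ (2 * sz E + 1) * 2 ^ a := by
        simp only [logLength, List.length_append, List.length_map, List.length_replicate, pow_add]
        refine Nat.mul_le_mul_right _ ?_
        have := two_pow_length_binLength_le E
        have := length_lt_sz E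
        omega
      calc Q ^ (List.take k (logLength a E)).length
          ≤ Q ^ (logLength a E).length :=
            Nat.pow_le_pow_right (NeZero.pos Q) (List.length_take_le' _ _)
        _ = (2 ^ (logLength a E).length) ^ m := by rw [hQ, ← pow_mul, ← pow_mul, Nat.mul_comm]
        _ ≤ _ := by gcongr

theorem beqFin : PT fun x : Fin Q × Fin Q => x.1 == x.2 :=
  of_fintype (fun x y h => by
    have h' := STree.cons.inj h
    exact Prod.ext (trep_fin_injective h'.1) (trep_fin_injective h'.2)) _

theorem beqBool : PT fun x : Bool × Bool => x.1 == x.2 :=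
  of_fintype (fun x y h => by
    have h' := STree.cons.inj h
    exact Prod.ext (trep_bool_injective h'.1) (trep_bool_injective h'.2)) _

theorem farApart_pt (D : ℕ) {f g : X → List (Fin Q)} (hf : PT f) (hg : PT g) :
    PT fun x => farApart D (f x) (g x) :=
  lengthLE_pt (flatMap (f := fun y : X × Fin Q × Fin Q =>
    bif y.2.1 == y.2.2 then List.replicate D () else []) (hf.zip hg)
    ((beqFin.comp snd).cond (const _) (const _))) hg

theorem greedyCode_pt (D : ℕ) : PT fun W : List (List (Fin Q)) => greedyCode D W := by
  refine foldl_of_add (X := List (List (Fin Q))) (l := fun W => W) (i := fun _ => [])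
    (h := fun y => bif y.2.1.all fun w' => farApart D y.2.2 w' then y.2.2 :: y.2.1 else y.2.1)
    .id (const _) ?_ (n := fun y => sz y.2 + 1) (snd.polyBdd.add (.const 1)) fun x s b => ?_
  · exact (all (f := fun y : (List (List (Fin Q)) × List (List (Fin Q)) × List (Fin Q)) × _ =>
      farApart D y.1.2.2 y.2) (fst.comp snd)
      (farApart_pt D (snd.comp (snd.comp fst)) snd)).cond ((snd.comp snd).cons (fst.comp snd))
      (fst.comp snd)
  · dsimp only
    cases s.all fun w' => farApart D b w'
    · simp
    · simp; omega

theorem lookupWord_pt {f : X → List (List Bool × List (Fin Q))} {g : X → List Bool} (hf : PT f)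
    (hg : PT g) : PT fun x => lookupWord (f x) (g x) := by
  refine foldl_of_add (i := fun _ => []) (h := fun y => bif y.2.2.1 == g y.1 then y.2.2.2
    else y.2.1) hf (const _) ?_ (n := fun y => sz y.2) snd.polyBdd fun x s b => ?_
  · exact (listBeq beqBool (fst.comp (snd.comp snd)) (hg.comp fst)).cond
      (snd.comp (snd.comp snd)) (fst.comp snd)
  · obtain ⟨u, w⟩ := b
    dsimp only
    cases u == g x <;> simp; omega

theorem codeTable_pt {m : ℕ} (hQ : Q = 2 ^ m) (D a : ℕ) : PT (codeTable Q D a) :=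
  (flatMap (f := fun y => y.2) .id snd).zip ((greedyCode_pt D).comp (allWords_pt hQ a))

theorem sz_map_le {f : A → B} {l : List A} (h : ∀ a ∈ l, sz (f a) ≤ sz a) :
    sz (l.map f) ≤ sz l := by
  induction l with
  | nil => simp
  | cons a l ih =>
    have h₁ := h a List.mem_cons_self
    have h₂ := ih fun b hb => h b (List.mem_cons_of_mem _ hb)
    simp only [List.map_cons, sz_cons]
    omega

theorem wordRows_pt {l : X → List Unit} {T : X → List (List (Fin Q))} (hl : PT l) (hT : PT T) :
    PT fun x => wordRows (l x) (T x) := by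
  refine snd.comp (foldl (i := fun x => (T x, [])) (h := fun y =>
    (y.2.1.1.map fun w => w.tail, (y.2.1.1.map fun w => w.headD 0) :: y.2.1.2)) hl
    (hT.pair (const [])) ?_ ⟨fun x => sz (T x) + (sz (l x) * (sz (T x) + 1) + 1) + 1,
      (hT.polyBdd.add ((hl.polyBdd.mul (hT.polyBdd.add (.const 1))).add (.const 1))).add (.const 1),
      fun x k => ?_⟩)
  · have h₁ : PT fun y : X × (List (List (Fin Q)) × List (List (Fin Q))) × Unit => y.2.1.1 :=
      fst.comp (fst.comp snd)
    exact (map (f := fun y => y.2.tail) h₁ (tail.comp snd)).pair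
      ((map (f := fun y => y.2.headD 0) h₁ ((headD 0).comp snd)).cons (snd.comp (fst.comp snd)))
  · have key : ∀ (l : List Unit) (s : List (List (Fin Q)) × List (List (Fin Q))) (C : ℕ),
        sz s.1 ≤ C → ∀ s', s' = l.foldl (fun (s : List (List (Fin Q)) × List (List (Fin Q))) _ =>
          (s.1.map fun w => w.tail, (s.1.map fun w => w.headD 0) :: s.2)) s →
        sz s'.1 ≤ C ∧ sz s'.2 ≤ sz s.2 + l.length * (C + 1) := by
      intro l
      induction l with
      | nil => rintro s C h s' rfl; exact ⟨h, by simp⟩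
      | cons b l ih =>
        rintro s C h s' rfl
        have h₁ : sz (s.1.map fun w => w.tail) ≤ C := (sz_map_le fun w _ => by
          cases w <;> simp; omega).trans h
        have h₂ : sz (s.1.map fun w => w.headD 0) ≤ C := (sz_map_le fun w _ => by
          cases w with
          | nil => exact le_of_eq rfl
          | cons d w => simp; omega).trans h
        have := ih (s.1.map fun w => w.tail, (s.1.map fun w => w.headD 0) :: s.2) C h₁ _ rfl
        refine ⟨this.1, this.2.trans ?_⟩
        simp only [sz_cons, List.length_cons, Nat.succ_mul]
        omega
    have h₁ := key ((l x).take k) (T x, []) _ le_rfl _ rfl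
    have h₂ := (List.length_take_le' k (l x)).trans (length_lt_sz (l x)).le
    have h₃ := Nat.mul_le_mul_right (sz (T x) + 1) h₂
    simp only [sz_nil] at h₁
    refine (le_of_eq (sz_pair _ _)).trans ?_
    dsimp only at *
    omega

theorem codedRows_pt {m : ℕ} (hQ : Q = 2 ^ m) (D a : ℕ) {E : X → List (List (List Bool))}
    {T : X → List (List Bool)} (hE : PT E) (hT : PT T) :
    PT fun x => codedRows Q D a (E x) (T x) :=
  wordRows_pt ((logLength_pt a).comp hE) (map (f := fun y : X × List Bool => lookupWord
    (codeTable Q D a (E y.1)) y.2) hT (lookupWord_pt ((codeTable_pt hQ D a).comp (hE.comp fst)) snd))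

/-- The parameter is written in binary and may be exponentially large. Cutting the list to the
length of `E` after each doubling keeps it polynomial. -/
theorem cappedUnary_pt [Inhabited A] {E : X → List A} {k : X → List Bool} (hE : PT E)
    (hk : PT k) : PT fun x => cappedUnary (E x) (k x) := by
  refine foldl_of_add (i := fun _ => []) (h := fun y : X × List Unit × Bool =>
    ((y.2.1 ++ (y.2.1 ++ bif y.2.2 then [()] else [])).zip (E y.1)).map fun p => p.1) hk (const _)
    ?_ (n := fun y => sz (E y.1) * 2 + 1) (((hE.comp fst).polyBdd.mul (.const 2)).add (.const 1))
    fun x s b => ?_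
  · have h₁ : PT fun y : X × List Unit × Bool => y.2.1 := fst.comp snd
    exact map (f := fun y : (X × List Unit × Bool) × Unit × A => y.2.1) ((h₁.append (h₁.append ((snd.comp snd).cond (const _)
      (const _)))).zip (hE.comp fst)) (fst.comp snd)
  · refine (sz_le_of_forall (C := 1) fun u _ => le_of_eq rfl).trans ?_
    have := length_lt_sz (E x)
    simp only [List.length_map, List.length_zip]
    omega

theorem bitString_pt : PT bitString :=
  (map (f := fun y : List Bool × Bool => Γ'.bit y.2) .id ((of_fintype trep_bool_injective Γ'.bit).comp snd)).append
    (const _)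

theorem pointsString_pt {R J m : ℕ} [NeZero R] (hQ : Q = 2 ^ m) (c : CoordStrings Q R J)
    (hp : PT c.point) (D a : ℕ) {E : X → List (List (List Bool))} (hE : PT E) :
    PT fun x => (E x).flatMap fun T => (List.finRange R).flatMap fun r =>
      Γ'.bra :: (((codedRows Q D a (E x) T).flatMap fun ρ => c.point ρ) ++
        (c.pointLast r ++ [Γ'.ket])) := by
  have hpl : PT c.pointLast := of_fintype trep_fin_injective _
  have h₁ : PT fun y : (X × List (List Bool)) × Fin R =>
      (codedRows Q D a (E y.1.1) y.1.2).flatMap fun ρ => c.point ρ :=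
    flatMap (f := fun y => c.point y.2) (codedRows_pt hQ D a
        (hE.comp (fst.comp fst)) (snd.comp fst)) (hp.comp snd)
  have h₂ : PT fun y : (X × List (List Bool)) × Fin R =>
      Γ'.bra :: (((codedRows Q D a (E y.1.1) y.1.2).flatMap fun ρ => c.point ρ) ++
        (c.pointLast y.2 ++ [Γ'.ket])) :=
    (const _).cons (h₁.append ((hpl.comp snd).append (const _)))
  have h₃ : PT fun y : X × List (List Bool) => (List.finRange R).flatMap fun r =>
      Γ'.bra :: (((codedRows Q D a (E y.1) y.2).flatMap fun ρ => c.point ρ) ++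
        (c.pointLast r ++ [Γ'.ket])) :=
    flatMap (const (List.finRange R)) h₂
  exact flatMap hE h₃

theorem centersString_pt {R J m : ℕ} [NeZero J] (hQ : Q = 2 ^ m) (c : CoordStrings Q R J)
    (hc : PT c.center) (D a : ℕ) {E : X → List (List (List Bool))} (hE : PT E) :
    PT fun x => (E x).flatMap fun T => (List.finRange J).flatMap fun j =>
      Γ'.bra :: (((codedRows Q D a (E x) T).flatMap fun ρ => c.center (j, ρ)) ++
        (c.centerLast j ++ [Γ'.ket])) := by
  have hcl : PT c.centerLast := of_fintype trep_fin_injective _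
  have h₁ : PT fun y : (X × List (List Bool)) × Fin J =>
      (codedRows Q D a (E y.1.1) y.1.2).flatMap fun ρ => c.center (y.2, ρ) :=
    flatMap (f := fun y : ((X × List (List Bool)) × Fin J) × List (Fin Q) =>
      c.center (y.1.2, y.2)) (codedRows_pt hQ D a
        (hE.comp (fst.comp fst)) (snd.comp fst)) (hc.comp ((snd.comp fst).pair snd))
  have h₂ : PT fun y : (X × List (List Bool)) × Fin J =>
      Γ'.bra :: (((codedRows Q D a (E y.1.1) y.1.2).flatMap fun ρ => c.center (y.2, ρ)) ++
        (c.centerLast y.2 ++ [Γ'.ket])) :=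
    (const _).cons (h₁.append ((hcl.comp snd).append (const _)))
  have h₃ : PT fun y : X × List (List Bool) => (List.finRange J).flatMap fun j =>
      Γ'.bra :: (((codedRows Q D a (E y.1) y.2).flatMap fun ρ => c.center (j, ρ)) ++
        (c.centerLast j ++ [Γ'.ket])) :=
    flatMap (const (List.finRange J)) h₂
  exact flatMap hE h₃

theorem reductionString_pt {R J m : ℕ} [NeZero R] [NeZero J] (hQ : Q = 2 ^ m)
    (c : CoordStrings Q R J) (hp : PT c.point) (hc : PT c.center) (D a D₀ : ℕ)
    {E : X → List (List (List Bool))} {k : X → List Bool} (hE : PT E) (hk : PT k) :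
    PT fun x => reductionString c D a D₀ (E x) (k x) := by
  have h₁ : PT fun x => bitString (binLength (() :: (logLength a (E x)).flatMap
      fun _ => List.replicate D₀ ())) :=
    bitString_pt.comp (binLength_pt.comp ((const ()).cons (flatMap
      (f := fun _ => List.replicate D₀ ()) ((logLength_pt a).comp hE) (const _))))
  have h₂ : PT fun x => bitString (binLength (cappedUnary (E x) (k x))) :=
    bitString_pt.comp (binLength_pt.comp (cappedUnary_pt hE hk))
  exact h₁.append (((const _).cons ((pointsString_pt hQ c hp D a hE).append (const _))).append
    (((const _).cons ((centersString_pt hQ c hc D a hE).append (const _))).append h₂))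

/-- The reduction is computed in polynomial time. -/
theorem reduction_pt {R J m : ℕ} [NeZero R] [NeZero J] (hQ : Q = 2 ^ m) (c : CoordStrings Q R J)
    (hp : PT c.point) (hc : PT c.center) (D a D₀ : ℕ) (bad : List Γ') :
    PT (reduction c D a D₀ bad) :=
  (isEmpty.comp parseParam_pt).cond (const bad)
    (reductionString_pt hQ c hp hc D a D₀ parseSets_pt parseParam_pt)

end PT

/-! ### The greedy code -/

section code

variable {Q : ℕ}

/-- The number of positions in which two words agree. -/
def agree (w w' : List (Fin Q)) : ℕ := (w.zip w').countP fun p => p.1 == p.2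

theorem agree_cons (d e : Fin Q) (w w' : List (Fin Q)) :
    agree (d :: w) (e :: w') = agree w w' + if d = e then 1 else 0 := by
  simp [agree, List.countP_cons]

theorem agree_comm (w w' : List (Fin Q)) : agree w w' = agree w' w := by
  induction w generalizing w' with
  | nil => cases w' <;> simp [agree]
  | cons d w ih =>
    cases w' with
    | nil => simp [agree]
    | cons e w' => rw [agree_cons, agree_cons, ih]; simp only [eq_comm]

theorem agree_self (w : List (Fin Q)) : agree w w = w.length := by
  induction w with
  | nil => rfl
  | cons d w ih => rw [agree_cons, ih]; simp

theorem farApart_iff (D : ℕ) (w w' : List (Fin Q)) :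
    farApart D w w' = true ↔ D * agree w w' ≤ w'.length := by
  have : ∀ l : List (Fin Q × Fin Q),
      (l.flatMap fun p => bif p.1 == p.2 then List.replicate D () else []).length =
        D * l.countP fun p => p.1 == p.2 := by
    intro l
    induction l with
    | nil => simp
    | cons p l ih =>
      rw [List.flatMap_cons, List.length_append, ih, List.countP_cons]
      cases p.1 == p.2 <;> simp [Nat.mul_add, Nat.add_comm]
  rw [farApart, lengthLE_iff, this, agree]

theorem allWords_append (l : List Unit) :
    allWords Q (l ++ [()]) =
      (allWords Q l).flatMap fun w => (List.finRange Q).map fun d => d :: w := by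
  simp [allWords]

/-- The sum factors over positions: at each of them one letter agrees and contributes `q`, the other
`Q - 1` letters contribute 1. It serves as an exponential moment of the number of agreements. -/
theorem sum_pow_agree (q n : ℕ) (w : List (Fin Q)) (hw : w.length = n) :
    ((allWords Q (List.replicate n ())).map fun w' => q ^ agree w' w).sum = (q + (Q - 1)) ^ n := by
  induction n generalizing w with
  | zero =>
    obtain rfl := List.length_eq_zero_iff.1 hw
    simp [allWords, agree]
  | succ n ih =>
    obtain ⟨e, w, rfl⟩ : ∃ e v, w = e :: v := List.exists_cons_of_length_eq_add_one hw
    rw [List.replicate_succ', allWords_append]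
    have h₁ : ∀ W : List (List (Fin Q)),
        ((W.flatMap fun w => (List.finRange Q).map fun d => d :: w).map
          fun w' => q ^ agree w' (e :: w)).sum =
        (W.map fun w' => q ^ agree w' w).sum * (q + (Q - 1)) := by
      intro W
      induction W with
      | nil => simp
      | cons v W ihW =>
        rw [List.flatMap_cons, List.map_append, List.sum_append, ihW, List.map_cons,
          List.sum_cons, Nat.add_mul]
        congr 1
        rw [List.map_map, ← Fin.sum_univ_def]
        simp only [Function.comp_def, agree_cons, pow_add]
        rw [← Finset.mul_sum]
        congr 1
        rw [← Finset.add_sum_erase _ _ (Finset.mem_univ e)]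
        simp only [if_true, pow_one]
        congr 1
        rw [Finset.sum_congr rfl (g := fun _ => 1)]
        · simp
        · intro d hd
          simp [Finset.ne_of_mem_erase hd]
    rw [h₁, ih w (by simpa using hw), pow_succ]

/-- A word is rejected only because it is too close to a word already chosen, and chosen words are
never removed. So the code is maximal, which is the last clause and the one used for counting. -/
theorem greedyCode_spec (D : ℕ) (W : List (List (Fin Q))) :
    (greedyCode D W).Pairwise (fun w w' => farApart D w w' = true) ∧
      (∀ w ∈ greedyCode D W, w ∈ W) ∧
      ∀ w ∈ W, w ∈ greedyCode D W ∨ ∃ w' ∈ greedyCode D W, ¬ farApart D w w' = true := by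
  unfold greedyCode
  have key : ∀ (W C : List (List (Fin Q))),
      C.Pairwise (fun w w' => farApart D w w' = true) →
      let C' := W.foldl (fun C w => bif C.all fun w' => farApart D w w' then w :: C else C) C
      C'.Pairwise (fun w w' => farApart D w w' = true) ∧ (∀ w ∈ C', w ∈ W ∨ w ∈ C) ∧
        (∀ w ∈ C, w ∈ C') ∧ ∀ w ∈ W, w ∈ C' ∨ ∃ w' ∈ C', ¬ farApart D w w' = true := by
    intro W
    induction W with
    | nil => intro C hC; exact ⟨hC, by simp, by simp, by simp⟩
    | cons v W ih =>
      intro C hC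
      simp only [List.foldl_cons]
      by_cases h : (C.all fun w' => farApart D v w') = true
      · simp only [h, cond_true]
        obtain ⟨h₁, h₂, h₃, h₄⟩ := ih (v :: C) (List.pairwise_cons.2 ⟨List.all_eq_true.1 h, hC⟩)
        refine ⟨h₁, fun w hw => ?_, fun w hw => h₃ w (List.mem_cons_of_mem _ hw), fun w hw => ?_⟩
        · rcases h₂ w hw with h | h
          · exact .inl (List.mem_cons_of_mem _ h)
          · rcases List.mem_cons.1 h with rfl | h
            · exact .inl List.mem_cons_self
            · exact .inr h
        · rcases List.mem_cons.1 hw with rfl | hw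
          · exact .inl (h₃ _ List.mem_cons_self)
          · exact h₄ w hw
      · have h' := Bool.eq_false_iff.2 h
        simp only [h', cond_false]
        obtain ⟨h₁, h₂, h₃, h₄⟩ := ih C hC
        refine ⟨h₁, fun w hw => (h₂ w hw).imp_left (List.mem_cons_of_mem _), h₃, fun w hw => ?_⟩
        rcases List.mem_cons.1 hw with rfl | hw
        · right
          simp only [List.all_eq_true, not_forall] at h
          obtain ⟨w', hw', h⟩ := h
          exact ⟨w', h₃ w' hw', h⟩
        · exact h₄ w hw
  obtain ⟨h₁, h₂, -, h₄⟩ := key W [] List.Pairwise.nil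
  exact ⟨h₁, fun w hw => by simpa using h₂ w hw, h₄⟩

/-- The union bound for a covering of `W` by the balls around the members of `C`. -/
theorem countP_le_sum_countP {α β : Type} (p : α → β → Bool) (W : List α) (C : List β)
    (h : ∀ w ∈ W, ∃ w' ∈ C, p w w' = true) :
    W.length ≤ (C.map fun w' => W.countP fun w => p w w').sum := by
  have : ∀ C : List β, (W.countP fun w => C.any fun w' => p w w') ≤
      (C.map fun w' => W.countP fun w => p w w').sum := by
    intro C
    induction C with
    | nil => simp
    | cons c C ih =>
      simp only [List.any_cons, List.map_cons, List.sum_cons]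
      refine le_trans ?_ (Nat.add_le_add_left ih _)
      clear h ih
      induction W with
      | nil => simp
      | cons w W ihW =>
        simp only [List.countP_cons]
        cases p w c <;> cases (C.any fun w' => p w w') <;> simp <;> omega
  refine le_trans (le_of_eq ?_) (this C)
  symm
  rw [List.countP_eq_length]
  intro w hw
  obtain ⟨w', hw', h⟩ := h w hw
  exact List.any_eq_true.2 ⟨w', hw', h⟩

/-- The Gilbert–Varshamov bound. -/
theorem two_pow_le_length_greedyCode {D n : ℕ} (hD : 2 ≤ D) (hn : 1 ≤ n) (hQ : Q = 2 ^ (2 * D)) :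
    2 ^ n ≤ (greedyCode D (allWords Q (List.replicate n ()))).length := by
  set W := allWords Q (List.replicate n ()) with hW
  set C := greedyCode D W
  have hQ1 : 1 ≤ Q := hQ ▸ Nat.one_le_two_pow
  have hWs := PT.allWords_spec Q (List.replicate n ())
  rw [List.length_replicate] at hWs
  obtain ⟨-, h₂, h₃⟩ := greedyCode_spec D W
  have hcl : ∀ w ∈ W, ∃ w' ∈ C, decide (n < D * agree w w') = true := by
    intro w hw
    rcases h₃ w hw with h | ⟨w', hw', h⟩
    -- A chosen word lies in its own ball: it agrees with itself in `n` positions, and `n < D * n`.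
    · refine ⟨w, h, ?_⟩
      rw [agree_self, hWs.2 w hw, decide_eq_true_eq]
      nlinarith
    · refine ⟨w', hw', ?_⟩
      rw [farApart_iff, hWs.2 w' (h₂ w' hw')] at h
      simpa using h
  -- Markov's inequality for `Q ^ agree`. A word in the ball has `D * agree > n`, so `Q ^ agree = 4
  -- ^ (D * agree) ≥ 4 ^ n`, while the sum over all words is `(2Q - 1) ^ n ≤ 2 ^ n * Q ^ n`. Hence a
  -- ball contains at most a fraction `2 ^ (-n)` of all words.
  have hcount : ∀ w' ∈ C, (W.countP fun w => decide (n < D * agree w w')) * 2 ^ n ≤ Q ^ n := by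
    intro w' hw'
    have h := sum_pow_agree Q n w' (hWs.2 w' (h₂ w' hw'))
    rw [← hW] at h
    have h₄ : (W.countP fun w => decide (n < D * agree w w')) * 4 ^ n ≤
        (W.map fun w => Q ^ agree w w').sum := by
      clear h hcl h₃ h₂ hWs hw'
      clear_value C
      clear hW
      clear_value W
      induction W with
      | nil => simp
      | cons w W ih =>
        rw [List.countP_cons, Nat.add_mul, List.map_cons, List.sum_cons, Nat.add_comm]
        refine Nat.add_le_add ?_ ih
        by_cases hlt : n < D * agree w w'
        · simp only [hlt, decide_true, if_true, one_mul]
          generalize agree w w' = s at hlt ⊢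
          rw [hQ, ← pow_mul, show (4 : ℕ) = 2 ^ 2 from rfl, ← pow_mul]
          exact Nat.pow_le_pow_right (by norm_num) (by nlinarith)
        · simp [hlt]
    have h₅ : (W.countP fun w => decide (n < D * agree w w')) * 2 ^ n * 2 ^ n ≤ Q ^ n * 2 ^ n := by
      calc _ = (W.countP fun w => decide (n < D * agree w w')) * 4 ^ n := by
            rw [mul_assoc, ← mul_pow]; rfl
        _ ≤ (Q + (Q - 1)) ^ n := h ▸ h₄
        _ ≤ (Q * 2) ^ n := Nat.pow_le_pow_left (by omega) n
        _ = _ := mul_pow _ _ _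
    exact Nat.le_of_mul_le_mul_right h₅ (by positivity)
  have hsum := countP_le_sum_countP (fun w w' => decide (n < D * agree w w')) W C hcl
  have h₆ : ∀ C' : List (List (Fin Q)), (∀ w' ∈ C', w' ∈ C) →
      (C'.map fun w' => W.countP fun w => decide (n < D * agree w w')).sum * 2 ^ n ≤
        C'.length * Q ^ n := by
    intro C'
    induction C' with
    | nil => simp
    | cons w' C' ih =>
      intro hC'
      rw [List.map_cons, List.sum_cons, Nat.add_mul, List.length_cons, Nat.succ_mul, Nat.add_comm]
      exact Nat.add_le_add (ih fun v hv => hC' v (List.mem_cons_of_mem _ hv))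
        (hcount w' (hC' w' List.mem_cons_self))
  have h₇ := h₆ C fun _ h => h
  rw [hWs.1] at hsum
  have h₈ : Q ^ n * 2 ^ n ≤ Q ^ n * C.length :=
    (Nat.mul_le_mul_right _ hsum).trans (h₇.trans (le_of_eq (Nat.mul_comm _ _)))
  exact Nat.le_of_mul_le_mul_left h₈ (by positivity)

end code

/-! ### The code words of the elements of the universe -/

section labels

variable {Q : ℕ} [NeZero Q]

/-- An element lying in several sets occurs several times as a key, with different words. Which
entry is found does not matter, only that the word found belongs to the key. -/
theorem lookupWord_mem (l : List (List Bool × List (Fin Q))) {u : List Bool}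
    (h : ∃ p ∈ l, p.1 = u) : (u, lookupWord l u) ∈ l := by
  unfold lookupWord
  have key : ∀ (l : List (List Bool × List (Fin Q))) (w : List (Fin Q)),
      let w' := l.foldl (fun w p => bif p.1 == u then p.2 else w) w
      (u, w') ∈ l ∨ (w' = w ∧ ∀ p ∈ l, p.1 ≠ u) := by
    intro l
    induction l with
    | nil => intro w; right; simp
    | cons p l ih =>
      intro w
      simp only [List.foldl_cons]
      rcases ih (bif p.1 == u then p.2 else w) with h | ⟨h₁, h₂⟩
      · exact .inl (List.mem_cons_of_mem _ h)
      · by_cases hp : p.1 = u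
        · left
          rw [h₁, beq_iff_eq.2 hp, cond_true, ← hp]
          exact List.mem_cons_self
        · right
          have h₃ : (p.1 == u) = false := beq_eq_false_iff_ne.2 hp
          rw [h₃, cond_false] at h₁
          refine ⟨by rw [h₃, cond_false]; exact h₁, ?_⟩
          simpa [hp] using h₂
  rcases key l [] with h' | ⟨-, h'⟩
  · exact h'
  · obtain ⟨p, hp, hpu⟩ := h
    exact absurd hpu (h' p hp)

/-- The words assigned to different keys are far apart. -/
theorem codeTable_spec {D a : ℕ} (hD : 2 ≤ D) (ha : 1 ≤ a) (hQ : Q = 2 ^ (2 * D))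
    {E : List (List (List Bool))} {z : ℕ} (hz : ∀ T ∈ E, T.length = z) (hza : z ≤ 2 ^ a) :
    (∀ T ∈ E, ∀ u ∈ T, (lookupWord (codeTable Q D a E) u).length = (logLength a E).length) ∧
    ∀ T ∈ E, ∀ u ∈ T, ∀ T' ∈ E, ∀ v ∈ T', u ≠ v →
      D * agree (lookupWord (codeTable Q D a E) u) (lookupWord (codeTable Q D a E) v) ≤
        (logLength a E).length := by
  set n := (logLength a E).length with hn
  have hrep : logLength a E = List.replicate n () := List.eq_replicate_of_mem fun _ _ => rfl
  have hna : n = (encodeNat E.length).length + a := by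
    simp [hn, logLength, binLength_eq]
  set C := greedyCode D (allWords Q (logLength a E)) with hC
  set U := E.flatMap fun T => T with hU
  -- Each of the `|E| * z` occurrences of elements needs its own code word, and there are at least
  -- `2 ^ n` of them, where `n` is the binary length of `|E|` plus `a`.
  have hlen : U.length ≤ C.length := by
    have h₁ := two_pow_le_length_greedyCode (Q := Q) hD (show 1 ≤ n by omega) hQ
    rw [← hrep] at h₁
    refine le_trans ?_ h₁
    have h₂ : U.length = E.length * z := by
      rw [hU, List.length_flatMap, List.map_congr_left (g := fun _ => z) hz]
      simp
    rw [h₂, hna, pow_add]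
    exact Nat.mul_le_mul (lt_two_pow_length_encodeNat _).le hza
  obtain ⟨hp, hCW, -⟩ := greedyCode_spec D (allWords Q (logLength a E))
  -- Keys and words share an index, so different keys have words at different indices of the code,
  -- and these are far apart.
  have hidx : ∀ T ∈ E, ∀ u ∈ T, ∃ i, ∃ (h : i < U.length) (h' : i < C.length),
      U[i] = u ∧ C[i] = lookupWord (codeTable Q D a E) u := by
    intro T hT u hu
    have huU : u ∈ U := List.mem_flatMap.2 ⟨T, hT, hu⟩
    have := lookupWord_mem (codeTable Q D a E) (u := u) (by
      obtain ⟨i, hi, rfl⟩ := List.mem_iff_getElem.1 huU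
      refine ⟨(U[i], C[i]), ?_, rfl⟩
      exact List.mem_iff_getElem.2 ⟨i, by simp [codeTable, ← hU, ← hC]; omega,
        by simp [codeTable, ← hU, ← hC]⟩)
    obtain ⟨i, hi, h⟩ := List.mem_iff_getElem.1 this
    have hi' : i < U.length ∧ i < C.length := by
      simpa [codeTable, ← hU, ← hC] using hi
    refine ⟨i, hi'.1, hi'.2, ?_⟩
    have h' : (U[i], C[i]) = (u, lookupWord (codeTable Q D a E) u) := by
      rw [← h]
      simp [codeTable, ← hU, ← hC]
    exact ⟨congrArg Prod.fst h', congrArg Prod.snd h'⟩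
  have hClen : ∀ w ∈ C, w.length = n := fun w hw =>
    (PT.allWords_spec Q (logLength a E)).2 w (hCW w hw)
  constructor
  · intro T hT u hu
    obtain ⟨i, h, h', -, h₂⟩ := hidx T hT u hu
    rw [← h₂]
    exact hClen _ (List.getElem_mem h')
  · intro T hT u hu T' hT' v hv huv
    obtain ⟨i, hi, hi', h₁, h₂⟩ := hidx T hT u hu
    obtain ⟨j, hj, hj', h₃, h₄⟩ := hidx T' hT' v hv
    rw [← h₂, ← h₄]
    rcases lt_trichotomy i j with hij | hij | hij
    · have := List.pairwise_iff_getElem.1 hp i j hi' hj' hij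
      rw [farApart_iff, hClen _ (List.getElem_mem hj')] at this
      exact this
    · subst hij
      exact absurd (h₁.symm.trans h₃) huv
    · have := List.pairwise_iff_getElem.1 hp j i hj' hi' hij
      rw [farApart_iff, hClen _ (List.getElem_mem hi'), agree_comm] at this
      exact this

/-- Peeling off the heads of all words transposes the table; consing the rows reverses their order,
which `rowAt` accounts for by `i.rev`. -/
theorem wordRows_eq (l : List Unit) (T : List (List (Fin Q))) :
    wordRows l T = ((List.range l.length).map fun i => T.map fun w => w.getD i 0).reverse := by
  unfold wordRows
  have key : ∀ (l : List Unit) (T acc : List (List (Fin Q))),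
      (l.foldl (fun (s : List (List (Fin Q)) × List (List (Fin Q))) _ =>
        (s.1.map fun w => w.tail, (s.1.map fun w => w.headD 0) :: s.2)) (T, acc)).2 =
      ((List.range l.length).map fun i => T.map fun w => w.getD i 0).reverse ++ acc := by
    intro l
    induction l with
    | nil => intro T acc; simp
    | cons b l ih =>
      intro T acc
      rw [List.foldl_cons, ih, List.length_cons, List.range_succ_eq_map]
      simp only [List.map_cons, List.reverse_cons, List.append_assoc, List.map_map]
      congr 1
      · congr 1
        refine List.map_congr_left fun i _ => ?_
        refine List.map_congr_left fun w _ => ?_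
        cases w <;> simp
      · simp only [List.cons_append, List.nil_append, List.cons.injEq, and_true]
        refine List.map_congr_left fun w _ => ?_
        cases w <;> simp
  simpa using key l T []

end labels

/-! ### Reading instances -/

theorem foldl_parseStep_bits (l : List Bool) (s : List Bool × List (List Bool))
    (r : List (List (List Bool))) :
    (l.map Γ'.bit).foldl parseStep (s, r) = ((l.reverse ++ s.1, s.2), r) := by
  induction l generalizing s with
  | nil => rfl
  | cons b l ih =>
    rw [List.map_cons, List.foldl_cons]
    have : parseStep (s, r) (.bit b) = ((b :: s.1, s.2), r) := by simp [parseStep, sectionΓ'Bool]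
    rw [this, ih]
    simp

theorem foldl_parseStep_nat (n : ℕ) (s : List (List Bool)) (r : List (List (List Bool))) :
    (writeNat n).foldl parseStep (([], s), r) = (([], (encodeNat n).reverse :: s), r) := by
  rw [writeNat, List.foldl_append, foldl_parseStep_bits]
  simp [parseStep]

theorem foldl_parseStep_nats {A : Type} (f : A → ℕ) (l : List A) (s : List (List Bool))
    (r : List (List (List Bool))) :
    (l.flatMap fun u => writeNat (f u)).foldl parseStep (([], s), r) =
      (([], (l.map fun u => (encodeNat (f u)).reverse).reverse ++ s), r) := by
  induction l generalizing s with
  | nil => rfl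
  | cons a l ih =>
    rw [List.flatMap_cons, List.foldl_append, foldl_parseStep_nat, ih]
    simp

theorem foldl_parseStep_list {A : Type} (f : A → ℕ) (l : List A)
    (s : List Bool × List (List Bool)) (r : List (List (List Bool))) :
    (writeList (fun u => writeNat (f u)) l).foldl parseStep (s, r) =
      (([], []), (l.map fun u => (encodeNat (f u)).reverse).reverse :: r) := by
  rw [writeList, List.foldl_cons, List.foldl_append]
  have : parseStep (s, r) .bra = (([], []), r) := by simp [parseStep]
  rw [this, foldl_parseStep_nats]
  simp [parseStep]

/-- The set `T`, as it is read by the reduction. -/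
def setKey {n : ℕ} (T : Finset (Fin n)) : List (List Bool) :=
  ((T.sort (· ≤ ·)).map fun u : Fin n => (encodeNat (u : ℕ)).reverse).reverse

/-- Everything is collected on stacks, so the sets, their elements and the bits appear in reverse
order. The numeral of `n` is discarded at the opening bracket of the collection; its closing bracket
adds an empty list, which the tail in `parseSets` removes. -/
theorem parse_write {z : ℕ} (I : JohnsonInstance z) :
    parseSets I.write = (I.E.map setKey).reverse ∧ parseParam I.write = (encodeNat I.k).reverse := by
  have key : ∀ (l : List (Finset (Fin I.n))) (r : List (List (List Bool))),
      (l.flatMap fun T : Finset (Fin I.n) => writeList (fun u : Fin I.n => writeNat u)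
        (T.sort (· ≤ ·))).foldl parseStep (([], []), r) =
      (([], []), (l.map setKey).reverse ++ r) := by
    intro l
    induction l with
    | nil => intro r; rfl
    | cons T l ih =>
      intro r
      rw [List.flatMap_cons, List.foldl_append, foldl_parseStep_list, ih, List.map_cons,
        List.reverse_cons, List.append_assoc]
      rfl
  have h : parse I.write = (([], [(encodeNat I.k).reverse]), [] :: (I.E.map setKey).reverse) := by
    rw [parse, JohnsonInstance.write, List.foldl_append, List.foldl_append, foldl_parseStep_nat,
      writeList, List.foldl_cons, List.foldl_append]
    have : ∀ s r, parseStep (s, r) .bra = (([], []), r) := fun s r => by simp [parseStep]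
    rw [this, key]
    have : ∀ s r, parseStep (s, r) .ket = (([], []), s.2 :: r) := fun s r => by simp [parseStep]
    rw [List.foldl_cons, this, List.foldl_nil, foldl_parseStep_nat]
    simp
  simp [parseSets, parseParam, h]

/-! ### The instances produced by the reduction -/

/-- The number with given binary digits, the least significant one first. -/
def bitsValue : List Bool → ℕ
  | [] => 0
  | b :: l => 2 * bitsValue l + b.toNat

theorem bitsValue_binSuccRec (l : List Bool) : bitsValue (binSuccRec l) = bitsValue l + 1 := by
  induction l with
  | nil => rfl
  | cons b l ih => cases b <;> simp [binSuccRec, bitsValue, ih]; omega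

theorem bitsValue_encodeNat (n : ℕ) : bitsValue (encodeNat n) = n := by
  induction n with
  | zero => rfl
  | succ n ih => rw [encodeNat_succ, binSucc_eq, bitsValue_binSuccRec, ih]

/-- Capping in every round has the effect of capping once at the end, since `min (2 * min v N + b) N
= min (2 * v + b) N`. -/
theorem length_cappedUnary {A : Type} (E : List A) (l : List Bool) :
    (cappedUnary E l.reverse).length = min (bitsValue l) E.length := by
  induction l with
  | nil => simp [cappedUnary, bitsValue]
  | cons b l ih =>
    unfold cappedUnary at ih ⊢
    rw [List.reverse_cons, List.foldl_append, List.foldl_cons, List.foldl_nil, List.length_map,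
      List.length_zip, List.length_append, List.length_append, ih, bitsValue]
    cases b <;> simp <;> omega

/-- A vector composed of blocks and a last coordinate. -/
def blockVec {A : Type} {l D₀ : ℕ} (P : Fin l → Fin D₀ → A) (x : A) : Fin (l * D₀ + 1) → A :=
  Fin.snoc (fun i => P i.divNat i.modNat) x

theorem ofFn_blockVec {A : Type} {l D₀ : ℕ} (P : Fin l → Fin D₀ → A) (x : A) :
    List.ofFn (blockVec P x) = (List.ofFn fun i => List.ofFn (P i)).flatten ++ [x] := by
  rw [List.ofFn_succ', List.concat_eq_append, List.ofFn_mul]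
  congr 2
  · congr 1
    funext i
    congr 1
    funext j
    have : (⟨i * D₀ + j, by
      calc i * D₀ + j < (i + 1) * D₀ := by have := j.2; rw [Nat.add_mul]; omega
        _ ≤ l * D₀ := Nat.mul_le_mul_right _ i.2⟩ : Fin (l * D₀)) = finProdFinEquiv (i, j) := by
      ext; simp [finProdFinEquiv, Nat.add_comm, Nat.mul_comm]
    simp only [blockVec, Fin.snoc_castSucc]
    rw [this]
    have h := finProdFinEquiv.symm_apply_apply (i, j)
    rw [finProdFinEquiv_symm_apply] at h
    obtain ⟨h₁, h₂⟩ := Prod.ext_iff.1 h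
    simp only at h₁ h₂
    rw [h₁, h₂]
  · simp [blockVec]

theorem blockVec_inj {A : Type} {l D₀ : ℕ} {P P' : Fin l → Fin D₀ → A} {x x' : A}
    (h : blockVec P x = blockVec P' x') : P = P' ∧ x = x' := by
  constructor
  · funext i j
    have := congrFun h (Fin.castSucc (finProdFinEquiv (i, j)))
    simp only [blockVec, Fin.snoc_castSucc] at this
    have h := finProdFinEquiv.symm_apply_apply (i, j)
    rw [finProdFinEquiv_symm_apply] at h
    obtain ⟨h₁, h₂⟩ := Prod.ext_iff.1 h
    simp only at h₁ h₂
    rwa [h₁, h₂] at this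
  · simpa [blockVec] using congrFun h (Fin.last _)

theorem sum_blockVec {A M : Type} [AddCommMonoid M] {l D₀ : ℕ} (P P' : Fin l → Fin D₀ → A)
    (x x' : A) (f : A → A → M) :
    ∑ i, f (blockVec P x i) (blockVec P' x' i) = ∑ i, ∑ j, f (P i j) (P' i j) + f x x' := by
  rw [Fin.sum_univ_castSucc]
  simp only [blockVec, Fin.snoc_castSucc, Fin.snoc_last]
  rw [← Fintype.sum_prod_type', ← finProdFinEquiv.symm.sum_comp]
  rfl

/-- Tables of coordinates for points and centers. -/
structure Gadget (Q R J D₀ : ℕ) where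
  point : List (Fin Q) → Fin D₀ → ℚ
  center : Fin J → List (Fin Q) → Fin D₀ → ℚ
  pointLast : Fin R → ℚ
  centerLast : Fin J → ℚ

/-- Different entries of the tables for words of length `z` are different. -/
structure Gadget.Separates {Q R J D₀ : ℕ} (G : Gadget Q R J D₀) (z : ℕ) : Prop where
  point_inj : ∀ ρ ρ', ρ.length = z → ρ'.length = z → G.point ρ = G.point ρ' → ρ = ρ'
  center_inj : ∀ j ρ ρ', ρ.length = z → ρ'.length = z → G.center j ρ = G.center j ρ' → ρ = ρ'
  pointLast_inj : Function.Injective G.pointLast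
  centerLast_inj : Function.Injective G.centerLast

/-- The strings written by the reduction are those of the coordinates. -/
structure CoordStrings.Writes {Q R J D₀ : ℕ} (c : CoordStrings Q R J) (G : Gadget Q R J D₀)
    (z : ℕ) : Prop where
  point : ∀ ρ, ρ.length = z → c.point ρ = (List.ofFn (G.point ρ)).flatMap writeRat
  center : ∀ j ρ, ρ.length = z → c.center (j, ρ) = (List.ofFn (G.center j ρ)).flatMap writeRat
  pointLast : ∀ r, c.pointLast r = writeRat (G.pointLast r)
  centerLast : ∀ j, c.centerLast j = writeRat (G.centerLast j)

section instances

variable {Q R J D₀ : ℕ} [NeZero Q]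

/-- The letters at the position `i` of the words of the elements of `T`. -/
def rowAt (Q D a : ℕ) [NeZero Q] (E : List (List (List Bool))) (T : List (List Bool))
    (i : Fin (logLength a E).length) : List (Fin Q) :=
  T.map fun u => (lookupWord (codeTable Q D a E) u).getD i.rev 0

theorem codedRows_eq (D a : ℕ) (E : List (List (List Bool))) (T : List (List Bool)) :
    codedRows Q D a E T = List.ofFn (rowAt Q D a E T) := by
  rw [codedRows, wordRows_eq]
  refine List.ext_getElem (by simp) fun i h₁ h₂ => ?_
  simp only [List.length_reverse, List.length_map, List.length_range] at h₁
  simp only [List.getElem_reverse, List.length_map, List.length_range, List.getElem_map,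
    List.getElem_range, List.getElem_ofFn, rowAt, List.map_map, Function.comp_def]
  refine List.map_congr_left fun u _ => ?_
  congr 1
  simp [Fin.val_rev]
  omega

/-- What is assumed of the collection `E`. -/
structure ValidSets (z D a : ℕ) (Q : ℕ) (E : List (List (List Bool))) : Prop where
  two_le : 2 ≤ D
  one_le : 1 ≤ a
  card_alphabet : Q = 2 ^ (2 * D)
  le_pow : z ≤ 2 ^ a
  nodup : E.Nodup
  ne_nil : E ≠ []
  length_eq : ∀ T ∈ E, T.length = z
  nodup_set : ∀ T ∈ E, T.Nodup

theorem agree_eq_card (n : ℕ) (w w' : List (Fin Q)) (hw : w.length = n) (hw' : w'.length = n) :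
    agree w w' = (Finset.univ.filter fun i : Fin n => w.getD i.rev 0 = w'.getD i.rev 0).card := by
  have h : (Finset.univ.filter fun i : Fin n => w.getD i.rev 0 = w'.getD i.rev 0).card =
      (Finset.univ.filter fun i : Fin n => w.getD i 0 = w'.getD i 0).card := by
    refine Finset.card_bij (fun i _ => i.rev) ?_ ?_ ?_
    · simp
    · intro i _ j _ h; exact Fin.rev_injective h
    · intro i hi
      refine ⟨i.rev, ?_, Fin.rev_rev i⟩
      rw [Finset.mem_filter] at hi ⊢
      rw [Fin.rev_rev]
      exact ⟨Finset.mem_univ _, hi.2⟩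
  rw [h]
  clear h
  induction n generalizing w w' with
  | zero =>
    obtain rfl := List.length_eq_zero_iff.1 hw
    simp [agree]
  | succ n ih =>
    obtain ⟨e, w, rfl⟩ : ∃ e v, w = e :: v := List.exists_cons_of_length_eq_add_one hw
    obtain ⟨e', w', rfl⟩ : ∃ e v, w' = e :: v := List.exists_cons_of_length_eq_add_one hw'
    rw [agree_cons, ih w w' (by simpa using hw) (by simpa using hw')]
    simp only [Finset.card_filter, Fin.sum_univ_succ]
    simp [Nat.add_comm]

variable {z D a : ℕ} {E : List (List (List Bool))}

theorem ValidSets.length_pos (hE : ValidSets z D a Q E) : 0 < (logLength a E).length := by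
  have := hE.one_le
  simp [logLength]
  omega

theorem ValidSets.card_agree (hE : ValidSets z D a Q E) {T T' : List (List Bool)} (hT : T ∈ E)
    (hT' : T' ∈ E) {u v : List Bool} (hu : u ∈ T) (hv : v ∈ T') (huv : u ≠ v) :
    D * (Finset.univ.filter fun i : Fin (logLength a E).length =>
      (lookupWord (codeTable Q D a E) u).getD i.rev 0 =
        (lookupWord (codeTable Q D a E) v).getD i.rev 0).card ≤ (logLength a E).length := by
  obtain ⟨h₁, h₂⟩ := codeTable_spec hE.two_le hE.one_le hE.card_alphabet hE.length_eq hE.le_pow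
  rw [← agree_eq_card _ _ _ (h₁ T hT u hu) (h₁ T' hT' v hv)]
  exact h₂ T hT u hu T' hT' v hv huv

/-- If the lists differed in some entry, the words of the two entries would agree in all positions,
against the distance of the code. -/
theorem ValidSets.rowAt_inj (hE : ValidSets z D a Q E) {T T' : List (List Bool)} (hT : T ∈ E)
    (hT' : T' ∈ E) (h : ∀ i, rowAt Q D a E T i = rowAt Q D a E T' i) : T = T' := by
  refine List.ext_getElem ((hE.length_eq T hT).trans (hE.length_eq T' hT').symm) fun x hx hx' => ?_
  by_contra huv
  have h₁ := hE.card_agree hT hT' (List.getElem_mem hx) (List.getElem_mem hx') huv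
  rw [Finset.filter_true_of_mem] at h₁
  · rw [Finset.card_univ, Fintype.card_fin] at h₁
    have := hE.length_pos
    have := hE.two_le
    nlinarith
  · intro i _
    have := congrArg (fun l => l[x]?) (h i)
    simpa [rowAt, hx, hx'] using this

theorem length_rowAt (hE : ValidSets z D a Q E) {T : List (List Bool)} (hT : T ∈ E)
    (i : Fin (logLength a E).length) : (rowAt Q D a E T i).length = z := by
  simp [rowAt, hE.length_eq T hT]

/-- The point with number `r` of the set `T`. -/
def setPoint (G : Gadget Q R J D₀) (D a : ℕ) (E : List (List (List Bool))) (T : List (List Bool))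
    (r : Fin R) : Fin ((logLength a E).length * D₀ + 1) → ℚ :=
  blockVec (fun i => G.point (rowAt Q D a E T i)) (G.pointLast r)

/-- The center of the subset with number `j` of the set `T`. -/
def setCenter (G : Gadget Q R J D₀) (D a : ℕ) (E : List (List (List Bool))) (T : List (List Bool))
    (j : Fin J) : Fin ((logLength a E).length * D₀ + 1) → ℚ :=
  blockVec (fun i => G.center j (rowAt Q D a E T i)) (G.centerLast j)

theorem nodup_flatMap_finRange {A B : Type} {N : ℕ} {E : List A} (hE : E.Nodup)
    {f : A → Fin N → B}
    (hf : ∀ T ∈ E, ∀ T' ∈ E, ∀ r r', f T r = f T' r' → T = T' ∧ r = r') :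
    (E.flatMap fun T => (List.finRange N).map (f T)).Nodup := by
  rw [List.nodup_flatMap]
  constructor
  · intro T hT
    refine (List.nodup_finRange N).map_on fun r _ r' _ h => (hf T hT T hT r r' h).2
  · refine List.Pairwise.imp_of_mem ?_ hE
    intro T T' hT hT' hne
    simp only [Function.onFun, List.disjoint_left, List.mem_map]
    rintro _ ⟨r, -, rfl⟩ ⟨r', -, h⟩
    exact hne (hf T' hT' T hT r' r h).1.symm

/-- The instance of `k`-means made from `E` and a number of centers. -/
def meansInstance (G : Gadget Q R J D₀) (hG : G.Separates z) (hE : ValidSets z D a Q E) (k : ℕ)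
    (hk : 1 ≤ k) (hk' : k ≤ E.length * J) : KMeansInstance where
  d := (logLength a E).length * D₀ + 1
  points := E.flatMap fun T => (List.finRange R).map (setPoint G D a E T)
  centers := E.flatMap fun T => (List.finRange J).map (setCenter G D a E T)
  k := k
  points_nodup := by
    refine nodup_flatMap_finRange hE.nodup fun T hT T' hT' r r' h => ?_
    obtain ⟨h₁, h₂⟩ := blockVec_inj h
    exact ⟨hE.rowAt_inj hT hT' fun i => hG.point_inj _ _ (length_rowAt hE hT i)
      (length_rowAt hE hT' i) (congrFun h₁ i), hG.pointLast_inj h₂⟩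
  centers_nodup := by
    refine nodup_flatMap_finRange hE.nodup fun T hT T' hT' j j' h => ?_
    obtain ⟨h₁, h₂⟩ := blockVec_inj h
    obtain rfl := hG.centerLast_inj h₂
    exact ⟨hE.rowAt_inj hT hT' fun i => hG.center_inj j _ _ (length_rowAt hE hT i)
      (length_rowAt hE hT' i) (congrFun h₁ i), rfl⟩
  k_pos := hk
  k_le := by
    rw [List.length_flatMap]
    simpa using hk'

theorem bitString_encodeNat (n : ℕ) : bitString (encodeNat n) = writeNat n := rfl

theorem reductionString_eq (G : Gadget Q R J D₀) (hG : G.Separates z) (hE : ValidSets z D a Q E)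
    (c : CoordStrings Q R J) (hc : c.Writes G z) (k : List Bool) (hk hk') :
    reductionString c D a D₀ E k =
      (meansInstance G hG hE (cappedUnary E k).length hk hk').write := by
  have hd : ∀ l : List Unit, ((l.flatMap fun _ => List.replicate D₀ ()).length) =
      l.length * D₀ := by
    intro l
    simp [List.length_flatMap]
  rw [reductionString, KMeansInstance.write, binLength_eq, binLength_eq, List.length_cons, hd,
    bitString_encodeNat, bitString_encodeNat, List.append_assoc, List.append_assoc]
  congr 1
  congr 1
  · simp only [meansInstance, writeList, List.flatMap_assoc, List.flatMap_map]
    congr 2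
    refine List.flatMap_congr fun T hT => ?_
    refine List.flatMap_congr fun r _ => ?_
    rw [setPoint, ofFn_blockVec, codedRows_eq, List.flatMap_append, hc.pointLast,
      ← List.append_assoc]
    simp only [List.flatMap_singleton]
    congr 3
    rw [List.ofFn_eq_map, List.ofFn_eq_map, List.flatMap_map, ← List.flatMap_def,
      List.flatMap_assoc]
    exact List.flatMap_congr fun i _ => hc.point _ (length_rowAt hE hT i)
  · congr 1
    simp only [meansInstance, writeList, List.flatMap_assoc, List.flatMap_map]
    congr 2
    refine List.flatMap_congr fun T hT => ?_
    refine List.flatMap_congr fun j _ => ?_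
    rw [setCenter, ofFn_blockVec, codedRows_eq, List.flatMap_append, hc.centerLast,
      ← List.append_assoc]
    simp only [List.flatMap_singleton]
    congr 3
    rw [List.ofFn_eq_map, List.ofFn_eq_map, List.flatMap_map, ← List.flatMap_def,
      List.flatMap_assoc]
    exact List.flatMap_congr fun i _ => hc.center _ _ (length_rowAt hE hT i)

end instances

/-! ### Completing sets of letters -/

section completion

variable {Q : ℕ}

/-- The set `X` together with the first letters outside of it, up to size `m`. -/
def completion (m : ℕ) (X : Finset (Fin Q)) : Finset (Fin Q) :=
  X ∪ (((List.finRange Q).filter fun u => u ∉ X).take (m - X.card)).toFinset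

theorem subset_completion (m : ℕ) (X : Finset (Fin Q)) : X ⊆ completion m X :=
  Finset.subset_union_left

theorem completion_eq {m : ℕ} {X : Finset (Fin Q)} (h : m ≤ X.card) : completion m X = X := by
  simp [completion, Nat.sub_eq_zero_of_le h]

theorem card_completion {m : ℕ} {X : Finset (Fin Q)} (h : X.card ≤ m) (hm : m ≤ Q) :
    (completion m X).card = m := by
  have hlen : ((List.finRange Q).filter fun u => u ∉ X).length = Q - X.card := by
    rw [← List.toFinset_card_of_nodup ((List.nodup_finRange Q).filter _), List.toFinset_filter]
    have := Finset.card_compl X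
    rw [Fintype.card_fin] at this
    rw [← this]
    congr 1
    ext u
    simp
  rw [completion, Finset.card_union_of_disjoint,
    List.toFinset_card_of_nodup (((List.nodup_finRange Q).filter _).sublist (List.take_sublist _ _)),
    List.length_take, hlen]
  · omega
  · rw [Finset.disjoint_left]
    intro u hu hu'
    have := List.mem_of_mem_take (List.mem_toFinset.1 hu')
    simp [hu] at this

/-- Letters are added in a fixed order. The letters added to `Y` that lie outside `X` form an
initial segment of the letters outside `X`, and it is short enough to be among those added to `X`.
-/
theorem completion_subset {m m' : ℕ} {X Y : Finset (Fin Q)} (hYX : Y ⊆ X)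
    (h : m' - Y.card ≤ m - X.card) : completion m' Y ⊆ completion m X := by
  refine Finset.union_subset (hYX.trans (subset_completion m X)) fun u hu => ?_
  by_cases hX : u ∈ X
  · exact subset_completion m X hX
  refine Finset.mem_union_right _ (List.mem_toFinset.2 ?_)
  have h₁ : ((List.finRange Q).filter fun u => u ∉ X) =
      ((List.finRange Q).filter fun u => u ∉ Y).filter fun u => u ∉ X := by
    rw [List.filter_filter]
    refine List.filter_congr fun u _ => ?_
    by_cases h : u ∈ X
    · simp [h]
    · have : u ∉ Y := fun h' => h (hYX h')
      simp [h, this]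
  rw [h₁]
  generalize (List.finRange Q).filter (fun u => u ∉ Y) = l at hu
  have hu := List.mem_toFinset.1 hu
  have h₂ : u ∈ (l.take (m' - Y.card)).filter fun u => u ∉ X := List.mem_filter.2 ⟨hu, by simpa⟩
  have h₃ : ((l.take (m' - Y.card)).filter fun u => u ∉ X) <+: l.filter fun u => u ∉ X :=
    (List.take_prefix _ _).filter _
  have h₄ : ((l.take (m' - Y.card)).filter fun u => u ∉ X).length ≤ m - X.card :=
    (List.length_filter_le _ _).trans ((List.length_take_le _ _).trans h)
  rw [List.prefix_iff_eq_take] at h₃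
  rw [h₃] at h₂
  exact List.take_subset_take_left _ h₄ h₂

end completion

/-! ### Subsets of sets of words -/

section subsets

variable {K : Type} [DecidableEq K] {Q z y : ℕ}

/-- The elements of a list at the given positions. -/
def selected (d : K) (T : List K) (X : Finset (Fin z)) : Finset K := X.image fun x : Fin z => T.getD x d

theorem toFinset_map_eq {K' : Type} [DecidableEq K'] (f : K → K') (T : List K) :
    (T.map f).toFinset = T.toFinset.image f := by
  ext v
  simp

theorem selected_map {K' : Type} [DecidableEq K'] (d : K) (d' : K') (T : List K)
    (X : Finset (Fin z)) (f : K → K') (hT : T.length = z) :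
    selected d' (T.map f) X = (selected d T X).image f := by
  rw [selected, selected, Finset.image_image]
  refine Finset.image_congr fun x _ => ?_
  have : (x : ℕ) < T.length := hT ▸ x.2
  simp [this]

theorem selected_subset (d : K) (T : List K) (X : Finset (Fin z)) (hT : T.length = z) :
    selected d T X ⊆ T.toFinset := by
  intro u hu
  obtain ⟨x, -, rfl⟩ := Finset.mem_image.1 hu
  have : (x : ℕ) < T.length := hT ▸ x.2
  simp [this]

theorem getD_injective {d : K} {T : List K} (hT : T.length = z) (hn : T.Nodup) :
    Function.Injective fun x : Fin z => T.getD x d := by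
  intro x x' h
  have h₁ : (x : ℕ) < T.length := hT ▸ x.2
  have h₂ : (x' : ℕ) < T.length := hT ▸ x'.2
  simp only [List.getD_eq_getElem, h₁, h₂] at h
  exact Fin.ext ((hn.getElem_inj_iff).1 h)

theorem card_selected (d : K) {T : List K} (X : Finset (Fin z)) (hT : T.length = z)
    (hn : T.Nodup) : (selected d T X).card = X.card :=
  Finset.card_image_of_injective _ (getD_injective hT hn)

theorem exists_selected (d : K) {T : List K} (hT : T.length = z) {S : Finset K}
    (hn : T.Nodup) (hS : S ⊆ T.toFinset) :
    ∃ X : Finset (Fin z), X.card = S.card ∧ selected d T X = S := by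
  refine ⟨Finset.univ.filter fun x : Fin z => T.getD x d ∈ S, ?_⟩
  have h : selected d T (Finset.univ.filter fun x : Fin z => T.getD x d ∈ S) = S := by
    ext u
    simp only [selected, Finset.mem_image, Finset.mem_filter, Finset.mem_univ, true_and]
    constructor
    · rintro ⟨x, hx, rfl⟩; exact hx
    · intro hu
      obtain ⟨i, hi, rfl⟩ := List.mem_iff_getElem.1 (List.mem_toFinset.1 (hS hu))
      refine ⟨⟨i, hT ▸ hi⟩, ?_⟩
      simp [hi, hu]
  exact ⟨by rw [← card_selected d _ hT hn, h], h⟩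

/-- The numbering of the `y`-subsets of `Fin z`. -/
noncomputable def subsetNumber (z y : ℕ) :
    {X // X ∈ Finset.powersetCard y (Finset.univ : Finset (Fin z))} ≃ Fin (z.choose y) :=
  Finset.equivFinOfCardEq (by simp)

/-- The subset with number `j`. -/
noncomputable def subsetAt (j : Fin (z.choose y)) : Finset (Fin z) := ((subsetNumber z y).symm j).1

theorem card_subsetAt (j : Fin (z.choose y)) : (subsetAt j).card = y :=
  (Finset.mem_powersetCard.1 ((subsetNumber z y).symm j).2).2

theorem exists_subsetAt {X : Finset (Fin z)} (hX : X.card = y) :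
    ∃ j : Fin (z.choose y), subsetAt j = X :=
  ⟨subsetNumber z y ⟨X, by simp [hX]⟩, by simp [subsetAt]⟩

variable [NeZero Q]

/-- The vertex of the Johnson graph used for a point. -/
def pointVertex (z : ℕ) (ρ : List (Fin Q)) : Finset (Fin Q) := completion z ρ.toFinset

/-- The vertex of the Johnson graph used for a center. -/
noncomputable def centerVertex (j : Fin (z.choose y)) (ρ : List (Fin Q)) : Finset (Fin Q) :=
  completion y (selected 0 ρ (subsetAt j))

theorem card_pointVertex (hzQ : z ≤ Q) {ρ : List (Fin Q)} (hρ : ρ.length = z) :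
    (pointVertex z ρ).card = z :=
  card_completion (hρ ▸ List.toFinset_card_le ρ) hzQ

theorem card_centerVertex (hyQ : y ≤ Q) (j : Fin (z.choose y)) (ρ : List (Fin Q)) :
    (centerVertex j ρ).card = y :=
  card_completion (Finset.card_image_le.trans (card_subsetAt j).le) hyQ

/-- The map `φ` to the letters at one position may identify elements. For `S ⊆ T` the image of `T`
has at most `z - y` letters more than that of `S`, so at least as many letters are missing from it,
and `completion_subset` applies. Thus containment survives even where letters collide. -/
theorem centerVertex_subset {T T' : List K} (hT : T.length = z) (hT' : T'.length = z)
    (hn : T.Nodup) (hn' : T'.Nodup) (d : K) (j : Fin (z.choose y)) (φ : K → Fin Q)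
    (h : selected d T' (subsetAt j) ⊆ T.toFinset) :
    centerVertex j (T'.map φ) ⊆ pointVertex z (T.map φ) := by
  unfold centerVertex pointVertex
  rw [selected_map d 0 T' _ φ hT', toFinset_map_eq]
  have hcard : T.toFinset.card = z := by rw [List.toFinset_card_of_nodup hn, hT]
  have hcard' : (selected d T' (subsetAt j)).card = y := by
    rw [card_selected d _ hT' hn', card_subsetAt]
  refine completion_subset (Finset.image_subset_image h) ?_
  have h₁ : (T.toFinset.image φ).card ≤
      ((selected d T' (subsetAt j)).image φ).card +
        ((T.toFinset \ selected d T' (subsetAt j)).image φ).card := by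
    rw [← Finset.union_sdiff_of_subset h, Finset.image_union]
    refine (Finset.card_union_le _ _).trans ?_
    rw [Finset.union_sdiff_of_subset h]
  have h₂ : ((T.toFinset \ selected d T' (subsetAt j)).image φ).card ≤ z - y := by
    refine Finset.card_image_le.trans ?_
    rw [Finset.card_sdiff_of_subset h, hcard, hcard']
  have h₃ : y ≤ z := by
    rw [← hcard, ← hcard']
    exact Finset.card_le_card h
  omega

/-- When `φ` is injective on `T` and `u`, the image of `T` already has `z` letters, so nothing is
added to it, and the letter of `u` is not among them. -/
theorem not_centerVertex_subset {T T' : List K} (hT : T.length = z) (hT' : T'.length = z)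
    (hn : T.Nodup) (d : K) (j : Fin (z.choose y)) (φ : K → Fin Q) {u : K}
    (hu : u ∈ selected d T' (subsetAt j))
    (hφ : Set.InjOn φ (insert u T.toFinset : Finset K)) (huT : u ∉ T) :
    ¬ centerVertex j (T'.map φ) ⊆ pointVertex z (T.map φ) := by
  intro h
  have h₁ : φ u ∈ pointVertex z (T.map φ) := by
    refine h (subset_completion _ _ ?_)
    rw [selected_map d 0 T' _ φ hT']
    exact Finset.mem_image_of_mem φ hu
  rw [pointVertex, toFinset_map_eq, completion_eq] at h₁
  · obtain ⟨v, hv, hvu⟩ := Finset.mem_image.1 h₁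
    have := hφ (by simp [List.mem_toFinset.1 hv]) (by simp) hvu
    exact huT (this ▸ List.mem_toFinset.1 hv)
  · rw [Finset.card_image_of_injOn (hφ.mono (by simp)), List.toFinset_card_of_nodup hn, hT]

end subsets

/-- At most positions, the graph of points and centers is the one that is needed. -/
theorem ValidSets.card_bad {Q z y D a : ℕ} [NeZero Q] {E : List (List (List Bool))}
    (hE : ValidSets z D a Q E) (hz : 1 ≤ z) {T T' : List (List Bool)} (hT : T ∈ E) (hT' : T' ∈ E)
    (j : Fin (z.choose y)) (h : ¬ selected [] T' (subsetAt j) ⊆ T.toFinset) :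
    D * (Finset.univ.filter fun i : Fin (logLength a E).length =>
      centerVertex j (rowAt Q D a E T' i) ⊆ pointVertex z (rowAt Q D a E T i)).card ≤
      2 * z ^ 2 * (logLength a E).length := by
  obtain ⟨u, hu, huT⟩ := Finset.not_subset.1 h
  have huT' : u ∈ T' := List.mem_toFinset.1 (selected_subset _ _ _ (hE.length_eq T' hT') hu)
  set U : Finset (List Bool) := insert u T.toFinset with hU
  have hUE : ∀ v ∈ U, ∃ T₁ ∈ E, v ∈ T₁ := by
    intro v hv
    rcases Finset.mem_insert.1 hv with rfl | hv
    · exact ⟨T', hT', huT'⟩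
    · exact ⟨T, hT, List.mem_toFinset.1 hv⟩
  set φ : Fin (logLength a E).length → List Bool → Fin Q := fun i u =>
    (lookupWord (codeTable Q D a E) u).getD i.rev 0 with hφ
  -- At a bad position two different elements of `U`, the set `T` together with `u`, share a letter.
  have hsub : (Finset.univ.filter fun i : Fin (logLength a E).length =>
      centerVertex j (rowAt Q D a E T' i) ⊆ pointVertex z (rowAt Q D a E T i)) ⊆
      U.offDiag.biUnion fun v => Finset.univ.filter fun i => φ i v.1 = φ i v.2 := by
    intro i hi
    by_contra hcon
    refine not_centerVertex_subset (hE.length_eq T hT) (hE.length_eq T' hT')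
      (hE.nodup_set T hT) [] j (φ i) hu ?_ (fun h => huT (List.mem_toFinset.2 h))
      (Finset.mem_filter.1 hi).2
    intro v hv v' hv' hvv
    by_contra hne
    exact hcon (Finset.mem_biUnion.2 ⟨(v, v'), Finset.mem_offDiag.2 ⟨hv, hv', hne⟩,
      Finset.mem_filter.2 ⟨Finset.mem_univ _, hvv⟩⟩)
  -- There are at most `(z + 1) * z ≤ 2 * z ^ 2` ordered pairs, and each spoils at most a fraction
  -- `1 / D` of the positions.
  have hcard : U.offDiag.card ≤ 2 * z ^ 2 := by
    have : U.card ≤ z + 1 := by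
      refine (Finset.card_insert_le _ _).trans (Nat.add_le_add_right ?_ 1)
      exact (List.toFinset_card_le T).trans (hE.length_eq T hT).le
    rw [Finset.offDiag_card]
    have : U.card * U.card - U.card = U.card * (U.card - 1) := by rw [Nat.mul_sub, mul_one]
    rw [this]
    calc U.card * (U.card - 1) ≤ (z + 1) * z := Nat.mul_le_mul ‹_› (by omega)
      _ ≤ _ := by nlinarith
  calc _ ≤ D * ∑ v ∈ U.offDiag, (Finset.univ.filter fun i => φ i v.1 = φ i v.2).card :=
        Nat.mul_le_mul_left _ ((Finset.card_le_card hsub).trans Finset.card_biUnion_le)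
    _ = ∑ v ∈ U.offDiag, D * (Finset.univ.filter fun i => φ i v.1 = φ i v.2).card :=
        Finset.mul_sum _ _ _
    _ ≤ ∑ v ∈ U.offDiag, (logLength a E).length := by
        refine Finset.sum_le_sum fun v hv => ?_
        obtain ⟨h₁, h₂, hne⟩ := Finset.mem_offDiag.1 hv
        obtain ⟨T₁, hT₁, h₁⟩ := hUE _ h₁
        obtain ⟨T₂, hT₂, h₂⟩ := hUE _ h₂
        exact hE.card_agree hT₁ hT₂ h₁ h₂ hne
    _ ≤ _ := by
        rw [Finset.sum_const, smul_eq_mul]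
        exact Nat.mul_le_mul_right _ hcard

/-! ### Costs of the instances produced by the reduction -/

/-- The `p`-th power of the distance of two vectors with rational coordinates. -/
noncomputable def distPow (p : ℝ) {d : ℕ} (x y : Fin d → ℚ) : ℝ :=
  ∑ i, |(x i : ℝ) - (y i : ℝ)| ^ p

theorem distPow_nonneg (p : ℝ) {d : ℕ} (x y : Fin d → ℚ) : 0 ≤ distPow p x y :=
  Finset.sum_nonneg fun _ _ => Real.rpow_nonneg (abs_nonneg _) _

theorem lpDist_sq (p : ℝ) {d : ℕ} (x y : Fin d → ℚ) :
    lpDist p (fun j => (x j : ℝ)) (fun j => (y j : ℝ)) ^ 2 = distPow p x y ^ (2 / p) := by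
  rw [lpDist, ← distPow, ← Real.rpow_natCast, ← Real.rpow_mul (distPow_nonneg p x y)]
  congr 1
  push_cast
  ring

theorem distPow_blockVec (p : ℝ) {l D₀ : ℕ} (P P' : Fin l → Fin D₀ → ℚ) (x x' : ℚ) :
    distPow p (blockVec P x) (blockVec P' x') =
      ∑ i, distPow p (P i) (P' i) + |(x : ℝ) - (x' : ℝ)| ^ p :=
  sum_blockVec P P' x x' fun a b => |(a : ℝ) - (b : ℝ)| ^ p

/-- The gadget represents containment of vertices, with gap `lam` and error `s`. -/
structure Gadget.Realizes {Q R z y D₀ : ℕ} [NeZero Q] (G : Gadget Q R (z.choose y) D₀)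
    (p lam s : ℝ) : Prop where
  lower : ∀ ρ j ρ', ρ.length = z → ρ'.length = z → 1 - s ≤ distPow p (G.point ρ) (G.center j ρ')
  adj : ∀ ρ j ρ', ρ.length = z → ρ'.length = z → centerVertex j ρ' ⊆ pointVertex z ρ →
    distPow p (G.point ρ) (G.center j ρ') ≤ 1 + s
  nonadj : ∀ ρ j ρ', ρ.length = z → ρ'.length = z → ¬ centerVertex j ρ' ⊆ pointVertex z ρ →
    lam ^ p * (1 - s) ≤ distPow p (G.point ρ) (G.center j ρ')
  last : ∀ r j, |(G.pointLast r : ℝ) - (G.centerLast j : ℝ)| ^ p ≤ s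

section costs

variable {Q R z y D a D₀ : ℕ} [NeZero Q] {E : List (List (List Bool))}
  {G : Gadget Q R (z.choose y) D₀} {p lam κ α : ℝ}

/-- The parameters of the reduction are in the range needed. -/
structure GoodParams (z D a R : ℕ) (p lam κ : ℝ) : Prop where
  one_le : 1 ≤ p
  one_le_lam : 1 ≤ lam
  pos : 0 < κ
  lt_one : κ < 1
  large : 8 * (z : ℝ) ^ 2 ≤ κ * D
  large' : 4 ≤ κ * a
  card_eq : R = 2 ^ a

/-- Each block contributes at most `1 + κ / 4`. The last coordinate adds at most `κ / 4`, which is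
absorbed because there is at least one block. -/
theorem distPow_le (hE : ValidSets z D a Q E) (hP : GoodParams z D a R p lam κ)
    (hG : G.Realizes p lam (κ / 4)) {T T' : List (List Bool)} (hT : T ∈ E) (hT' : T' ∈ E)
    (r : Fin R) (j : Fin (z.choose y)) (h : selected [] T' (subsetAt j) ⊆ T.toFinset) :
    distPow p (setPoint G D a E T r) (setCenter G D a E T' j) ≤
      (logLength a E).length * (1 + κ / 2) := by
  rw [setPoint, setCenter, distPow_blockVec]
  have h₁ : ∑ i, distPow p (G.point (rowAt Q D a E T i)) (G.center j (rowAt Q D a E T' i)) ≤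
      ∑ _i : Fin (logLength a E).length, (1 + κ / 4) :=
    Finset.sum_le_sum fun i _ => hG.adj _ _ _ (length_rowAt hE hT i) (length_rowAt hE hT' i)
      (centerVertex_subset (hE.length_eq T hT) (hE.length_eq T' hT') (hE.nodup_set T hT)
        (hE.nodup_set T' hT') [] j _ h)
  rw [Finset.sum_const, Finset.card_univ, Fintype.card_fin, nsmul_eq_mul] at h₁
  have h₂ := hG.last r j
  have h₃ : (1 : ℝ) ≤ (logLength a E).length := by exact_mod_cast hE.length_pos
  have := hP.pos
  nlinarith

theorem le_distPow (hE : ValidSets z D a Q E) (hP : GoodParams z D a R p lam κ)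
    (hG : G.Realizes p lam (κ / 4)) {T T' : List (List Bool)} (hT : T ∈ E) (hT' : T' ∈ E)
    (r : Fin R) (j : Fin (z.choose y)) :
    (logLength a E).length * (1 - κ) ≤
      distPow p (setPoint G D a E T r) (setCenter G D a E T' j) := by
  rw [setPoint, setCenter, distPow_blockVec]
  have h₁ : ∑ _i : Fin (logLength a E).length, (1 - κ / 4) ≤
      ∑ i, distPow p (G.point (rowAt Q D a E T i)) (G.center j (rowAt Q D a E T' i)) :=
    Finset.sum_le_sum fun i _ => hG.lower _ _ _ (length_rowAt hE hT i) (length_rowAt hE hT' i)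
  rw [Finset.sum_const, Finset.card_univ, Fintype.card_fin, nsmul_eq_mul] at h₁
  have h₂ : 0 ≤ |(G.pointLast r : ℝ) - (G.centerLast j : ℝ)| ^ p :=
    Real.rpow_nonneg (abs_nonneg _) _
  have h₃ : (1 : ℝ) ≤ (logLength a E).length := by exact_mod_cast hE.length_pos
  have := hP.pos
  nlinarith

theorem le_distPow_of_not_subset (hz : 1 ≤ z) (hE : ValidSets z D a Q E)
    (hP : GoodParams z D a R p lam κ)
    (hG : G.Realizes p lam (κ / 4)) {T T' : List (List Bool)} (hT : T ∈ E) (hT' : T' ∈ E)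
    (r : Fin R) (j : Fin (z.choose y)) (h : ¬ selected [] T' (subsetAt j) ⊆ T.toFinset) :
    (logLength a E).length * (1 - κ) * lam ^ p ≤
      distPow p (setPoint G D a E T r) (setCenter G D a E T' j) := by
  classical
  rw [setPoint, setCenter, distPow_blockVec]
  set N := (logLength a E).length
  have hκ := hP.pos
  have hκ' := hP.lt_one
  set B := Finset.univ.filter fun i : Fin N =>
      centerVertex j (rowAt Q D a E T' i) ⊆ pointVertex z (rowAt Q D a E T i) with hB
  have hlam : 1 ≤ lam ^ p := Real.one_le_rpow hP.one_le_lam (by linarith [hP.one_le])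
  have h₁ : ∑ _i ∈ Bᶜ, lam ^ p * (1 - κ / 4) ≤
      ∑ i, distPow p (G.point (rowAt Q D a E T i)) (G.center j (rowAt Q D a E T' i)) := by
    refine le_trans (Finset.sum_le_sum fun i hi => ?_)
      (Finset.sum_le_sum_of_subset_of_nonneg (Finset.subset_univ Bᶜ) fun i _ _ =>
        distPow_nonneg p _ _)
    refine hG.nonadj _ _ _ (length_rowAt hE hT i) (length_rowAt hE hT' i) ?_
    simpa [hB] using hi
  have hcard : ((Bᶜ).card : ℝ) = N - B.card := by
    rw [Finset.card_compl, Fintype.card_fin, Nat.cast_sub]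
    simpa using Finset.card_le_univ B
  rw [Finset.sum_const, nsmul_eq_mul, hcard] at h₁
  have hbad : (D : ℝ) * B.card ≤ 2 * z ^ 2 * N := by
    exact_mod_cast hE.card_bad hz hT hT' j h
  have hN : (1 : ℝ) ≤ N := by exact_mod_cast hE.length_pos
  have hD : (0 : ℝ) < D := by have := hE.two_le; positivity
  have hbad' : (B.card : ℝ) ≤ κ / 4 * N := by
    have := hP.large
    refine le_of_mul_le_mul_left (a := (D : ℝ)) ?_ hD
    nlinarith
  have h₂ : 0 ≤ |(G.pointLast r : ℝ) - (G.centerLast j : ℝ)| ^ p :=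
    Real.rpow_nonneg (abs_nonneg _) _
  -- The bad positions cost a factor `1 - κ / 4`, the error of the gadget another one, and their
  -- product is at least `1 - κ`.
  have h₃ : (N : ℝ) * (1 - κ) ≤ (N - B.card) * (1 - κ / 4) := by
    have : (N : ℝ) * (1 - κ / 4) * (1 - κ / 4) ≤ (N - B.card) * (1 - κ / 4) :=
      mul_le_mul_of_nonneg_right (by linarith) (by linarith)
    nlinarith [mul_pos hκ hκ, mul_nonneg (by linarith : (0 : ℝ) ≤ N) (sq_nonneg κ)]
  have h₄ : (N : ℝ) * (1 - κ) * lam ^ p ≤ (N - B.card) * (1 - κ / 4) * lam ^ p :=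
    mul_le_mul_of_nonneg_right h₃ (by linarith)
  linarith

/-- The number of points is close to a power of two. -/
theorem logLength_bounds (hE : ValidSets z D a Q E) (hP : GoodParams z D a R p lam κ) :
    0 < Real.log (E.length * R : ℕ) / Real.log 2 ∧
      Real.log (E.length * R : ℕ) / Real.log 2 ≤ (logLength a E).length ∧
      ((logLength a E).length : ℝ) ≤
        Real.log (E.length * R : ℕ) / Real.log 2 * (1 + κ / 4) := by
  have hlen : (logLength a E).length = (encodeNat E.length).length + a := by
    simp [logLength, binLength_eq]
  have hE0 : 0 < E.length := List.length_pos_iff.2 hE.ne_nil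
  have h₁ := lt_two_pow_length_encodeNat E.length
  have h₂ := two_pow_length_encodeNat_le (n := E.length) hE0.ne'
  have hn : (0 : ℝ) < (E.length * R : ℕ) := by
    have : 0 < R := by rw [hP.card_eq]; positivity
    exact_mod_cast Nat.mul_pos hE0 this
  have hlog2 : 0 < Real.log 2 := Real.log_pos (by norm_num)
  -- Let `n = |E| * 2 ^ a` be the number of points. Then `2` to the block count lies between `n` and
  -- `2 * n`, so the block count exceeds `log₂ n` by at most 1. Since `log₂ n ≥ a`, this is at most
  -- `κ / 4 * log₂ n`: the copies of the points serve to make the rounding negligible.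
  have hle : ((E.length * R : ℕ) : ℝ) ≤ 2 ^ (logLength a E).length := by
    rw [hlen, pow_add, hP.card_eq]
    push_cast
    refine mul_le_mul_of_nonneg_right ?_ (by positivity)
    exact_mod_cast h₁.le
  have hge : (2 : ℝ) ^ (logLength a E).length ≤ 2 * (E.length * R : ℕ) := by
    rw [hlen, pow_add, hP.card_eq]
    push_cast
    rw [← mul_assoc]
    refine mul_le_mul_of_nonneg_right ?_ (by positivity)
    exact_mod_cast h₂
  have hge' : (2 : ℝ) ^ a ≤ (E.length * R : ℕ) := by
    rw [hP.card_eq]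
    push_cast
    have : (1 : ℝ) ≤ E.length := by exact_mod_cast hE0
    nlinarith [pow_pos (show (0 : ℝ) < 2 by norm_num) a]
  have ha : (1 : ℝ) ≤ a := by exact_mod_cast hE.one_le
  have e₁ := Real.log_le_log hn hle
  have e₂ := Real.log_le_log (by positivity) hge
  have e₃ := Real.log_le_log (by positivity) hge'
  rw [Real.log_pow] at e₁ e₂ e₃
  rw [Real.log_mul (by norm_num) hn.ne'] at e₂
  have f₁ : (a : ℝ) ≤ Real.log (E.length * R : ℕ) / Real.log 2 := by rwa [le_div_iff₀ hlog2]
  refine ⟨by linarith, by rwa [div_le_iff₀ hlog2], ?_⟩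
  have f₂ : ((logLength a E).length : ℝ) ≤ 1 + Real.log (E.length * R : ℕ) / Real.log 2 := by
    rw [← sub_le_iff_le_add', le_div_iff₀ hlog2]
    linarith
  have := hP.large'
  have := hP.pos
  nlinarith

/-! ### Threshold, completeness and soundness of the k-means instances -/

variable {hS : G.Separates z} {hE : ValidSets z D a Q E} {k : ℕ} {hk : 1 ≤ k}
  {hk' : k ≤ E.length * z.choose y}

theorem sum_flatMap_map_finRange {A B : Type} {N : ℕ} (l : List A) (g : A → Fin N → B)
    (F : B → ℝ) : ((l.flatMap fun T => (List.finRange N).map (g T)).map F).sum =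
      (l.map fun T => ∑ r, F (g T r)).sum := by
  induction l with
  | nil => rfl
  | cons T l ih =>
    rw [List.flatMap_cons, List.map_append, List.sum_append, ih, List.map_cons, List.sum_cons,
      List.map_map, ← Fin.sum_univ_def]
    rfl

theorem n_meansInstance : (meansInstance G hS hE k hk hk').n = E.length * R := by
  rw [KMeansInstance.n, meansInstance, List.length_flatMap]
  simp

/-- The factor in the threshold. -/
noncomputable def thresholdFactor (p κ : ℝ) : ℝ := ((1 + κ) / Real.log 2) ^ (2 / p)

theorem threshold_meansInstance (hP : GoodParams z D a R p lam κ) :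
    (meansInstance G hS hE k hk hk').threshold p (thresholdFactor p κ) =
      (E.length * R : ℕ) * (Real.log (E.length * R : ℕ) / Real.log 2 * (1 + κ)) ^ (2 / p) := by
  have hlog2 : 0 < Real.log 2 := Real.log_pos (by norm_num)
  have := hP.pos
  rw [KMeansInstance.threshold, n_meansInstance, thresholdFactor, mul_comm _ ((_ : ℕ) : ℝ),
    mul_assoc, ← Real.mul_rpow (by positivity) (Real.log_natCast_nonneg _)]
  congr 2
  ring

theorem cost_eq_sum (p : ℝ) (I : KMeansInstance) (C σ) : I.cost p C σ =
    (I.points.map fun x => distPow p x (C (σ x)) ^ (2 / p)).sum := by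
  unfold KMeansInstance.cost
  simp only [lpDist_sq]
  rw [List.sum_toFinset _ I.points_nodup]

theorem cost_meansInstance (C : Fin k → Fin ((logLength a E).length * D₀ + 1) → ℚ)
    (σ : (Fin ((logLength a E).length * D₀ + 1) → ℚ) → Fin k) :
    (meansInstance G hS hE k hk hk').cost p C σ = (E.map fun T => ∑ r,
      distPow p (setPoint G D a E T r) (C (σ (setPoint G D a E T r))) ^ (2 / p)).sum := by
  exact (cost_eq_sum p _ _ _).trans (sum_flatMap_map_finRange _ _ _)

theorem exists_cost_le (hP : GoodParams z D a R p lam κ) (hG : G.Realizes p lam (κ / 4))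
    (f : Fin k → List (List Bool) × Fin (z.choose y)) (hf : ∀ i, (f i).1 ∈ E)
    (hcov : ∀ T ∈ E, ∃ i, selected [] (f i).1 (subsetAt (f i).2) ⊆ T.toFinset) :
    ∃ C, (meansInstance G hS hE k hk hk').IsChoice C ∧ ∃ σ,
      (meansInstance G hS hE k hk hk').cost p C σ ≤
        (meansInstance G hS hE k hk hk').threshold p (thresholdFactor p κ) := by
  refine ⟨fun i => setCenter G D a E (f i).1 (f i).2, fun i => ?_, ?_⟩
  · exact List.mem_flatMap.2 ⟨_, hf i, List.mem_map.2 ⟨_, List.mem_finRange _, rfl⟩⟩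
  have hp : 0 < p := by linarith [hP.one_le]
  obtain ⟨hL, -, hL₂⟩ := logLength_bounds hE hP
  set L := Real.log (E.length * R : ℕ) / Real.log 2
  -- The assignment has to be defined on all vectors; on those that are not points any index will
  -- do, and one exists because `k ≥ 1`.
  have key : ∀ x : Fin ((logLength a E).length * D₀ + 1) → ℚ, ∃ i : Fin k,
      ∀ T ∈ E, ∀ r, setPoint G D a E T r = x →
      distPow p x (setCenter G D a E (f i).1 (f i).2) ≤ L * (1 + κ) := by
    intro x
    by_cases hx : ∃ T ∈ E, ∃ r, setPoint G D a E T r = x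
    · obtain ⟨T, hT, r, rfl⟩ := hx
      obtain ⟨i, hi⟩ := hcov T hT
      refine ⟨i, fun _ _ _ _ => (distPow_le hE hP hG hT (hf i) r (f i).2 hi).trans ?_⟩
      have := hP.pos
      have := hP.lt_one
      have : ((logLength a E).length : ℝ) * (1 + κ / 2) ≤ L * (1 + κ / 4) * (1 + κ / 2) :=
        mul_le_mul_of_nonneg_right hL₂ (by linarith)
      have : (1 + κ / 4) * (1 + κ / 2) ≤ 1 + κ := by nlinarith
      nlinarith
    · exact ⟨⟨0, hk⟩, fun T hT r h => absurd ⟨T, hT, r, h⟩ hx⟩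
  choose σ hσ using key
  refine ⟨σ, ?_⟩
  refine (le_of_eq (cost_meansInstance (hS := hS) (hE := hE) (hk := hk) (hk' := hk')
    (fun i => setCenter G D a E (f i).1 (f i).2) σ)).trans ?_
  rw [threshold_meansInstance hP, ← List.sum_toFinset _ hE.nodup]
  have h : ∀ T ∈ E.toFinset, ∑ r, distPow p (setPoint G D a E T r)
      (setCenter G D a E (f (σ (setPoint G D a E T r))).1 (f (σ (setPoint G D a E T r))).2) ^
        (2 / p) ≤ R * (L * (1 + κ)) ^ (2 / p) := by
    intro T hT
    refine (Finset.sum_le_card_nsmul _ _ _ fun r _ => Real.rpow_le_rpow (distPow_nonneg p _ _)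
      (hσ _ T (List.mem_toFinset.1 hT) r rfl) (by positivity)).trans ?_
    simp
  refine (Finset.sum_le_card_nsmul _ _ _ h).trans ?_
  rw [List.toFinset_card_of_nodup hE.nodup, nsmul_eq_mul]
  change _ ≤ ((E.length * R : ℕ) : ℝ) * (L * (1 + κ)) ^ (2 / p)
  rw [Nat.cast_mul, mul_assoc]

/-- Every point costs at least about `L ^ (2 / p)`, where `L` is the binary logarithm of the number
of points, and a point of an uncovered set at least `lam ^ 2` times that. Since at most `α |E|` sets
are covered, the average factor is at least `1 + (1 - α) * (lam ^ 2 - 1)`; `hc` absorbs the errors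
in `κ`. -/
theorem le_cost (hz : 1 ≤ z) (hP : GoodParams z D a R p lam κ) (hG : G.Realizes p lam (κ / 4))
    {c : ℝ} (hc : c * (1 + κ) ^ (2 / p) ≤ (1 - κ) ^ (2 / p) * (1 + (1 - α) * (lam ^ 2 - 1)))
    (hcov : ∀ f : Fin k → List (List Bool) × Fin (z.choose y), (∀ i, (f i).1 ∈ E) →
      ((E.toFinset.filter fun T => ∃ i, selected [] (f i).1 (subsetAt (f i).2) ⊆
        T.toFinset).card : ℝ) ≤ α * E.length) :
    ∀ C, (meansInstance G hS hE k hk hk').IsChoice C → ∀ σ,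
      c * (meansInstance G hS hE k hk hk').threshold p (thresholdFactor p κ) ≤
        (meansInstance G hS hE k hk hk').cost p C σ := by
  classical
  intro (C : Fin k → Fin ((logLength a E).length * D₀ + 1) → ℚ) hC
    (σ : (Fin ((logLength a E).length * D₀ + 1) → ℚ) → Fin k)
  have hp : 0 < p := by linarith [hP.one_le]
  have hκ := hP.pos
  have hκ' := hP.lt_one
  have hlam := hP.one_le_lam
  obtain ⟨hL, hL₂, -⟩ := logLength_bounds hE hP
  have hf : ∀ i, ∃ f : List (List Bool) × Fin (z.choose y), f.1 ∈ E ∧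
      C i = setCenter G D a E f.1 f.2 := by
    intro i
    obtain ⟨T, hT, hx⟩ := List.mem_flatMap.1 (hC i)
    obtain ⟨j, -, h⟩ := List.mem_map.1 hx
    exact ⟨(T, j), hT, h.symm⟩
  choose f hfE hfC using hf
  have hcov := hcov f hfE
  rw [threshold_meansInstance hP, cost_meansInstance,
    ← List.sum_toFinset _ hE.nodup]
  set L := Real.log (E.length * R : ℕ) / Real.log 2
  set b := (L * (1 - κ)) ^ (2 / p) with hb
  have hb0 : 0 ≤ b := Real.rpow_nonneg (mul_nonneg hL.le (by linarith)) _
  set cv : List (List Bool) → Prop := fun T => ∃ i, selected [] (f i).1 (subsetAt (f i).2) ⊆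
        T.toFinset with hcv
  have hpoint : ∀ T ∈ E, ∀ r, b * (if cv T then 1 else lam ^ 2) ≤
      distPow p (setPoint G D a E T r) (C (σ (setPoint G D a E T r))) ^ (2 / p) := by
    intro T hT r
    set i := σ (setPoint G D a E T r)
    rw [hfC i]
    split_ifs with h
    · rw [mul_one, hb]
      refine Real.rpow_le_rpow (mul_nonneg hL.le (by linarith)) ?_ (by positivity)
      refine le_trans ?_ (le_distPow hE hP hG hT (hfE i) r _)
      exact mul_le_mul_of_nonneg_right hL₂ (by linarith)
    · have h₁ : lam ^ 2 = (lam ^ p) ^ (2 / p) := by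
        rw [← Real.rpow_mul (by linarith), mul_div_cancel₀ _ hp.ne']
        norm_num
      have h₂ : 0 ≤ lam ^ p := Real.rpow_nonneg (by linarith) _
      rw [h₁, hb, ← Real.mul_rpow (mul_nonneg hL.le (by linarith)) h₂]
      refine Real.rpow_le_rpow (mul_nonneg (mul_nonneg hL.le (by linarith)) h₂) ?_ (by positivity)
      refine le_trans ?_ (le_distPow_of_not_subset hz hE hP hG hT (hfE i) r _
        fun h' => h ⟨i, h'⟩)
      refine mul_le_mul_of_nonneg_right (mul_le_mul_of_nonneg_right hL₂ (by linarith)) h₂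
  have hsum : ∑ T ∈ E.toFinset, R * (b * (if cv T then 1 else lam ^ 2)) ≤
      ∑ T ∈ E.toFinset, ∑ r,
        distPow p (setPoint G D a E T r) (C (σ (setPoint G D a E T r))) ^ (2 / p) := by
    refine Finset.sum_le_sum fun T hT => ?_
    refine le_trans (le_of_eq ?_) (Finset.sum_le_sum fun r _ =>
      hpoint T (List.mem_toFinset.1 hT) r)
    simp
  refine le_trans ?_ hsum
  rw [← Finset.mul_sum, ← Finset.mul_sum]
  have hval : ∑ T ∈ E.toFinset, (if cv T then 1 else lam ^ 2) =
      (E.length : ℝ) * lam ^ 2 - (E.toFinset.filter cv).card * (lam ^ 2 - 1) := by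
    have h₁ : ∀ T, (if cv T then (1 : ℝ) else lam ^ 2) =
        lam ^ 2 - if cv T then lam ^ 2 - 1 else 0 := by
      intro T; split_ifs <;> ring
    simp only [h₁]
    rw [Finset.sum_sub_distrib, Finset.sum_const, List.toFinset_card_of_nodup hE.nodup,
      ← Finset.sum_filter, Finset.sum_const, nsmul_eq_mul, nsmul_eq_mul]
  rw [hval]
  have hval' : (E.length : ℝ) * (1 + (1 - α) * (lam ^ 2 - 1)) ≤
      (E.length : ℝ) * lam ^ 2 - (E.toFinset.filter cv).card * (lam ^ 2 - 1) := by
    have : (0 : ℝ) ≤ lam ^ 2 - 1 := by nlinarith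
    have := mul_le_mul_of_nonneg_right hcov this
    linarith
  have h₁ : (R : ℝ) * (b * (E.length * (1 + (1 - α) * (lam ^ 2 - 1)))) ≤
      R * (b * (E.length * lam ^ 2 - (E.toFinset.filter cv).card * (lam ^ 2 - 1))) := by
    gcongr
  refine le_trans ?_ h₁
  rw [hb, Real.mul_rpow hL.le (by linarith), Real.mul_rpow hL.le (by linarith)]
  have hL' : 0 ≤ L ^ (2 / p) := Real.rpow_nonneg hL.le _
  have := mul_le_mul_of_nonneg_left hc
    (mul_nonneg (Nat.cast_nonneg (α := ℝ) (E.length * R)) hL')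
  push_cast at this ⊢
  linarith

end costs

/-! ### Gap numbers -/

theorem lpDist_nonneg (p : ℝ) {d : ℕ} (a b : Fin d → ℝ) : 0 ≤ lpDist p a b :=
  Real.rpow_nonneg (Finset.sum_nonneg fun _ _ => Real.rpow_nonneg (abs_nonneg _) _) _

theorem lpDist_comm (p : ℝ) {d : ℕ} (a b : Fin d → ℝ) : lpDist p a b = lpDist p b a := by
  simp only [lpDist, abs_sub_comm]

theorem lpDist_triangle {p : ℝ} (hp : 1 ≤ p) {d : ℕ} (a b c : Fin d → ℝ) :
    lpDist p a c ≤ lpDist p a b + lpDist p b c := by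
  have := Real.Lp_add_le Finset.univ (fun i => a i - b i) (fun i => b i - c i) hp
  simpa [lpDist] using this

theorem IsGapRealization.mono {p lam lam' : ℝ} {A B : Type} {Adj : A → B → Prop} {d : ℕ}
    {τ : A ⊕ B → Fin d → ℝ} (h : IsGapRealization p lam' Adj τ) (hl : lam ≤ lam') :
    IsGapRealization p lam Adj τ := by
  obtain ⟨β, hβ, h₁, h₂⟩ := h
  exact ⟨β, hβ, h₁, fun u v huv => (mul_le_mul_of_nonneg_right hl hβ.le).trans (h₂ u v huv)⟩

theorem isGapRealization_one (p : ℝ) {A B : Type} (Adj : A → B → Prop) :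
    IsGapRealization p 1 Adj (Sum.elim (fun _ (_ : Fin 1) => 0) fun _ _ => 1) := by
  have : lpDist p (fun _ : Fin 1 => (0 : ℝ)) (fun _ => 1) = 1 := by simp [lpDist]
  exact ⟨1, one_pos, fun _ _ _ => this, fun _ _ _ => by simpa using this.ge⟩

/-- The case `lam = 1` is listed separately because it is always available, whereas no `lam ≥ 1`
lies strictly below the gap number when that equals 1. -/
theorem exists_realization {p lam : ℝ} {Δ : ℕ}
    (h : lam = 1 ∨ ENNReal.ofReal lam < gammaGap p Δ) {q t : ℕ} (ht : Δ + 1 ≤ t) (hq : t ≤ q) :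
    ∃ (d : ℕ) (τ : _ → Fin d → ℝ), IsGapRealization p lam (johnsonAdj q t (t - Δ)) τ := by
  rcases h with rfl | h
  · exact ⟨1, _, isGapRealization_one p _⟩
  · have h₁ : gammaGap p Δ ≤ gapNumber p (johnsonAdj q t (t - Δ)) :=
      iInf_le_of_le q (iInf_le_of_le t (iInf_le _ ⟨ht, hq⟩))
    obtain ⟨x, ⟨lam', -, rfl, d, τ, hτ⟩, hx⟩ := lt_sSup_iff.1 (h.trans_le h₁)
    exact ⟨d, τ, hτ.mono (le_of_not_ge fun h => hx.not_ge (ENNReal.ofReal_le_ofReal h))⟩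

theorem one_le_gammaGap (p : ℝ) (Δ : ℕ) : 1 ≤ gammaGap p Δ :=
  le_iInf fun q => le_iInf fun t => le_iInf fun _ => le_sSup
    ⟨1, le_rfl, by simp, 1, _, isGapRealization_one p _⟩

/-- In `J(Δ + 2, Δ + 1, 1)` there is a path `T, S', T', S` of three edges between non-adjacent
vertices, so the triangle inequality gives `lam * β ≤ 3 * β`. The path needs `1` to differ from the
last element, which is where `Δ ≥ 1` enters. Finiteness makes the `toReal` in `zetaTwo` meaningful.
-/
theorem gammaGap_le {p : ℝ} (hp : 1 ≤ p) {Δ : ℕ} (hΔ : 1 ≤ Δ) :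
    gammaGap p Δ ≤ ENNReal.ofReal 3 := by
  refine iInf_le_of_le (Δ + 2) (iInf_le_of_le (Δ + 1) (iInf_le_of_le ⟨le_rfl, by omega⟩ ?_))
  refine sSup_le ?_
  rintro _ ⟨lam, -, rfl, d, τ, β, hβ, h₁, h₂⟩
  refine ENNReal.ofReal_le_ofReal ?_
  have hc : Δ + 1 - Δ = 1 := by omega
  let T : {T : Finset (Fin (Δ + 2)) // T.card = Δ + 1} := ⟨{Fin.last _}ᶜ, by
    simp [Finset.card_compl]⟩
  let T' : {T : Finset (Fin (Δ + 2)) // T.card = Δ + 1} := ⟨{0}ᶜ, by simp [Finset.card_compl]⟩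
  let S : {T : Finset (Fin (Δ + 2)) // T.card = Δ + 1 - Δ} := ⟨{Fin.last _}, by simp⟩
  let S' : {T : Finset (Fin (Δ + 2)) // T.card = Δ + 1 - Δ} := ⟨{1}, by simp⟩
  have a₁ := h₁ T S' (by
    simp only [johnsonAdj, T, S', Finset.singleton_subset_iff, Finset.mem_compl,
      Finset.mem_singleton]
    intro h
    have := congrArg Fin.val h
    simp at this
    omega)
  have a₂ := h₁ T' S' (by simp [johnsonAdj, T', S'])
  have a₃ := h₁ T' S (by simp [johnsonAdj, T', S])
  have a₄ := h₂ T S (by simp [johnsonAdj, T, S])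
  have t₁ := lpDist_triangle hp (τ (Sum.inl T)) (τ (Sum.inr S')) (τ (Sum.inr S))
  have t₂ := lpDist_triangle hp (τ (Sum.inr S')) (τ (Sum.inl T')) (τ (Sum.inr S))
  rw [lpDist_comm p (τ (Sum.inr S')) (τ (Sum.inl T'))] at t₂
  refine le_of_mul_le_mul_right (a := β) ?_ hβ
  linarith

/-- The embedding of sets by their indicator vectors. -/
theorem le_gammaGap {p : ℝ} (hp : 1 ≤ p) : ENNReal.ofReal (3 ^ (1 / p)) ≤ gammaGap p 1 := by
  have hp0 : 0 < p := by linarith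
  refine le_iInf fun q => le_iInf fun t => le_iInf fun ht => le_sSup ?_
  refine ⟨3 ^ (1 / p), Real.one_le_rpow (by norm_num) (by positivity), rfl, q,
    Sum.elim (fun T i => if i ∈ T.1 then 1 else 0) (fun S i => if i ∈ S.1 then 1 else 0), 1,
    one_pos, ?_, ?_⟩
  all_goals
    rintro ⟨T, hT⟩ ⟨S, hS⟩ hTS
    simp only [johnsonAdj] at hTS
    have h : ∑ i, |(if i ∈ T then (1 : ℝ) else 0) - (if i ∈ S then (1 : ℝ) else 0)| ^ p =
        (T \ S).card + (S \ T).card := by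
      have h₁ : ∀ i, |(if i ∈ T then (1 : ℝ) else 0) - (if i ∈ S then (1 : ℝ) else 0)| ^ p =
          (if i ∈ T \ S then 1 else 0) + (if i ∈ S \ T then 1 else 0) := by
        intro i
        by_cases h : i ∈ T <;> by_cases h' : i ∈ S <;> simp [h, h', Real.zero_rpow hp0.ne']
      simp only [h₁, Finset.sum_add_distrib, Finset.sum_boole,
        Finset.filter_univ_mem]
    have hcard := Finset.card_sdiff_add_card_inter T S
    have hcard' := Finset.card_sdiff_add_card_inter S T
    rw [Finset.inter_comm] at hcard'
    simp only [lpDist, Sum.elim_inl, Sum.elim_inr, h]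
  · rw [Finset.sdiff_eq_empty_iff_subset.2 hTS] at *
    have : (T \ S).card = 1 := by
      rw [Finset.card_sdiff_of_subset hTS]
      omega
    simp [this]
  · rw [mul_one]
    refine Real.rpow_le_rpow (by norm_num) ?_ (by positivity)
    -- As `T` has one element more than `S`, the set `T \ S` has one element more than `S \ T`; once
    -- the latter is nonempty, the two have at least three elements together.
    have : 0 < (S \ T).card := Finset.card_pos.2 (Finset.sdiff_nonempty.2 hTS)
    have : 3 ≤ (T \ S).card + (S \ T).card := by omega
    exact_mod_cast this

/-! ### Existence of gadgets -/

theorem distPow_snoc (p : ℝ) {d : ℕ} (x y : Fin d → ℚ) (a b : ℚ) :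
    distPow p (Fin.snoc x a : Fin (d + 1) → ℚ) (Fin.snoc y b : Fin (d + 1) → ℚ) =
      distPow p x y + |(a : ℝ) - (b : ℝ)| ^ p := by
  simp [distPow, Fin.sum_univ_castSucc]

/-- Multiples of a small rational `η` are used as labels: they keep vectors distinct but contribute
at most `s` to the `p`-th power of a distance. -/
theorem exists_scale {p : ℝ} (hp : 1 ≤ p) (M : ℕ) {s : ℝ} (hs : 0 < s) (hs' : s ≤ 1) :
    ∃ η : ℚ, 0 < η ∧ ∀ a b : ℕ, a ≤ M → b ≤ M →
      |((η * a : ℚ) : ℝ) - ((η * b : ℚ) : ℝ)| ^ p ≤ s := by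
  obtain ⟨η, hη, hη'⟩ := exists_rat_btwn (show (0 : ℝ) < s / (M + 1) by positivity)
  have hη : (0 : ℝ) < η := by exact_mod_cast hη
  refine ⟨η, by exact_mod_cast hη, fun a b ha hb => ?_⟩
  have h₁ : |((η * a : ℚ) : ℝ) - ((η * b : ℚ) : ℝ)| ≤ s := by
    rw [lt_div_iff₀ (by positivity)] at hη'
    have ha' : (a : ℝ) ≤ M := by exact_mod_cast ha
    have hb' : (b : ℝ) ≤ M := by exact_mod_cast hb
    have := Nat.cast_nonneg (α := ℝ) a
    have := Nat.cast_nonneg (α := ℝ) b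
    push_cast
    rw [abs_le]
    constructor <;> nlinarith
  refine le_trans (Real.rpow_le_rpow (abs_nonneg _) h₁ (by linarith)) ?_
  calc s ^ p ≤ s ^ (1 : ℝ) := Real.rpow_le_rpow_of_exponent_ge hs hs' hp
    _ = s := Real.rpow_one s

/-- Rational approximations of gap realizations. -/
theorem exists_rat_realization {p lam s : ℝ} (hp : 1 ≤ p) (hlam : 1 ≤ lam) (hs : 0 < s)
    {A B : Type} [Finite A] [Finite B] {Adj : A → B → Prop} {d : ℕ} {τ : A ⊕ B → Fin d → ℝ}
    (h : IsGapRealization p lam Adj τ) :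
    ∃ θ : A ⊕ B → Fin d → ℚ,
      (∀ u v, Adj u v → |distPow p (θ (Sum.inl u)) (θ (Sum.inr v)) - 1| ≤ s) ∧
      ∀ u v, ¬ Adj u v → lam ^ p * (1 - s) ≤ distPow p (θ (Sum.inl u)) (θ (Sum.inr v)) := by
  have hp0 : 0 < p := by linarith
  obtain ⟨β, hβ, h₁, h₂⟩ := h
  let F : A → B → (A ⊕ B → Fin d → ℝ) → ℝ := fun u v θ =>
    ∑ i, |θ (Sum.inl u) i - θ (Sum.inr v) i| ^ p
  have hF : ∀ u v, Continuous (F u v) := fun u v => by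
    refine continuous_finsetSum _ fun i _ => Continuous.rpow_const ?_ fun _ => .inr hp0.le
    fun_prop
  -- Exact edge lengths are relaxed to strict inequalities. They define an open set, which contains
  -- the given realization scaled by `1 / β` and hence also a rational one.
  let U : Set (A ⊕ B → Fin d → ℝ) := {θ | ∀ u v, (Adj u v → |F u v θ - 1| < s) ∧
    (¬ Adj u v → lam ^ p * (1 - s) < F u v θ)}
  have hU : IsOpen U := by
    simp only [U, Set.ofPred_forall]
    refine isOpen_iInter_of_finite fun u => isOpen_iInter_of_finite fun v => ?_
    refine IsOpen.and ?_ ?_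
    · by_cases h : Adj u v
      · simpa [h] using isOpen_lt ((hF u v).sub continuous_const).abs continuous_const
      · simp [h]
    · by_cases h : Adj u v
      · simp [h]
      · simpa [h] using isOpen_lt continuous_const (hF u v)
  have hval : ∀ u v, F u v (fun w i => τ w i / β) =
      (lpDist p (τ (Sum.inl u)) (τ (Sum.inr v)) / β) ^ p := by
    intro u v
    have h₀ : 0 ≤ ∑ i, |τ (Sum.inl u) i - τ (Sum.inr v) i| ^ p :=
      Finset.sum_nonneg fun _ _ => Real.rpow_nonneg (abs_nonneg _) _
    rw [Real.div_rpow (lpDist_nonneg p _ _) hβ.le, lpDist, ← Real.rpow_mul h₀,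
      one_div_mul_cancel hp0.ne', Real.rpow_one, Finset.sum_div]
    refine Finset.sum_congr rfl fun i _ => ?_
    rw [← sub_div, abs_div, abs_of_pos hβ, Real.div_rpow (abs_nonneg _) hβ.le]
  have hlp : 0 < lam ^ p := Real.rpow_pos_of_pos (by linarith) _
  have hmem : (fun w i => τ w i / β) ∈ U := by
    intro u v
    refine ⟨fun h => ?_, fun h => ?_⟩
    · rw [hval, h₁ u v h, div_self hβ.ne', Real.one_rpow]
      simpa using hs
    · rw [hval]
      have : lam ^ p ≤ (lpDist p (τ (Sum.inl u)) (τ (Sum.inr v)) / β) ^ p :=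
        Real.rpow_le_rpow (by linarith) ((le_div_iff₀ hβ).2 (h₂ u v h)) hp0.le
      nlinarith
  have hd : DenseRange (Pi.map fun _ : A ⊕ B => Pi.map fun _ : Fin d => ((↑) : ℚ → ℝ)) :=
    DenseRange.piMap fun _ => DenseRange.piMap fun _ => Rat.denseRange_cast
  obtain ⟨θ, hθ⟩ := hd.exists_mem_open hU ⟨_, hmem⟩
  have hθ : ∀ u v, (Adj u v → |F u v (fun w i => (θ w i : ℝ)) - 1| < s) ∧
    (¬ Adj u v → lam ^ p * (1 - s) < F u v (fun w i => (θ w i : ℝ))) := hθ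
  exact ⟨θ, fun u v h => ((hθ u v).1 h).le, fun u v h => ((hθ u v).2 h).le⟩

/-- Different words can yield the same vertex, because order, repetitions and completion are
forgotten. A label computed from the word is therefore appended to each block; a final label
separates the copies of a point, and the centers of one set. Labels only increase distances, so the
lower bounds are unaffected, and half of `s` is reserved for the upper bound. -/
theorem exists_gadget {p lam s : ℝ} (hp : 1 ≤ p) (hlam : 1 ≤ lam) (hs : 0 < s) (hs' : s ≤ 1)
    {Q z y : ℕ} [NeZero Q] (hyz : y ≤ z) (hzQ : z ≤ Q)
    (h : ∃ (d : ℕ) (τ : _ → Fin d → ℝ), IsGapRealization p lam (johnsonAdj Q z y) τ) (R : ℕ) :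
    ∃ (D₀ : ℕ) (G : Gadget Q R (z.choose y) D₀), G.Separates z ∧ G.Realizes p lam s := by
  classical
  obtain ⟨d, τ, hτ⟩ := h
  obtain ⟨θ, hθ, hθ'⟩ := exists_rat_realization hp hlam (half_pos hs) hτ
  have hfin : {ρ : List (Fin Q) | ρ.length = z}.Finite := List.finite_length_eq _ _
  obtain ⟨M, hM⟩ := (hfin.image (Encodable.encode (α := List (Fin Q)))).bddAbove
  have hM : ∀ ρ : List (Fin Q), ρ.length = z → Encodable.encode ρ ≤ M := fun ρ hρ =>
    hM ⟨ρ, hρ, rfl⟩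
  obtain ⟨η, hη, hηs⟩ := exists_scale hp M (half_pos hs) (by linarith)
  obtain ⟨μ, hμ, hμs⟩ := exists_scale hp (R + z.choose y) hs hs'
  -- For words of length `z` the vertex has `z` letters; the value 0 is a dummy for other words.
  let tP : List (Fin Q) → Fin d → ℚ := fun ρ =>
    if h : (pointVertex z ρ).card = z then θ (Sum.inl ⟨_, h⟩) else 0
  let tC : Fin (z.choose y) → List (Fin Q) → Fin d → ℚ := fun j ρ =>
    θ (Sum.inr ⟨centerVertex j ρ, card_centerVertex (hyz.trans hzQ) j ρ⟩)
  let G : Gadget Q R (z.choose y) (d + 1) :=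
    { point := fun ρ => Fin.snoc (tP ρ) (η * (Encodable.encode ρ : ℕ))
      center := fun j ρ => Fin.snoc (tC j ρ) (η * (Encodable.encode ρ : ℕ))
      pointLast := fun r => μ * (r : ℕ)
      centerLast := fun j => μ * (j : ℕ) }
  have hinj : ∀ (t t' : Fin d → ℚ) (ρ ρ' : List (Fin Q)),
      (Fin.snoc t (η * (Encodable.encode ρ : ℕ)) : Fin (d + 1) → ℚ) =
        Fin.snoc t' (η * (Encodable.encode ρ' : ℕ)) → ρ = ρ' := by
    intro t t' ρ ρ' h
    have := congrFun h (Fin.last d)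
    simp only [Fin.snoc_last] at this
    exact Encodable.encode_injective (by exact_mod_cast mul_left_cancel₀ hη.ne' this)
  refine ⟨d + 1, G, ⟨fun ρ ρ' _ _ h => hinj _ _ _ _ h, fun j ρ ρ' _ _ h => hinj _ _ _ _ h,
    fun r r' h => ?_, fun j j' h => ?_⟩, ?_⟩
  · exact Fin.ext (by exact_mod_cast mul_left_cancel₀ hμ.ne' h)
  · exact Fin.ext (by exact_mod_cast mul_left_cancel₀ hμ.ne' h)
  have hval : ∀ ρ j ρ', distPow p (G.point ρ) (G.center j ρ') = distPow p (tP ρ) (tC j ρ') +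
      |((η * (Encodable.encode ρ : ℕ) : ℚ) : ℝ) - ((η * (Encodable.encode ρ' : ℕ) : ℚ) : ℝ)| ^ p :=
    fun ρ j ρ' => distPow_snoc _ _ _ _ _
  have htP : ∀ ρ (h : ρ.length = z), tP ρ =
      θ (Sum.inl ⟨pointVertex z ρ, card_pointVertex hzQ h⟩) := fun ρ h =>
    dif_pos (card_pointVertex hzQ h)
  have hlp : 1 ≤ lam ^ p := Real.one_le_rpow hlam (by linarith)
  have hnonadj : ∀ ρ j ρ', ρ.length = z → ρ'.length = z →
      ¬ centerVertex j ρ' ⊆ pointVertex z ρ →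
      lam ^ p * (1 - s) ≤ distPow p (G.point ρ) (G.center j ρ') := by
    intro ρ j ρ' hρ hρ' h
    rw [hval, htP ρ hρ]
    have := hθ' ⟨pointVertex z ρ, card_pointVertex hzQ hρ⟩
      ⟨centerVertex j ρ', card_centerVertex (hyz.trans hzQ) j ρ'⟩ h
    have h₀ : 0 ≤ |((η * (Encodable.encode ρ : ℕ) : ℚ) : ℝ) -
      ((η * (Encodable.encode ρ' : ℕ) : ℚ) : ℝ)| ^ p := Real.rpow_nonneg (abs_nonneg _) _
    have : lam ^ p * (1 - s) ≤ lam ^ p * (1 - s / 2) :=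
      mul_le_mul_of_nonneg_left (by linarith) (by linarith)
    simp only [tC]
    linarith
  refine ⟨fun ρ j ρ' hρ hρ' => ?_, fun ρ j ρ' hρ hρ' h => ?_, hnonadj, fun r j => ?_⟩
  · by_cases h : centerVertex j ρ' ⊆ pointVertex z ρ
    · rw [hval, htP ρ hρ]
      have := abs_le.1 (hθ ⟨pointVertex z ρ, card_pointVertex hzQ hρ⟩
        ⟨centerVertex j ρ', card_centerVertex (hyz.trans hzQ) j ρ'⟩ h)
      have h₀ : 0 ≤ |((η * (Encodable.encode ρ : ℕ) : ℚ) : ℝ) -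
        ((η * (Encodable.encode ρ' : ℕ) : ℚ) : ℝ)| ^ p := Real.rpow_nonneg (abs_nonneg _) _
      simp only [tC]
      linarith [this.1]
    · refine le_trans ?_ (hnonadj ρ j ρ' hρ hρ' h)
      nlinarith
  · rw [hval, htP ρ hρ]
    have := abs_le.1 (hθ ⟨pointVertex z ρ, card_pointVertex hzQ hρ⟩
      ⟨centerVertex j ρ', card_centerVertex (hyz.trans hzQ) j ρ'⟩ h)
    have h₀ := hηs _ _ (hM ρ hρ) (hM ρ' hρ')
    simp only [tC]
    linarith [this.2]
  · refine hμs _ _ ?_ ?_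
    · have := r.2; omega
    · have := j.2; omega

/-! ### Computing the coordinate tables -/

theorem trep_list_injective {A : Type} [TreeRep A]
    (h : Function.Injective (trep : A → STree)) : Function.Injective (trep : List A → STree) := by
  intro l
  induction l with
  | nil => intro l' h'; cases l' with
    | nil => rfl
    | cons b l' => exact absurd h' (by simp [trep_nil, trep_cons])
  | cons a l ih => intro l' h'; cases l' with
    | nil => exact absurd h' (by simp [trep_nil, trep_cons])
    | cons b l' =>
      rw [trep_cons, trep_cons] at h'
      injection h' with h₁ h₂
      rw [h h₁, ih h₂]

theorem trep_pair_injective {A B : Type} [TreeRep A] [TreeRep B]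
    (h : Function.Injective (trep : A → STree)) (h' : Function.Injective (trep : B → STree)) :
    Function.Injective (trep : A × B → STree) := by
  rintro ⟨a, b⟩ ⟨a', b'⟩ hab
  rw [trep_pair, trep_pair] at hab
  injection hab with h₁ h₂
  rw [h h₁, h' h₂]

/-- The coordinates of a gadget are written in polynomial time. -/
theorem exists_coordStrings {Q R J D₀ : ℕ} [NeZero Q] (G : Gadget Q R J D₀) (z : ℕ) :
    ∃ c : CoordStrings Q R J, PT c.point ∧ PT c.center ∧ c.Writes G z := by
  have hfin : {ρ : List (Fin Q) | ρ.length = z}.Finite := List.finite_length_eq _ _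
  have hinj : Function.Injective (trep : List (Fin Q) → STree) :=
    trep_list_injective trep_fin_injective
  have hinj' : Function.Injective (trep : Fin J × List (Fin Q) → STree) :=
    trep_pair_injective trep_fin_injective hinj
  obtain ⟨f, hf, hf'⟩ := PT.finite hinj
    (fun ρ => (List.ofFn (G.point ρ)).flatMap writeRat) hfin.toFinset.toList
  obtain ⟨g, hg, hg'⟩ := PT.finite hinj'
    (fun x : Fin J × List (Fin Q) => (List.ofFn (G.center x.1 x.2)).flatMap writeRat)
    (Finset.univ ×ˢ hfin.toFinset).toList
  refine ⟨⟨f, g, fun r => writeRat (G.pointLast r), fun j => writeRat (G.centerLast j)⟩, hf, hg,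
    ⟨fun ρ hρ => hf' ρ (by simpa using hρ), fun j ρ hρ => hg' (j, ρ) (by simpa using hρ),
      fun _ => rfl, fun _ => rfl⟩⟩

/-! ### Reading the sets of an instance of Johnson Coverage -/

/-- The key of an element of the universe. -/
def elementKey {n : ℕ} (u : Fin n) : List Bool := (encodeNat (u : ℕ)).reverse

theorem elementKey_injective {n : ℕ} : Function.Injective (elementKey (n := n)) := by
  intro u v h
  have := congrArg bitsValue (List.reverse_injective h)
  rw [bitsValue_encodeNat, bitsValue_encodeNat] at this
  exact Fin.ext this

theorem setKey_toFinset {n : ℕ} (T : Finset (Fin n)) :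
    (setKey T).toFinset = T.image elementKey := by
  ext u
  simp [setKey, elementKey]

theorem setKey_injective {n : ℕ} : Function.Injective (setKey (n := n)) := by
  intro T T' h
  have := congrArg List.toFinset h
  rw [setKey_toFinset, setKey_toFinset] at this
  exact Finset.image_injective elementKey_injective this

theorem length_setKey {n : ℕ} (T : Finset (Fin n)) : (setKey T).length = T.card := by
  simp [setKey]

theorem nodup_setKey {n : ℕ} (T : Finset (Fin n)) : (setKey T).Nodup := by
  rw [setKey, List.nodup_reverse]
  exact (Finset.sort_nodup _ _).map elementKey_injective

section johnson

variable {z y : ℕ} (I : JohnsonInstance z)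

theorem JohnsonInstance.mem_parseSets {t : List (List Bool)} :
    t ∈ parseSets I.write ↔ ∃ T ∈ I.E, setKey T = t := by
  simp [(parse_write I).1]

theorem JohnsonInstance.length_parseSets : (parseSets I.write).length = I.E.length := by
  simp [(parse_write I).1]

theorem JohnsonInstance.validSets {Q D a : ℕ} (hD : 2 ≤ D) (ha : 1 ≤ a) (hQ : Q = 2 ^ (2 * D))
    (hz : z ≤ 2 ^ a) : ValidSets z D a Q (parseSets I.write) where
  two_le := hD
  one_le := ha
  card_alphabet := hQ
  le_pow := hz
  nodup := by
    rw [(parse_write I).1, List.nodup_reverse]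
    exact I.nodup.map setKey_injective
  ne_nil := by simpa [(parse_write I).1] using I.nonempty
  length_eq := by
    intro t ht
    obtain ⟨T, hT, rfl⟩ := I.mem_parseSets.1 ht
    rw [length_setKey, I.card_eq T hT]
  nodup_set := by
    intro t ht
    obtain ⟨T, hT, rfl⟩ := I.mem_parseSets.1 ht
    exact nodup_setKey T

theorem JohnsonInstance.length_cappedUnary :
    (cappedUnary (parseSets I.write) (parseParam I.write)).length = min I.k I.E.length := by
  rw [(parse_write I).2, _root_.length_cappedUnary, bitsValue_encodeNat, I.length_parseSets]

theorem JohnsonInstance.isEmpty_parseParam : (parseParam I.write).isEmpty = decide (I.k = 0) := by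
  rw [(parse_write I).2, List.isEmpty_reverse]
  by_cases h : I.k = 0
  · rw [h]; rfl
  · have : encodeNat I.k ≠ [] := fun h' => h (by rw [← bitsValue_encodeNat I.k, h']; rfl)
    simp [h, this]

variable {I}

theorem JohnsonInstance.exists_set_of_selected {T : Finset (Fin I.n)} (hT : T ∈ I.E)
    (j : Fin (z.choose y)) : ∃ S : Finset (Fin I.n), S.card = y ∧
      S.image elementKey = selected [] (setKey T) (subsetAt j) := by
  have h := selected_subset [] (setKey T) (subsetAt j) ((length_setKey T).trans (I.card_eq T hT))
  rw [setKey_toFinset, Finset.subset_image_iff] at h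
  obtain ⟨S, -, hS⟩ := h
  refine ⟨S, ?_, hS⟩
  rw [← Finset.card_image_of_injective S elementKey_injective, hS,
    card_selected [] _ ((length_setKey T).trans (I.card_eq T hT)) (nodup_setKey T),
    card_subsetAt]

theorem JohnsonInstance.exists_selected_of_set {T : Finset (Fin I.n)} (hT : T ∈ I.E)
    {S : Finset (Fin I.n)} (hS : S.card = y) (hST : S ⊆ T) :
    ∃ j : Fin (z.choose y), selected [] (setKey T) (subsetAt j) = S.image elementKey := by
  obtain ⟨X, hX, h⟩ := exists_selected [] ((length_setKey T).trans (I.card_eq T hT))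
    (nodup_setKey T) (S := S.image elementKey)
    (by rw [setKey_toFinset]; exact Finset.image_subset_image hST)
  rw [Finset.card_image_of_injective S elementKey_injective, hS] at hX
  obtain ⟨j, rfl⟩ := exists_subsetAt hX
  exact ⟨j, h⟩

theorem image_elementKey_subset {n : ℕ} {S T : Finset (Fin n)} :
    S.image elementKey ⊆ (setKey T).toFinset ↔ S ⊆ T := by
  rw [setKey_toFinset, Finset.image_subset_image_iff elementKey_injective]

theorem mem_covFamily {n k : ℕ} {S : Fin k → Finset (Fin n)} {E : Finset (Finset (Fin n))}
    {T : Finset (Fin n)} : T ∈ covFamily S E ↔ T ∈ E ∧ ∃ i, S i ⊆ T := by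
  simp [covFamily, cov]

/-- Centers come only from subsets of members of `E`, which is no loss: a set contained in no member
covers nothing and may be replaced by any other. -/
theorem JohnsonInstance.Complete.exists_cover (h : I.Complete y) (hyz : y ≤ z) {k : ℕ}
    (hk : k = min I.k I.E.length) :
    ∃ f : Fin k → List (List Bool) × Fin (z.choose y), (∀ i, (f i).1 ∈ parseSets I.write) ∧
      ∀ t ∈ parseSets I.write, ∃ i, selected [] (f i).1 (subsetAt (f i).2) ⊆ t.toFinset := by
  obtain ⟨S, hS, hcov⟩ := h
  obtain ⟨T₀, hT₀⟩ := List.exists_mem_of_ne_nil _ I.nonempty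
  have hpos : 0 < z.choose y := Nat.choose_pos hyz
  rcases le_total I.k I.E.length with hle | hle
  · obtain rfl : k = I.k := by omega
    have key : ∀ i, ∃ x : List (List Bool) × Fin (z.choose y), x.1 ∈ parseSets I.write ∧
        ∀ T ∈ I.E, S i ⊆ T → selected [] x.1 (subsetAt x.2) ⊆ (setKey T).toFinset := by
      intro i
      by_cases hi : ∃ T ∈ I.E, S i ⊆ T
      · obtain ⟨T, hT, hST⟩ := hi
        obtain ⟨j, hj⟩ := JohnsonInstance.exists_selected_of_set hT (hS i) hST
        refine ⟨(setKey T, j), I.mem_parseSets.2 ⟨T, hT, rfl⟩, fun T' _ h' => ?_⟩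
        rw [hj]
        exact image_elementKey_subset.2 h'
      · exact ⟨(setKey T₀, ⟨0, hpos⟩), I.mem_parseSets.2 ⟨T₀, hT₀, rfl⟩,
          fun T hT h' => absurd ⟨T, hT, h'⟩ hi⟩
    choose f hf hf' using key
    refine ⟨f, hf, fun t ht => ?_⟩
    obtain ⟨T, hT, rfl⟩ := I.mem_parseSets.1 ht
    have : T ∈ covFamily S I.E.toFinset := by rw [hcov]; exact List.mem_toFinset.2 hT
    obtain ⟨-, i, hi⟩ := mem_covFamily.1 this
    exact ⟨i, hf' i T hT hi⟩
  -- With as many centers as sets, each set is covered by a subset of its own, so capping the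
  -- parameter is harmless.
  · obtain rfl : k = I.E.length := by omega
    refine ⟨fun i => ((parseSets I.write)[i]'(i.2.trans_eq I.length_parseSets.symm), ⟨0, hpos⟩),
      fun i => List.getElem_mem _, fun t ht => ?_⟩
    obtain ⟨i, hi, rfl⟩ := List.mem_iff_getElem.1 ht
    refine ⟨⟨i, I.length_parseSets ▸ hi⟩, selected_subset _ _ _ ?_⟩
    obtain ⟨T, hT, h⟩ := I.mem_parseSets.1 (List.getElem_mem hi)
    change (parseSets I.write)[i].length = z
    rw [← h, length_setKey, I.card_eq T hT]

theorem JohnsonInstance.Sound.card_le {α : ℝ} (h : I.Sound α y) {k : ℕ} (hk : 1 ≤ k)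
    (hkI : k ≤ I.k) (f : Fin k → List (List Bool) × Fin (z.choose y))
    (hf : ∀ i, (f i).1 ∈ parseSets I.write) :
    (((parseSets I.write).toFinset.filter fun t =>
      ∃ i, selected [] (f i).1 (subsetAt (f i).2) ⊆ t.toFinset).card : ℝ) ≤
      α * (parseSets I.write).length := by
  have hS : ∀ i, ∃ S : Finset (Fin I.n), S.card = y ∧
      S.image elementKey = selected [] (f i).1 (subsetAt (f i).2) := by
    intro i
    obtain ⟨T, hT, hTi⟩ := I.mem_parseSets.1 (hf i)
    rw [← hTi]
    exact JohnsonInstance.exists_set_of_selected hT _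
  choose S hSc hS using hS
  -- Soundness speaks of exactly `I.k` sets; a smaller family is padded by repeating its first
  -- member.
  let S' : Fin I.k → Finset (Fin I.n) := fun i => if h : (i : ℕ) < k then S ⟨i, h⟩ else S ⟨0, hk⟩
  have h₁ := h S' (fun i => by
    simp only [S']
    split_ifs
    · exact hSc _
    · exact hSc _)
  rw [List.toFinset_card_of_nodup I.nodup, ← I.length_parseSets] at h₁
  refine le_trans ?_ h₁
  rw [← Finset.card_image_of_injective (covFamily S' I.E.toFinset) setKey_injective]
  refine Nat.cast_le.2 (Finset.card_le_card fun t ht => ?_)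
  obtain ⟨ht, i, hi⟩ := Finset.mem_filter.1 ht
  obtain ⟨T, hT, rfl⟩ := I.mem_parseSets.1 (List.mem_toFinset.1 ht)
  refine Finset.mem_image_of_mem _ (mem_covFamily.2 ⟨List.mem_toFinset.2 hT,
    ⟨i, i.2.trans_le hkI⟩, ?_⟩)
  rw [← hS i, image_elementKey_subset] at hi
  simpa [S'] using hi

theorem JohnsonInstance.Complete.k_ne_zero (h : I.Complete y) : I.k ≠ 0 := by
  intro hk
  obtain ⟨S, -, hcov⟩ := h
  obtain ⟨T, hT⟩ := List.exists_mem_of_ne_nil _ I.nonempty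
  have : T ∈ covFamily S I.E.toFinset := by rw [hcov]; exact List.mem_toFinset.2 hT
  obtain ⟨-, i, -⟩ := mem_covFamily.1 this
  exact absurd i.2 (by omega)

end johnson

/-! ### The reduction is correct -/

/-- An instance with two points and one center far away. -/
theorem exists_expensive_instance {p : ℝ} (hp : 1 ≤ p) (c ρ : ℝ) :
    ∃ I : KMeansInstance, I.n = 2 ∧ I.d = 1 ∧ I.centers.length = 1 ∧
      ∀ C, I.IsChoice C → ∀ σ, c * I.threshold p ρ ≤ I.cost p C σ := by
  -- The point 0 is at distance `N` from the only center, and `N ≥ 1` gives `N ^ 2 ≥ N`, which is at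
  -- least the required cost.
  obtain ⟨N, hN⟩ := exists_nat_ge (max 1 (c * (ρ * (2 : ℕ) * Real.log (2 : ℕ) ^ (2 / p))))
  refine ⟨⟨1, [fun _ => 0, fun _ => 1], [fun _ => N], 1, ?_, ?_, le_rfl, le_rfl⟩, rfl, rfl, rfl, ?_⟩
  · simp [funext_iff]
  · simp
  intro C hC σ
  have hC : ∀ i, C i = fun _ => (N : ℚ) := fun i => by simpa using hC i
  have hN₁ : (1 : ℝ) ≤ N := (le_max_left _ _).trans hN
  refine ((le_max_right _ _).trans hN).trans ?_
  rw [cost_eq_sum]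
  simp only [hC, List.map_cons, List.sum_cons]
  have h₁ : distPow p (fun _ : Fin 1 => (0 : ℚ)) (fun _ => (N : ℚ)) ^ (2 / p) = (N : ℝ) ^ 2 := by
    have : p ≠ 0 := by linarith
    simp only [distPow, Finset.univ_unique, Finset.sum_singleton, Rat.cast_zero, zero_sub, abs_neg,
      Rat.cast_natCast, Nat.abs_cast]
    rw [← Real.rpow_mul (by positivity), mul_div_cancel₀ _ this]
    norm_num
  rw [h₁]
  have h₂ : 0 ≤ distPow p (fun _ : Fin 1 => (1 : ℚ)) (fun _ => (N : ℚ)) ^ (2 / p) :=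
    Real.rpow_nonneg (distPow_nonneg _ _ _) _
  simp only [List.map_nil, List.sum_nil]
  nlinarith

/-- Here `lam` and `κ` are fixed, so the alphabet, the gadget and its tables are constants of the
reduction. Instances with `k = 0` are never complete, while k-means needs `k ≥ 1`; they are sent to
a fixed expensive instance. -/
theorem kMeansHard_of_realizations {p α c lam κ : ℝ} {z y : ℕ} (hp : 1 ≤ p) (hz : 1 ≤ z)
    (hyz : y ≤ z) (hlam : 1 ≤ lam) (hκ : 0 < κ) (hκ₁ : κ < 1)
    (hc : c * (1 + κ) ^ (2 / p) ≤ (1 - κ) ^ (2 / p) * (1 + (1 - α) * (lam ^ 2 - 1)))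
    (hreal : ∀ Q, z ≤ Q →
      ∃ (d : ℕ) (τ : _ → Fin d → ℝ), IsGapRealization p lam (johnsonAdj Q z y) τ)
    (hJ : (johnsonCoverage α z y).NPHard) : KMeansHard p c := by
  obtain ⟨D', hD'⟩ := exists_nat_ge (8 * (z : ℝ) ^ 2 / κ)
  obtain ⟨a', ha'⟩ := exists_nat_ge (4 / κ)
  -- In `D`, the summand `D'` makes the fraction of bad positions small, `z` gives `z ≤ Q`, and `2`
  -- makes the code distance nontrivial. In `a`, the summand `a'` makes the rounding of the
  -- logarithm small, `z` gives both `z ≤ 2 ^ a` and `z.choose y ≤ R`, so that there are no more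
  -- centers than points, and `1` ensures at least two points.
  set D := D' + z + 2 with hD
  set a := a' + z + 1 with ha
  set Q := 2 ^ (2 * D) with hQ
  set R := 2 ^ a with hR
  have hpow : ∀ m : ℕ, m < 2 ^ m := fun m => Nat.lt_two_pow_self
  have hzQ : z ≤ Q := by have := hpow (2 * D); omega
  have hza : z ≤ 2 ^ a := by have := hpow a; omega
  have : NeZero Q := ⟨by positivity⟩
  have : NeZero R := ⟨by positivity⟩
  have : NeZero (z.choose y) := ⟨(Nat.choose_pos hyz).ne'⟩
  have hP : GoodParams z D a R p lam κ := by
    refine ⟨hp, hlam, hκ, hκ₁, ?_, ?_, rfl⟩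
    · rw [div_le_iff₀ hκ] at hD'
      have : (D' : ℝ) ≤ D := by exact_mod_cast (by omega : D' ≤ D)
      nlinarith
    · rw [div_le_iff₀ hκ] at ha'
      have : (a' : ℝ) ≤ a := by exact_mod_cast (by omega : a' ≤ a)
      nlinarith
  obtain ⟨D₀, G, hS, hG⟩ := exists_gadget hp hlam (show 0 < κ / 4 by linarith)
    (by linarith) hyz hzQ (hreal Q hzQ) R
  obtain ⟨w, hw₁, hw₂, hw⟩ := exists_coordStrings G z
  obtain ⟨B, hBn, hBd, hBc, hB⟩ := exists_expensive_instance hp c (thresholdFactor p κ)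
  have hlog2 : 0 < Real.log 2 := Real.log_pos (by norm_num)
  have hBsmall : B.Small (2 * (D₀ + 1) / Real.log 2) 1 := by
    refine ⟨hBn.ge, ?_, by rw [hBc, hBn]; norm_num⟩
    rw [hBd, hBn]
    push_cast
    rw [div_mul_cancel₀ _ hlog2.ne']
    have := Nat.cast_nonneg (α := ℝ) D₀
    linarith
  -- With `l` blocks the dimension is `l * D₀ + 1 ≤ l * (D₀ + 1)`, and `l` is at most twice the
  -- binary logarithm of the number of points.
  have hsmall : ∀ {E : List (List (List Bool))} (hE : ValidSets z D a Q E) (k hk hk'),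
      (meansInstance G hS hE k hk hk').Small (2 * (D₀ + 1) / Real.log 2) 1 := by
    intro E hE k hk hk'
    have hE0 : 0 < E.length := List.length_pos_iff.2 hE.ne_nil
    refine ⟨?_, ?_, ?_⟩
    · rw [n_meansInstance]
      have : 2 ≤ R := by
        calc 2 = 2 ^ 1 := rfl
          _ ≤ 2 ^ a := Nat.pow_le_pow_right (by norm_num) (by omega)
      nlinarith
    · rw [n_meansInstance]
      obtain ⟨h₁, -, h₂⟩ := logLength_bounds hE hP
      change (((logLength a E).length * D₀ + 1 : ℕ) : ℝ) ≤ _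
      have h₃ : (1 : ℝ) ≤ (logLength a E).length := by exact_mod_cast hE.length_pos
      have h₄ : ((logLength a E).length : ℝ) ≤
          2 * (Real.log (E.length * R : ℕ) / Real.log 2) := by nlinarith
      have h₅ := mul_le_mul_of_nonneg_right h₄ (show (0 : ℝ) ≤ D₀ + 1 by positivity)
      have h₆ : 2 * ((D₀ : ℝ) + 1) / Real.log 2 * Real.log (E.length * R : ℕ) =
          2 * (Real.log (E.length * R : ℕ) / Real.log 2) * (D₀ + 1) := by ring
      rw [h₆]
      push_cast at h₅ ⊢
      nlinarith
    · rw [n_meansInstance, pow_one]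
      change (E.flatMap fun T => (List.finRange _).map (setCenter G D a E T)).length ≤ _
      rw [List.length_flatMap]
      simp only [List.length_map, List.length_finRange, List.map_const', List.sum_replicate,
        smul_eq_mul]
      refine Nat.mul_le_mul_left _ ((Nat.choose_le_two_pow z y).trans ?_)
      exact Nat.pow_le_pow_right (by norm_num) (by omega)
  refine ⟨thresholdFactor p κ, Real.rpow_pos_of_pos (by positivity) _,
    2 * (D₀ + 1) / Real.log 2, 1, fun L hL => ?_⟩
  obtain ⟨f, hf, hfy, hfn⟩ := hJ L hL
  refine ⟨fun x => reduction w D a D₀ B.write (f x),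
    hf.comp_pt (PT.reduction_pt hQ w hw₁ hw₂ D a D₀ B.write), fun x hx => ?_, fun x hx => ?_⟩
  all_goals
    obtain ⟨I, hI, hIc⟩ : ∃ I : JohnsonInstance z, f x = I.write ∧ _ :=
      by first | exact hfy x hx | exact hfn x hx
    have hE := I.validSets (Q := Q) (by omega : 2 ≤ D) (by omega : 1 ≤ a) rfl hza
    have hlen := I.length_cappedUnary
    have hE0 : 0 < I.E.length := List.length_pos_iff.2 I.nonempty
    have hJpos := Nat.choose_pos hyz
    have hmain : I.k ≠ 0 → ∃ hk hk', reduction w D a D₀ B.write (f x) =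
        (meansInstance G hS hE (cappedUnary (parseSets I.write) (parseParam I.write)).length
          hk hk').write := by
      intro hk0
      refine ⟨by omega, ?_, ?_⟩
      · rw [hlen, I.length_parseSets]
        exact (min_le_right _ _).trans (Nat.le_mul_of_pos_right _ hJpos)
      · rw [hI, reduction, I.isEmpty_parseParam, decide_eq_false hk0, cond_false]
        exact reductionString_eq G hS hE w hw _ _ _
  · obtain ⟨hk, hk', h⟩ := hmain hIc.k_ne_zero
    obtain ⟨g, hg, hcov⟩ := hIc.exists_cover hyz hlen
    exact ⟨_, h, hsmall hE _ hk hk', exists_cost_le hP hG g hg hcov⟩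
  · by_cases hk0 : I.k = 0
    · refine ⟨B, ?_, hBsmall, hB⟩
      change reduction w D a D₀ B.write (f x) = _
      rw [hI, reduction, I.isEmpty_parseParam, decide_eq_true hk0, cond_true]
    · obtain ⟨hk, hk', h⟩ := hmain hk0
      refine ⟨_, h, hsmall hE _ hk hk', le_cost hz hP hG hc fun g hg => ?_⟩
      exact hIc.card_le hk (hlen ▸ min_le_left _ _) g hg

/-! ### The main theorem -/

/-- Both sides are continuous in `κ` at 0, where they equal `c` and `b`. -/
theorem exists_error {p b c : ℝ} (hp : 1 ≤ p) (h : c < b) : ∃ κ : ℝ, 0 < κ ∧ κ < 1 ∧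
    c * (1 + κ) ^ (2 / p) ≤ (1 - κ) ^ (2 / p) * b := by
  have hp' : 0 ≤ 2 / p := by positivity
  have hcont : ContinuousAt (fun κ : ℝ => (1 - κ) ^ (2 / p) * b - c * (1 + κ) ^ (2 / p)) 0 := by
    refine ContinuousAt.sub (ContinuousAt.mul ?_ continuousAt_const)
      (ContinuousAt.mul continuousAt_const ?_)
    · exact ContinuousAt.rpow_const (by fun_prop) (.inr hp')
    · exact ContinuousAt.rpow_const (by fun_prop) (.inr hp')
  have h₁ := hcont.eventually (lt_mem_nhds (a := 0) (by simpa using h))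
  have h₂ : ∀ᶠ κ : ℝ in nhdsWithin 0 (Set.Ioi 0), 0 < κ ∧ κ < 1 ∧
      c * (1 + κ) ^ (2 / p) ≤ (1 - κ) ^ (2 / p) * b := by
    filter_upwards [nhdsWithin_le_nhds h₁, self_mem_nhdsWithin,
      nhdsWithin_le_nhds (gt_mem_nhds (zero_lt_one (α := ℝ)))] with κ h₁ h₂ h₃
    exact ⟨h₂, h₃, by linarith⟩
  exact h₂.exists

/-- For `α ≤ 1` a value of `lam` slightly below `γ` works by continuity. For `α ≥ 1` the coefficient
`1 - α` is not positive, and `lam = 1` is already good enough, as it is when `γ = 1`. -/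
theorem exists_gap {p α ε : ℝ} (hp : 1 ≤ p) {Δ : ℕ} (hΔ : 1 ≤ Δ) (hε : 0 < ε) :
    ∃ lam : ℝ, 1 ≤ lam ∧ (lam = 1 ∨ ENNReal.ofReal lam < gammaGap p Δ) ∧
      zetaTwo p Δ α - ε < 1 + (1 - α) * (lam ^ 2 - 1) := by
  have htop : gammaGap p Δ ≠ ⊤ := ((gammaGap_le hp hΔ).trans_lt ENNReal.ofReal_lt_top).ne
  have hγ : 1 ≤ (gammaGap p Δ).toReal := by
    rw [← ENNReal.toReal_one]
    exact ENNReal.toReal_mono htop (one_le_gammaGap p Δ)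
  have hγ' : gammaGap p Δ = ENNReal.ofReal (gammaGap p Δ).toReal := (ENNReal.ofReal_toReal htop).symm
  unfold zetaTwo
  set γ := (gammaGap p Δ).toReal
  rcases hγ.eq_or_lt with h | h
  · exact ⟨1, le_rfl, .inl rfl, by rw [← h]; linarith⟩
  rcases le_total 1 α with hα | hα
  · refine ⟨1, le_rfl, .inl rfl, ?_⟩
    have : 0 ≤ (α - 1) * (γ ^ 2 - 1) := mul_nonneg (by linarith) (by nlinarith)
    nlinarith
  have hcont : ContinuousAt (fun lam : ℝ => 1 + (1 - α) * (lam ^ 2 - 1)) γ := by fun_prop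
  have h₁ := hcont.eventually (lt_mem_nhds
    (show 1 + (1 - α) * (γ ^ 2 - 1) - ε < 1 + (1 - α) * (γ ^ 2 - 1) by linarith))
  have h₂ : ∀ᶠ lam : ℝ in nhdsWithin γ (Set.Iio γ), 1 ≤ lam ∧
      (lam = 1 ∨ ENNReal.ofReal lam < gammaGap p Δ) ∧
      1 + (1 - α) * (γ ^ 2 - 1) - ε < 1 + (1 - α) * (lam ^ 2 - 1) := by
    filter_upwards [nhdsWithin_le_nhds h₁, self_mem_nhdsWithin,
      nhdsWithin_le_nhds (lt_mem_nhds h)] with lam h₁ h₂ h₃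
    refine ⟨h₃.le, .inr ?_, h₁⟩
    rw [hγ', ENNReal.ofReal_lt_ofReal_iff (by linarith)]
    exact h₂
  exact h₂.exists

theorem kMeansHard_of_johnsonCoverage {p α : ℝ} {z y : ℕ} (hp : 1 ≤ p) (hy : 1 ≤ y) (hyz : y < z)
    (hJ : (johnsonCoverage α z y).NPHard) {ε : ℝ} (hε : 0 < ε) :
    KMeansHard p (zetaTwo p (z - y) α - ε) := by
  obtain ⟨lam, hlam, hgap, hlt⟩ := exists_gap (α := α) hp (show 1 ≤ z - y by omega) hε
  obtain ⟨κ, hκ, hκ₁, hc⟩ := exists_error hp hlt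
  refine kMeansHard_of_realizations hp (by omega) hyz.le hlam hκ hκ₁ hc (fun Q hQ => ?_) hJ
  have := exists_realization hgap (show z - y + 1 ≤ z by omega) hQ
  rwa [show z - (z - y) = y by omega] at this

theorem JohnsonCoverageHypothesis.kMeansHard (h : JohnsonCoverageHypothesis) {p ε : ℝ} (hp : 1 ≤ p)
    (hε : 0 < ε) : KMeansHard p (zetaTwo p 1 (1 - 1 / Real.exp 1) - ε) := by
  -- Raising `α` by `ε / 16` lowers the factor by `ε / 16 * (γ ^ 2 - 1) ≤ ε / 2`, because `γ ≤ 3`.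
  -- The remaining slack `δ` is positive and is used as the error in the first part.
  obtain ⟨z, hz, hJ⟩ := h (ε / 16) (by linarith)
  have hγ : (gammaGap p 1).toReal ≤ 3 :=
    ENNReal.toReal_le_of_le_ofReal (by norm_num) (gammaGap_le hp le_rfl)
  have h₀ : 0 ≤ (gammaGap p 1).toReal := ENNReal.toReal_nonneg
  set δ := zetaTwo p 1 (1 - 1 / Real.exp 1 + ε / 16) - (zetaTwo p 1 (1 - 1 / Real.exp 1) - ε)
    with hδ
  have hδ0 : 0 < δ := by
    rw [hδ]
    unfold zetaTwo
    have : (gammaGap p 1).toReal ^ 2 ≤ 3 ^ 2 := pow_le_pow_left₀ h₀ hγ 2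
    have := mul_le_mul_of_nonneg_left this hε.le
    linarith
  have := kMeansHard_of_johnsonCoverage hp (by omega) (by omega) hJ hδ0
  rw [show z - (z - 1) = 1 by omega, hδ] at this
  simpa using this

theorem le_zetaTwo {p : ℝ} (hp : 1 ≤ p) :
    1 + ((3 ^ (1 / p)) ^ 2 - 1) / Real.exp 1 ≤ zetaTwo p 1 (1 - 1 / Real.exp 1) := by
  have htop : gammaGap p 1 ≠ ⊤ := ((gammaGap_le hp le_rfl).trans_lt ENNReal.ofReal_lt_top).ne
  have h := (ENNReal.ofReal_le_iff_le_toReal htop).1 (le_gammaGap hp)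
  have h₀ : (0 : ℝ) ≤ 3 ^ (1 / p) := by positivity
  have := pow_le_pow_left₀ h₀ h 2
  rw [zetaTwo, sub_sub_cancel, one_div_mul_eq_div]
  gcongr

theorem zetaTwo_one_gt : 3.94 < zetaTwo 1 1 (1 - 1 / Real.exp 1) := by
  refine lt_of_lt_of_le ?_ (le_zetaTwo le_rfl)
  have h := Real.exp_one_lt_d9
  have : 2.94 < ((3 ^ ((1 : ℝ) / 1)) ^ 2 - 1) / Real.exp 1 := by
    rw [lt_div_iff₀ (Real.exp_pos 1)]
    norm_num
    linarith
  linarith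

theorem zetaTwo_two_gt : 1.73 < zetaTwo 2 1 (1 - 1 / Real.exp 1) := by
  refine lt_of_lt_of_le ?_ (le_zetaTwo one_le_two)
  have h := Real.exp_one_lt_d9
  have h₁ : ((3 : ℝ) ^ ((1 : ℝ) / 2)) ^ 2 = 3 := by
    rw [← Real.sqrt_eq_rpow, Real.sq_sqrt (by norm_num)]
  have : 0.73 < (((3 : ℝ) ^ ((1 : ℝ) / 2)) ^ 2 - 1) / Real.exp 1 := by
    rw [h₁, lt_div_iff₀ (Real.exp_pos 1)]
    linarith
  linarith

theorem mainTheorem3 :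
    (∀ (p α : ℝ) (z y : ℕ), 1 ≤ p → 1 ≤ y → y < z → (johnsonCoverage α z y).NPHard →
      ∀ ε : ℝ, 0 < ε → KMeansHard p (zetaTwo p (z - y) α - ε)) ∧
    (JohnsonCoverageHypothesis → ∀ p : ℝ, 1 ≤ p → ∀ ε : ℝ, 0 < ε →
      KMeansHard p (zetaTwo p 1 (1 - 1 / Real.exp 1) - ε)) ∧
    (3.94 ≤ zetaTwo 1 1 (1 - 1 / Real.exp 1) ∧ 1.73 ≤ zetaTwo 2 1 (1 - 1 / Real.exp 1)) ∧
    (JohnsonCoverageHypothesis → KMeansHard 1 3.94 ∧ KMeansHard 2 1.73) := by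
  refine ⟨fun p α z y hp hy hyz hJ ε hε => kMeansHard_of_johnsonCoverage hp hy hyz hJ hε,
    fun h p hp ε hε => h.kMeansHard hp hε, ⟨zetaTwo_one_gt.le, zetaTwo_two_gt.le⟩,
    fun h => ⟨?_, ?_⟩⟩
  · have := h.kMeansHard le_rfl (sub_pos.2 zetaTwo_one_gt)
    rwa [sub_sub_cancel] at this
  · have := h.kMeansHard one_le_two (sub_pos.2 zetaTwo_two_gt)
    rwa [sub_sub_cancel] at this
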